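/- For $\beta>0$ let $\mathbf H_\beta$ be the operator in $L^2(\mathbb R^2)$ acting off the line $x=0$ as $$\mathbf H_\beta\Psi=-\frac{\partial^2\Psi}{\partial x^2}+\frac12\Big(-\frac{\partial^2\Psi}{\partial y^2}+y^2\Psi\Big),$$ with domain consisting of all $\Psi\in H^2((0,\infty)\times\mathbb R)\oplus H^2((-\infty,0)\times\mathbb R)$ such that $\mathbf H_\beta\Psi\in L^2(\mathbb R^2)$ and, for a.e. $y$, $$\Psi(0+,y)-\Psi(0-,y)=\frac{\beta}{y}\,\frac{\partial\Psi}{\partial x}(0+,y),\qquad \frac{\partial\Psi}{\partial x}(0+,y)=\frac{\partial\Psi}{\partial x}(0-,y).$$ For $\varepsilon>0$ let $\mathbf J(\varepsilon)$ be the Jacobi operator in $\ell^2(\mathbb N_0)$ generated by the matrix with zero diagonal whose only non-zero entries are $$j_{n,n-1}(\varepsilon)=j_{n-1,n}(\varepsilon)=\frac{n^{1/2}}{2(n+\varepsilon)^{1/4}(n-1+\varepsilon)^{1/4}},\qquad n\in\mathbb N=\{1,2,\dots\}.$$ For a self-adjoint operator $\mathbf A$ in a Hilbert space $\mathcal H$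 with spectral measure $E^{\mathbf A}$ put $N_+(\lambda,\mathbf A)=\dim E^{\mathbf A}((\lambda,\infty))\mathcal H$ and $N_-(\lambda,\mathbf A)=\dim E^{\mathbf A}((-\infty,\lambda))\mathcal H$. **Theorem 8.** Let $\beta>2\sqrt2$, $\mu=\frac{\beta}{2\sqrt2}$ and $\varepsilon\in(0,\frac12)$. Then $\mathbf H_\beta$ and $\mathbf J(\varepsilon)$ are self-adjoint, and $$N_-\big(\tfrac12-\varepsilon,\mathbf H_\beta\big)=N_+\big(\mu,\mathbf J(\varepsilon)\big)=N_-\big(-\mu,\mathbf J(\varepsilon)\big).$$ -/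

import Mathlib

open MeasureTheory Filter Topology Set
open scoped ENNReal ContDiff LinearPMap

namespace SmilanskySolomyak

/-! ## Spectral measures of (unbounded) self-adjoint operators -/

section Spectral

variable {H : Type*} [NormedAddCommGroup H] [InnerProductSpace ℂ H] [CompleteSpace H]

/-- A projection-valued measure on the Borel sets of `ℝ`: orthogonal projections `E S`, with
`E ℝ = 1`, countably additive in the strong operator topology.  (Multiplicativity
`E (S ∩ T) = E S * E T` and `E ∅ = 0` follow; values at non-Borel sets are irrelevant.) -/
structure ProjectionValuedMeasure (H : Type*) [NormedAddCommGroup H] [InnerProductSpace ℂ H]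
    [CompleteSpace H] where
  toFun : Set ℝ → H →L[ℂ] H
  isStarProjection : ∀ S, MeasurableSet S → IsStarProjection (toFun S)
  univ : toFun Set.univ = 1
  hasSum_iUnion : ∀ S : ℕ → Set ℝ, (∀ n, MeasurableSet (S n)) →
    Pairwise (fun m n => Disjoint (S m) (S n)) →
    ∀ u : H, HasSum (fun n => toFun (S n) u) (toFun (⋃ n, S n) u)

namespace ProjectionValuedMeasure

theorem empty_apply (E : ProjectionValuedMeasure H) (u : H) : E.toFun ∅ u = 0 := by
  have h := E.hasSum_iUnion (fun _ => ∅) (fun _ => MeasurableSet.empty) (fun _ _ _ => by simp) u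
  exact tendsto_nhds_unique tendsto_const_nhds h.summable.tendsto_atTop_zero

theorem re_inner_nonneg (E : ProjectionValuedMeasure H) (u : H) {S : Set ℝ}
    (hS : MeasurableSet S) : 0 ≤ (inner ℂ u (E.toFun S u)).re := by
  have hP := E.isStarProjection S hS
  have h1 : E.toFun S (E.toFun S u) = E.toFun S u :=
    DFunLike.congr_fun hP.isIdempotentElem.eq u
  have h2 : inner ℂ u (E.toFun S u) = inner ℂ (E.toFun S u) (E.toFun S u) := by
    have h3 := (ContinuousLinearMap.isSelfAdjoint_iff_isSymmetric.mp hP.isSelfAdjoint)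
      u (E.toFun S u)
    simp only [ContinuousLinearMap.coe_coe] at h3
    rw [h3, h1]
  rw [h2]
  exact inner_self_nonneg (𝕜 := ℂ)

/-- The scalar measure `S ↦ ⟪u, E S u⟫` (which equals `‖E S u‖ ^ 2`). -/
noncomputable def scalarMeasure (E : ProjectionValuedMeasure H) (u : H) : Measure ℝ :=
  Measure.ofMeasurable (fun S _ => ENNReal.ofReal (inner ℂ u (E.toFun S u)).re)
    (by simp [E.empty_apply u])
    (by
      intro S hS hd
      have h := E.hasSum_iUnion S hS hd u
      have h2 : HasSum (fun n => (inner ℂ u (E.toFun (S n) u)).re)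
          (inner ℂ u (E.toFun (⋃ n, S n) u)).re :=
        Complex.hasSum_re (h.mapL (innerSL ℂ u))
      rw [← h2.tsum_eq,
        ENNReal.ofReal_tsum_of_nonneg (fun n => E.re_inner_nonneg u (hS n)) h2.summable])

/-- `E` is the spectral measure of the operator `A`, i.e. `A = ∫ t dE(t)`: the domain of `A`
consists of the `u` with `∫ t² d⟪u, E(t) u⟫ < ∞`, and `⟪u, A u⟫ = ∫ t d⟪u, E(t) u⟫` there
(by polarization this determines `A`). -/
def IsSpectralMeasureOf (E : ProjectionValuedMeasure H) (A : H →ₗ.[ℂ] H) : Prop :=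
  (∀ u : H, u ∈ A.domain ↔ ∫⁻ t, ENNReal.ofReal (t ^ 2) ∂(E.scalarMeasure u) < (⊤ : ℝ≥0∞)) ∧
  ∀ u : A.domain, inner ℂ (u : H) (A u) = ((∫ t, t ∂(E.scalarMeasure (u : H)) : ℝ) : ℂ)

end ProjectionValuedMeasure

open Classical in
/-- The spectral projection `E^A(S)` of `A`, where `E^A` is the spectral measure of `A`
(for a self-adjoint `A` it exists and is unique by the spectral theorem;
the value `0` is used for operators without a spectral measure). -/
noncomputable def spectralProjection (A : H →ₗ.[ℂ] H) (S : Set ℝ) : H →L[ℂ] H :=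
  if h : ∃ E : ProjectionValuedMeasure H, E.IsSpectralMeasureOf A then h.choose.toFun S else 0

/-- `N₊(l, A) = dim E^A(l, ∞) H`, as an element of `{0, 1, 2, …, ∞}`. -/
noncomputable def Nplus (l : ℝ) (A : H →ₗ.[ℂ] H) : ℕ∞ :=
  Cardinal.toENat (Module.rank ℂ (spectralProjection A (Ioi l)).range)

/-- `N₋(l, A) = dim E^A(-∞, l) H`, as an element of `{0, 1, 2, …, ∞}`. -/
noncomputable def Nminus (l : ℝ) (A : H →ₗ.[ℂ] H) : ℕ∞ :=
  Cardinal.toENat (Module.rank ℂ (spectralProjection A (Iio l)).range)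

end Spectral

/-! ## The Jacobi operator `J(ε)` -/

/-- `j_{n,n-1}(ε) = j_{n-1,n}(ε) = n^{1/2} / (2 (n+ε)^{1/4} (n-1+ε)^{1/4})`, for `n ≥ 1`. -/
noncomputable def jacobiEntry (ε : ℝ) (n : ℕ) : ℝ :=
  (n : ℝ) ^ (1 / 2 : ℝ) / (2 * ((n : ℝ) + ε) ^ (1 / 4 : ℝ) * ((n : ℝ) - 1 + ε) ^ (1 / 4 : ℝ))

/-- The action of the Jacobi matrix with zero diagonal on sequences. -/
noncomputable def jacobiAction (ε : ℝ) (g : ℕ → ℂ) : ℕ → ℂ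
  | 0 => (jacobiEntry ε 1 : ℂ) * g 1
  | n + 1 => (jacobiEntry ε (n + 1) : ℂ) * g n + (jacobiEntry ε (n + 2) : ℂ) * g (n + 2)

theorem jacobiAction_add (ε : ℝ) (g h : ℕ → ℂ) :
    jacobiAction ε (g + h) = jacobiAction ε g + jacobiAction ε h := by
  funext n
  cases n <;> simp [jacobiAction] <;> ring

theorem jacobiAction_smul (ε : ℝ) (c : ℂ) (g : ℕ → ℂ) :
    jacobiAction ε (c • g) = c • jacobiAction ε g := by
  funext n
  cases n <;> simp [jacobiAction] <;> ring

/-- The Jacobi operator `J(ε)` in `ℓ²(ℕ₀)`, on its maximal domain `{g | J(ε) g ∈ ℓ²}`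
(which is all of `ℓ²` when `ε > 0`). -/
noncomputable def jacobiOperator (ε : ℝ) :
    lp (fun _ : ℕ => ℂ) 2 →ₗ.[ℂ] lp (fun _ : ℕ => ℂ) 2 where
  domain :=
    { carrier := {g | Memℓp (jacobiAction ε g) 2}
      zero_mem' := by
        have h : jacobiAction ε ((0 : lp (fun _ : ℕ => ℂ) 2) : ℕ → ℂ) = 0 := by
          funext n
          cases n <;> simp [jacobiAction]
        simp only [mem_ofPred_eq]
        rw [h]
        exact zero_memℓp
      add_mem' := by
        intro a b ha hb
        simp only [mem_ofPred_eq, lp.coeFn_add] at *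
        rw [jacobiAction_add]
        exact ha.add hb
      smul_mem' := by
        intro c a ha
        simp only [mem_ofPred_eq, lp.coeFn_smul] at *
        rw [jacobiAction_smul]
        exact ha.const_smul c }
  toFun :=
    { toFun := fun g => ⟨jacobiAction ε (g : lp (fun _ : ℕ => ℂ) 2), g.2⟩
      map_add' := fun a b => Subtype.ext (jacobiAction_add ε _ _)
      map_smul' := fun c a => Subtype.ext (jacobiAction_smul ε c _) }

/-! ## Sobolev functions and traces in the plane -/

/-- `g` is the weak derivative of `f` in the direction `v` on the open set `Ω`. -/
def HasWeakDeriv (Ω : Set (ℝ × ℝ)) (v : ℝ × ℝ) (f g : ℝ × ℝ → ℂ) : Prop :=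
  ∀ φ : ℝ × ℝ → ℝ, ContDiff ℝ ∞ φ → HasCompactSupport φ → tsupport φ ⊆ Ω →
    ∫ p, (fderiv ℝ φ p v) • f p = - ∫ p, φ p • g p

/-- `f` belongs to the Sobolev space `H^k(Ω) = W^{k,2}(Ω)`. -/
def MemSobolev (Ω : Set (ℝ × ℝ)) : ℕ → (ℝ × ℝ → ℂ) → Prop
  | 0, f => MemLp f 2 (volume.restrict Ω)
  | k + 1, f => MemLp f 2 (volume.restrict Ω) ∧
      ∀ v : ℝ × ℝ, ∃ g : ℝ × ℝ → ℂ, HasWeakDeriv Ω v f g ∧ MemSobolev Ω k g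

/-- The plane without the line `x = 0`.  Being the disjoint union of the two open half-planes, it
satisfies `H^k(slitPlane) = H^k((0,∞) × ℝ) ⊕ H^k((-∞,0) × ℝ)`. -/
def slitPlane : Set (ℝ × ℝ) := {p | p.1 ≠ 0}

/-- The one-sided boundary value `y ↦ f(0+, y)` (for `l = 𝓝[>] 0`) or `y ↦ f(0-, y)`
(for `l = 𝓝[<] 0`) is `g`: the slices `f(x, ·)` converge to `g` in `L²(ℝ)` along `l`, where `x` may
avoid a null set since `f` is only determined almost everywhere. -/
def HasTrace (l : Filter ℝ) (f : ℝ × ℝ → ℂ) (g : ℝ → ℂ) : Prop :=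
  MemLp g 2 ∧
    Tendsto (fun x => eLpNorm (fun y => f (x, y) - g y) 2 volume) (l ⊓ ae volume) (𝓝 0)

/-! ## The Hamiltonian `H_β` -/

/-- The Hilbert space `L²(ℝ²)`. -/
abbrev L2Plane : Type := Lp ℂ 2 (volume : Measure (ℝ × ℝ))

/-- `Ψ` is in the domain of `H_β` and `H_β Ψ = F`.  That is: `Ψ` is in `H²` of both half-planes;
`Ψ(0+,y) - Ψ(0-,y) = (β / y) ∂ₓΨ(0+,y)` and `∂ₓΨ(0+,y) = ∂ₓΨ(0-,y)`, where the one-sided values are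
called `a`, `b`, and `d`; and `F = - ∂ₓ²Ψ + (- ∂_y²Ψ + y² Ψ) / 2` off the line `x = 0`. -/
def IsHamiltonianPair (β : ℝ) (Ψ F : ℝ × ℝ → ℂ) : Prop :=
  MemSobolev slitPlane 2 Ψ ∧
  ∃ Ψx Ψy Ψxx Ψyy : ℝ × ℝ → ℂ, ∃ a b d : ℝ → ℂ,
    (MemLp Ψx 2 ∧ MemLp Ψy 2 ∧ MemLp Ψxx 2 ∧ MemLp Ψyy 2) ∧
    (HasWeakDeriv slitPlane (1, 0) Ψ Ψx ∧ HasWeakDeriv slitPlane (0, 1) Ψ Ψy ∧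
      HasWeakDeriv slitPlane (1, 0) Ψx Ψxx ∧ HasWeakDeriv slitPlane (0, 1) Ψy Ψyy) ∧
    (HasTrace (𝓝[>] 0) Ψ a ∧ HasTrace (𝓝[<] 0) Ψ b ∧
      HasTrace (𝓝[>] 0) Ψx d ∧ HasTrace (𝓝[<] 0) Ψx d) ∧
    (∀ᵐ y : ℝ, a y - b y = ((β / y : ℝ) : ℂ) * d y) ∧
    ∀ᵐ p : ℝ × ℝ, F p = - Ψxx p + (1 / 2 : ℂ) * (- Ψyy p + (p.2 : ℂ) ^ 2 * Ψ p)

theorem isOpen_slitPlane : IsOpen slitPlane :=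
  isOpen_ne_fun continuous_fst continuous_const

theorem ae_mem_slitPlane : ∀ᵐ p : ℝ × ℝ, p ∈ slitPlane := by
  have h : ∀ᵐ x : ℝ, x ≠ 0 := by simp [ae_iff]
  exact Measure.quasiMeasurePreserving_fst.ae h

theorem integrable_test_smul {Ω : Set (ℝ × ℝ)} {f : ℝ × ℝ → ℂ}
    (hf : MemLp f 2 (volume.restrict Ω)) {φ : ℝ × ℝ → ℝ} (hφ : Continuous φ)
    (hc : HasCompactSupport φ) (hs : tsupport φ ⊆ Ω) : Integrable (fun p => φ p • f p) := by
  have h1 : MemLp φ 2 (volume.restrict Ω) := (hφ.memLp_of_hasCompactSupport hc).restrict Ω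
  have h2 : IntegrableOn (fun p => φ p • f p) Ω := by
    have h3 : MemLp (φ • f) 1 (volume.restrict Ω) := hf.smul h1
    exact memLp_one_iff_integrable.mp h3
  refine (integrableOn_iff_integrable_of_support_subset ?_).mp h2
  intro p hp
  refine hs (subset_tsupport φ ?_)
  intro h0
  exact hp (by simp [h0])

theorem continuous_fderiv_test {φ : ℝ × ℝ → ℝ} (h : ContDiff ℝ ∞ φ) (v : ℝ × ℝ) :
    Continuous (fun p => fderiv ℝ φ p v) :=
  (h.continuous_fderiv (by simp)).clm_apply continuous_const

theorem hasCompactSupport_fderiv_test {φ : ℝ × ℝ → ℝ} (h : HasCompactSupport φ) (v : ℝ × ℝ) :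
    HasCompactSupport (fun p => fderiv ℝ φ p v) :=
  h.fderiv_apply ℝ v

theorem tsupport_fderiv_test {φ : ℝ × ℝ → ℝ} (v : ℝ × ℝ) :
    tsupport (fun p => fderiv ℝ φ p v) ⊆ tsupport φ :=
  tsupport_fderiv_apply_subset ℝ v

theorem HasWeakDeriv.add {Ω : Set (ℝ × ℝ)} {v : ℝ × ℝ}
    {f g f' g' : ℝ × ℝ → ℂ}
    (hf : MemLp f 2 (volume.restrict Ω)) (hg : MemLp g 2 (volume.restrict Ω))
    (hf' : MemLp f' 2 (volume.restrict Ω)) (hg' : MemLp g' 2 (volume.restrict Ω))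
    (h : HasWeakDeriv Ω v f g) (h' : HasWeakDeriv Ω v f' g') :
    HasWeakDeriv Ω v (f + f') (g + g') := by
  intro φ h1 h2 h3
  have c := continuous_fderiv_test h1 v
  have s := hasCompactSupport_fderiv_test h2 v
  have t := (tsupport_fderiv_test (φ := φ) v).trans h3
  simp only [Pi.add_apply, smul_add]
  rw [integral_add (integrable_test_smul hf c s t) (integrable_test_smul hf' c s t),
    integral_add (integrable_test_smul hg h1.continuous h2 h3)
      (integrable_test_smul hg' h1.continuous h2 h3), h φ h1 h2 h3, h' φ h1 h2 h3]
  ring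

theorem HasWeakDeriv.const_smul {Ω : Set (ℝ × ℝ)} {v : ℝ × ℝ} {f g : ℝ × ℝ → ℂ} (c : ℂ)
    (h : HasWeakDeriv Ω v f g) : HasWeakDeriv Ω v (c • f) (c • g) := by
  intro φ h1 h2 h3
  simp only [Pi.smul_apply, smul_comm _ c]
  rw [integral_smul, integral_smul, h φ h1 h2 h3, smul_neg]

theorem HasWeakDeriv.congr_left {Ω : Set (ℝ × ℝ)} {v : ℝ × ℝ} {f f' g : ℝ × ℝ → ℂ}
    (e : f =ᵐ[volume] f') (h : HasWeakDeriv Ω v f g) : HasWeakDeriv Ω v f' g := by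
  intro φ h1 h2 h3
  rw [← h φ h1 h2 h3]
  refine integral_congr_ae ?_
  filter_upwards [e] with p hp
  rw [hp]

theorem HasWeakDeriv.zero {Ω : Set (ℝ × ℝ)} {v : ℝ × ℝ} :
    HasWeakDeriv Ω v (0 : ℝ × ℝ → ℂ) (0 : ℝ × ℝ → ℂ) := by
  intro φ _ _ _
  simp

theorem HasWeakDeriv.ae_eq_zero {v : ℝ × ℝ} {f g : ℝ × ℝ → ℂ} (hg : MemLp g 2)
    (e : f =ᵐ[volume] 0) (h : HasWeakDeriv slitPlane v f g) : g =ᵐ[volume] 0 := by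
  have h0 : ∀ᵐ p : ℝ × ℝ, p ∈ slitPlane → g p = 0 := by
    refine isOpen_slitPlane.ae_eq_zero_of_integral_contDiff_smul_eq_zero
      ((hg.locallyIntegrable (by norm_num)).locallyIntegrableOn _) ?_
    intro φ h1 h2 h3
    have h4 := (h.congr_left e) φ h1 h2 h3
    simpa using h4.symm
  filter_upwards [h0, ae_mem_slitPlane] with p hp hm using hp hm

theorem MemSobolev.memLp {Ω : Set (ℝ × ℝ)} {k : ℕ} {f : ℝ × ℝ → ℂ} (h : MemSobolev Ω k f) :
    MemLp f 2 (volume.restrict Ω) := by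
  cases k with
  | zero => exact h
  | succ k => exact h.1

theorem MemSobolev.zero {Ω : Set (ℝ × ℝ)} (k : ℕ) : MemSobolev Ω k 0 := by
  induction k with
  | zero => exact MemLp.zero
  | succ k ih => exact ⟨MemLp.zero, fun v => ⟨0, HasWeakDeriv.zero, ih⟩⟩

theorem MemSobolev.add {Ω : Set (ℝ × ℝ)} {k : ℕ} {f g : ℝ × ℝ → ℂ}
    (hf : MemSobolev Ω k f) (hg : MemSobolev Ω k g) : MemSobolev Ω k (f + g) := by
  induction k generalizing f g with
  | zero => exact MemLp.add hf hg
  | succ k ih =>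
    refine ⟨hf.1.add hg.1, fun v => ?_⟩
    obtain ⟨f', h1, h2⟩ := hf.2 v
    obtain ⟨g', h3, h4⟩ := hg.2 v
    exact ⟨f' + g', h1.add hf.1 h2.memLp hg.1 h4.memLp h3, ih h2 h4⟩

theorem MemSobolev.const_smul {Ω : Set (ℝ × ℝ)} {k : ℕ} {f : ℝ × ℝ → ℂ} (c : ℂ)
    (hf : MemSobolev Ω k f) : MemSobolev Ω k (c • f) := by
  induction k generalizing f with
  | zero => exact MemLp.const_smul hf c
  | succ k ih =>
    refine ⟨hf.1.const_smul c, fun v => ?_⟩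
    obtain ⟨f', h1, h2⟩ := hf.2 v
    exact ⟨c • f', h1.const_smul c, ih h2⟩

theorem MemSobolev.congr {Ω : Set (ℝ × ℝ)} {k : ℕ} {f f' : ℝ × ℝ → ℂ}
    (e : f =ᵐ[volume] f') (hf : MemSobolev Ω k f) : MemSobolev Ω k f' := by
  cases k with
  | zero => exact (memLp_congr_ae (ae_restrict_of_ae e)).mp hf
  | succ k =>
    refine ⟨(memLp_congr_ae (ae_restrict_of_ae e)).mp hf.1, fun v => ?_⟩
    obtain ⟨f', h1, h2⟩ := hf.2 v
    exact ⟨f', h1.congr_left e, h2⟩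

theorem HasTrace.congr {l : Filter ℝ} {f f' : ℝ × ℝ → ℂ} {g : ℝ → ℂ}
    (e : f =ᵐ[volume] f') (h : HasTrace l f g) : HasTrace l f' g := by
  refine ⟨h.1, h.2.congr' ?_⟩
  refine Filter.Eventually.filter_mono inf_le_right ?_
  filter_upwards [Measure.ae_ae_of_ae_prod e] with x hx
  refine eLpNorm_congr_ae ?_
  filter_upwards [hx] with y hy
  rw [hy]

theorem HasTrace.zero {l : Filter ℝ} : HasTrace l (0 : ℝ × ℝ → ℂ) 0 := by
  refine ⟨MemLp.zero, ?_⟩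
  simpa using tendsto_const_nhds

theorem HasTrace.const_smul {l : Filter ℝ} {f : ℝ × ℝ → ℂ} {g : ℝ → ℂ} (c : ℂ)
    (h : HasTrace l f g) : HasTrace l (c • f) (c • g) := by
  refine ⟨h.1.const_smul c, ?_⟩
  have h2 : (fun x => eLpNorm (fun y => (c • f) (x, y) - (c • g) y) 2 volume) =
      fun x => ‖c‖ₑ * eLpNorm (fun y => f (x, y) - g y) 2 volume := by
    funext x
    rw [← eLpNorm_const_smul]
    congr 1
    funext y
    simp [mul_sub]
  rw [h2]
  simpa using ENNReal.Tendsto.const_mul h.2 (Or.inr (by simp : ‖c‖ₑ ≠ ⊤))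

theorem HasTrace.add {l : Filter ℝ} {f f' : ℝ × ℝ → ℂ} {g g' : ℝ → ℂ}
    (hf : AEStronglyMeasurable f) (hf' : AEStronglyMeasurable f')
    (h : HasTrace l f g) (h' : HasTrace l f' g') : HasTrace l (f + f') (g + g') := by
  refine ⟨h.1.add h'.1, ?_⟩
  have h2 := h.2.add h'.2
  rw [add_zero] at h2
  refine tendsto_of_tendsto_of_tendsto_of_le_of_le' tendsto_const_nhds h2
    (Eventually.of_forall fun _ => bot_le) ?_
  refine Filter.Eventually.filter_mono inf_le_right ?_
  filter_upwards [hf.prodMk_left, hf'.prodMk_left] with x hx hx'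
  refine le_trans (le_of_eq ?_) (eLpNorm_add_le (hx.sub h.1.1) (hx'.sub h'.1.1) (by norm_num))
  congr 1
  funext y
  simp only [Pi.add_apply]
  ring

theorem IsHamiltonianPair.congr {β : ℝ} {Ψ Ψ' F F' : ℝ × ℝ → ℂ} (e : Ψ =ᵐ[volume] Ψ')
    (e' : F =ᵐ[volume] F') (h : IsHamiltonianPair β Ψ F) : IsHamiltonianPair β Ψ' F' := by
  obtain ⟨hs, Ψx, Ψy, Ψxx, Ψyy, a, b, d, hm, ⟨w1, w2, w3, w4⟩, ⟨t1, t2, t3, t4⟩, hc, hF⟩ := h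
  refine ⟨hs.congr e, Ψx, Ψy, Ψxx, Ψyy, a, b, d, hm,
    ⟨w1.congr_left e, w2.congr_left e, w3, w4⟩, ⟨t1.congr e, t2.congr e, t3, t4⟩, hc, ?_⟩
  filter_upwards [e, e', hF] with p h1 h2 h3
  rw [← h1, ← h2, h3]

theorem IsHamiltonianPair.zero (β : ℝ) : IsHamiltonianPair β 0 0 :=
  ⟨MemSobolev.zero 2, 0, 0, 0, 0, 0, 0, 0, ⟨MemLp.zero, MemLp.zero, MemLp.zero, MemLp.zero⟩,
    ⟨HasWeakDeriv.zero, HasWeakDeriv.zero, HasWeakDeriv.zero, HasWeakDeriv.zero⟩,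
    ⟨HasTrace.zero, HasTrace.zero, HasTrace.zero, HasTrace.zero⟩, by simp, by simp⟩

theorem IsHamiltonianPair.add {β : ℝ} {Ψ Ψ' F F' : ℝ × ℝ → ℂ}
    (mΨ : MemLp Ψ 2) (mΨ' : MemLp Ψ' 2)
    (h : IsHamiltonianPair β Ψ F) (h' : IsHamiltonianPair β Ψ' F') :
    IsHamiltonianPair β (Ψ + Ψ') (F + F') := by
  obtain ⟨hs, Ψx, Ψy, Ψxx, Ψyy, a, b, d, ⟨m1, m2, m3, m4⟩, ⟨w1, w2, w3, w4⟩,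
    ⟨t1, t2, t3, t4⟩, hc, hF⟩ := h
  obtain ⟨hs', Ψx', Ψy', Ψxx', Ψyy', a', b', d', ⟨m1', m2', m3', m4'⟩, ⟨w1', w2', w3', w4'⟩,
    ⟨t1', t2', t3', t4'⟩, hc', hF'⟩ := h'
  refine ⟨hs.add hs', Ψx + Ψx', Ψy + Ψy', Ψxx + Ψxx', Ψyy + Ψyy', a + a', b + b', d + d',
    ⟨m1.add m1', m2.add m2', m3.add m3', m4.add m4'⟩,
    ⟨w1.add (mΨ.restrict _) (m1.restrict _) (mΨ'.restrict _) (m1'.restrict _) w1',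
      w2.add (mΨ.restrict _) (m2.restrict _) (mΨ'.restrict _) (m2'.restrict _) w2',
      w3.add (m1.restrict _) (m3.restrict _) (m1'.restrict _) (m3'.restrict _) w3',
      w4.add (m2.restrict _) (m4.restrict _) (m2'.restrict _) (m4'.restrict _) w4'⟩,
    ⟨t1.add mΨ.1 mΨ'.1 t1', t2.add mΨ.1 mΨ'.1 t2', t3.add m1.1 m1'.1 t3',
      t4.add m1.1 m1'.1 t4'⟩, ?_, ?_⟩
  · filter_upwards [hc, hc'] with y h1 h2
    simp only [Pi.add_apply]
    linear_combination h1 + h2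
  · filter_upwards [hF, hF'] with p h1 h2
    simp only [Pi.add_apply]
    rw [h1, h2]
    ring

theorem IsHamiltonianPair.const_smul {β : ℝ} {Ψ F : ℝ × ℝ → ℂ} (c : ℂ)
    (h : IsHamiltonianPair β Ψ F) : IsHamiltonianPair β (c • Ψ) (c • F) := by
  obtain ⟨hs, Ψx, Ψy, Ψxx, Ψyy, a, b, d, ⟨m1, m2, m3, m4⟩, ⟨w1, w2, w3, w4⟩,
    ⟨t1, t2, t3, t4⟩, hc, hF⟩ := h
  refine ⟨hs.const_smul c, c • Ψx, c • Ψy, c • Ψxx, c • Ψyy, c • a, c • b, c • d,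
    ⟨m1.const_smul c, m2.const_smul c, m3.const_smul c, m4.const_smul c⟩,
    ⟨w1.const_smul c, w2.const_smul c, w3.const_smul c, w4.const_smul c⟩,
    ⟨t1.const_smul c, t2.const_smul c, t3.const_smul c, t4.const_smul c⟩, ?_, ?_⟩
  · filter_upwards [hc] with y h1
    simp only [Pi.smul_apply, smul_eq_mul]
    linear_combination c * h1
  · filter_upwards [hF] with p h1
    simp only [Pi.smul_apply, smul_eq_mul]
    rw [h1]
    ring

/-- The graph of `H_β`. -/
def hamiltonianGraph (β : ℝ) : Submodule ℂ (L2Plane × L2Plane) where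
  carrier := {q | IsHamiltonianPair β q.1 q.2}
  zero_mem' := (IsHamiltonianPair.zero β).congr (Lp.coeFn_zero ℂ 2 _).symm
    (Lp.coeFn_zero ℂ 2 _).symm
  add_mem' := fun {q r} hq hr => (hq.add (Lp.memLp q.1) (Lp.memLp r.1) hr).congr
    (Lp.coeFn_add q.1 r.1).symm (Lp.coeFn_add q.2 r.2).symm
  smul_mem' := fun c q hq => (IsHamiltonianPair.const_smul c hq).congr
    (Lp.coeFn_smul c q.1).symm (Lp.coeFn_smul c q.2).symm

theorem hamiltonianGraph_singleValued (β : ℝ) (q : L2Plane × L2Plane)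
    (hq : q ∈ hamiltonianGraph β) (h0 : q.1 = 0) : q.2 = 0 := by
  obtain ⟨-, Ψx, Ψy, Ψxx, Ψyy, a, b, d, ⟨m1, m2, m3, m4⟩, ⟨w1, w2, w3, w4⟩, -, -, hF⟩ := hq
  have e : (q.1 : ℝ × ℝ → ℂ) =ᵐ[volume] 0 := by
    rw [h0]
    exact Lp.coeFn_zero ℂ 2 _
  have e3 := w3.ae_eq_zero m3 (w1.ae_eq_zero m1 e)
  have e4 := w4.ae_eq_zero m4 (w2.ae_eq_zero m2 e)
  refine (Lp.eq_zero_iff_ae_eq_zero).mpr ?_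
  filter_upwards [e, e3, e4, hF] with p h1 h2 h3 h4
  rw [h4, h1, h2, h3]
  simp

/-- The Hamiltonian `H_β` as an (unbounded) operator in `L²(ℝ²)`. -/
noncomputable def hamiltonian (β : ℝ) : L2Plane →ₗ.[ℂ] L2Plane :=
  (hamiltonianGraph β).toLinearPMap

/-- `hamiltonian β` is the operator with the graph described by `IsHamiltonianPair`. -/
theorem mem_graph_hamiltonian (β : ℝ) (Ψ F : L2Plane) :
    (Ψ, F) ∈ (hamiltonian β).graph ↔ IsHamiltonianPair β Ψ F := by
  rw [hamiltonian, Submodule.toLinearPMap_graph_eq _ (hamiltonianGraph_singleValued β)]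
  rfl

end SmilanskySolomyak

namespace SmilanskySolomyak

/-! ## The spectral theorem -/

section BoundedSpectral

variable {H : Type*} [NormedAddCommGroup H] [InnerProductSpace ℂ H] [CompleteSpace H]
variable {T : H →L[ℂ] H} (hT : IsSelfAdjoint T)

/-! Expanding Ψ = Σ uₙ(x) χₙ(y) in Hermite functions decouples H_β off the line x = 0 into fₙ =
-uₙ'' + (n + 1/2) uₙ. Let aₙ, bₙ be the values of uₙ at 0+, 0- and dₙ the common value of uₙ'.
Multiplication by y acts on Hermite coefficients through the ladder weights √(n/2), so the interface
condition, written as β d = y (a - b), couples only neighbouring indices: β dₙ = √((n+1)/2) (aₙ₊₁ -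
bₙ₊₁) + √(n/2) (aₙ₋₁ - bₙ₋₁). By `mem_graph_hamiltonian_iff` this system describes the graph of H_β
exactly.

Put Dₙ = (n+ε)^(1/4) (aₙ - bₙ) / 2. Green's formula gives (`FormData.inner_eq`) ⟪u, (H_β - (1/2 -
ε)) u⟫ = ‖u'‖² + ‖(n+ε)^(1/2) u‖² + (4√2/β) ⟪D, J(ε) D⟫. The trace inequality bounds the first two
terms below by 2‖D‖² (`norm_jump_sq_le`), with equality when uₙ is a multiple of sign(x)
exp(-(n+ε)^(1/2) |x|). For fixed D the infimum of the form is therefore 2‖D‖² + (4√2/β) ⟪D, J(ε) D⟫,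
which is negative exactly when ⟪D, J(ε) D⟫ < -μ ‖D‖². So the two operators have equally many
negative directions. Passing from u to D is linear (`isPositiveForm_jacobi_of_hamiltonian`).
Conversely, the optimal exponentials violate the condition on dₙ, but derivative values at a point
are invisible to the energy norm and can be corrected at arbitrarily small cost (`exists_trial`,
`isPositiveForm_hamiltonian_of_jacobi`).

Spectral dimensions are read off from forms by Glazman's lemma
(`ProjectionValuedMeasure.le_rank_iff`): the dimension is at least k iff some k vectors of the
domain make the relevant form positive definite. This condition is strict, hence stable under
approximation (`IsPositiveForm.eventually`). The equality of N₊(μ) and N₋(-μ) for J(ε) holds because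
the diagonal vanishes: conjugation by (-1)ⁿ turns J(ε) into -J(ε).

Self-adjointness and the spectral measure both follow from symmetry together with surjectivity of A
- z at one real z (`isSelfAdjoint_of_surjective`, `exists_isSpectralMeasureOf`). For H_β the point
is z = -3/2. The decoupled equations are solved without a jump, odd exponentials are added, and
their coefficients satisfy a band equation with diagonal β and off-diagonal part of norm at most
2√2, invertible because β > 2√2 (`exists_band_solution`). -/

theorem cfcHom_symm (f : C(spectrum ℝ T, ℝ)) (u v : H) :
    inner ℂ (cfcHom hT f u) v = inner ℂ u (cfcHom hT f v) := by
  have h : IsSelfAdjoint (cfcHom hT f) := by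
    rw [IsSelfAdjoint, ← map_star]
    congr 1
  exact (ContinuousLinearMap.isSelfAdjoint_iff_isSymmetric.mp h) u v

theorem cfcHom_norm_sq (f : C(spectrum ℝ T, ℝ)) (u : H) :
    (inner ℂ u (cfcHom hT (f * f) u)).re = ‖cfcHom hT f u‖ ^ 2 := by
  rw [map_mul, mul_apply_eq_comp, ← cfcHom_symm hT, inner_self_eq_norm_sq_to_K]
  norm_cast

/-- A nonnegative continuous function is the square of its root, so its form is a squared norm. -/
theorem cfcHom_re_inner_nonneg {f : C(spectrum ℝ T, ℝ)} (hf : ∀ x, 0 ≤ f x) (u : H) :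
    0 ≤ (inner ℂ u (cfcHom hT f u)).re := by
  let g : C(spectrum ℝ T, ℝ) := ⟨fun x => Real.sqrt (f x), by fun_prop⟩
  have h : f = g * g := by
    ext x
    exact (Real.mul_self_sqrt (hf x)).symm
  rw [h, cfcHom_norm_sq]
  positivity

/-- The functional f ↦ Re ⟪u, f(T) u⟫ is positive on continuous functions on the compact spectrum,
so the Riesz–Markov theorem represents it by a measure. -/
theorem exists_vectorMeasure (u : H) : ∃ μ : Measure (spectrum ℝ T), IsFiniteMeasure μ ∧
    ∀ f : C(spectrum ℝ T, ℝ), ∫ x, f x ∂μ = (inner ℂ u (cfcHom hT f u)).re := by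
  have : CompactSpace (spectrum ℝ T) := inferInstance
  let Λ : CompactlySupportedContinuousMap (spectrum ℝ T) ℝ →ₚ[ℝ] ℝ :=
    { toFun := fun g => (inner ℂ u (cfcHom hT g.toContinuousMap u)).re
      map_add' := fun g g' => by
        have : (g + g').toContinuousMap = g.toContinuousMap + g'.toContinuousMap := rfl
        rw [this, map_add]
        simp
      map_smul' := fun c g => by
        have : (c • g).toContinuousMap = c • g.toContinuousMap := rfl
        rw [this, map_smul]
        have h2 : (c • cfcHom hT g.toContinuousMap) u
          = (c : ℂ) • (cfcHom hT g.toContinuousMap u) := by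
          simp
        rw [h2, inner_smul_right]
        simp
      monotone' := fun g g' h => by
        have h1 := cfcHom_re_inner_nonneg hT (f := g'.toContinuousMap - g.toContinuousMap)
          (fun x => sub_nonneg.mpr (h x)) u
        rw [map_sub] at h1
        simp only [sub_apply, inner_sub_right, Complex.sub_re] at h1
        exact sub_nonneg.mp h1 }
  refine ⟨RealRMK.rieszMeasure Λ, inferInstance, fun f => ?_⟩
  exact RealRMK.integral_rieszMeasure Λ ⟨f, HasCompactSupport.of_compactSpace _⟩

/-- The measure `μ` on the spectrum with `∫ f dμ = ⟪u, f(T) u⟫`. -/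
noncomputable def vectorMeasureAt (u : H) : Measure (spectrum ℝ T) :=
  (exists_vectorMeasure hT u).choose

instance (u : H) : IsFiniteMeasure (vectorMeasureAt hT u) :=
  (exists_vectorMeasure hT u).choose_spec.1

theorem integral_vectorMeasureAt (u : H) (f : C(spectrum ℝ T, ℝ)) :
    ∫ x, f x ∂(vectorMeasureAt hT u) = (inner ℂ u (cfcHom hT f u)).re :=
  (exists_vectorMeasure hT u).choose_spec.2 f

theorem vectorMeasureAt_univ (u : H) : (vectorMeasureAt hT u).real Set.univ = ‖u‖ ^ 2 := by
  have h := integral_vectorMeasureAt hT u 1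
  rw [map_one] at h
  simp only [ContinuousMap.one_apply, integral_const, smul_eq_mul, mul_one,
    one_apply_eq_self] at h
  rw [h, inner_self_eq_norm_sq_to_K]
  norm_cast

theorem memLp_continuous {ν : Measure (spectrum ℝ T)} [IsFiniteMeasure ν]
    (f : C(spectrum ℝ T, ℝ)) : MemLp f 2 ν := by
  obtain ⟨C, hC⟩ := (isCompact_range f.continuous).isBounded.exists_norm_le
  exact MemLp.of_bound f.continuous.aestronglyMeasurable C
    (Eventually.of_forall fun x => hC _ ⟨x, rfl⟩)

/-- Both squared norms equal ∫ f² dμ. This isometry is what extends f ↦ f(T) u from continuous f to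
all of L²(μ). -/
theorem norm_toLp_continuous (u : H) (f : C(spectrum ℝ T, ℝ)) :
    ‖cfcHom hT f u‖ = ‖ContinuousMap.toLp 2 (vectorMeasureAt hT u) ℝ f‖ := by
  have h1 : ‖ContinuousMap.toLp 2 (vectorMeasureAt hT u) ℝ f‖ ^ 2 = ‖cfcHom hT f u‖ ^ 2 := by
    rw [← cfcHom_norm_sq, ← integral_vectorMeasureAt, ← real_inner_self_eq_norm_sq, L2.inner_def]
    refine integral_congr_ae ?_
    filter_upwards [ContinuousMap.coeFn_toLp (𝕜 := ℝ) (p := 2) (vectorMeasureAt hT u) f] with x hx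
    rw [hx]
    simp [sq]
  exact ((pow_left_inj₀ (norm_nonneg _) (norm_nonneg _) two_ne_zero).mp h1).symm

/-- `f ↦ f(T) u` on continuous functions, as a real-linear map. -/
noncomputable def cfcApply (u : H) : C(spectrum ℝ T, ℝ) →ₗ[ℝ] H where
  toFun f := cfcHom hT f u
  map_add' f g := by simp
  map_smul' c f := by simp

/-- `g ↦ g(T) u` for `g` in `L²` of the measure at `u`. -/
noncomputable def lpApply (u : H) : Lp ℝ 2 (vectorMeasureAt hT u) →L[ℝ] H :=
  (cfcApply hT u).extendOfNorm
    (ContinuousMap.toLp (E := ℝ) 2 (vectorMeasureAt hT u) ℝ).toLinearMap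

theorem lpApply_toLp (u : H) (f : C(spectrum ℝ T, ℝ)) :
    lpApply hT u (ContinuousMap.toLp 2 (vectorMeasureAt hT u) ℝ f) = cfcHom hT f u :=
  LinearMap.extendOfNorm_eq (f := cfcApply hT u)
    (e := (ContinuousMap.toLp (E := ℝ) 2 (vectorMeasureAt hT u) ℝ).toLinearMap)
    (ContinuousMap.toLp_denseRange (𝕜 := ℝ) (E := ℝ) (p := 2) (μ := vectorMeasureAt hT u)
      (by norm_num)) ⟨1, fun f => by
      rw [one_mul]
      exact (norm_toLp_continuous hT u f).le⟩ f

theorem norm_lpApply (u : H) (g : Lp ℝ 2 (vectorMeasureAt hT u)) : ‖lpApply hT u g‖ = ‖g‖ := by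
  refine (ContinuousMap.toLp_denseRange (𝕜 := ℝ) (E := ℝ) (p := 2) (μ := vectorMeasureAt hT u)
      (by norm_num)).induction_on (p := fun g => ‖lpApply hT u g‖ = ‖g‖) g ?_ ?_
  · exact isClosed_eq (lpApply hT u).continuous.norm continuous_norm
  · intro f
    rw [lpApply_toLp, norm_toLp_continuous]

open Classical in
/-- `g(T) u` for measurable `g`, square integrable with respect to the measure at `u`. -/
noncomputable def borelApply (u : H) (g : spectrum ℝ T → ℝ) : H :=
  if h : MemLp g 2 (vectorMeasureAt hT u) then lpApply hT u (h.toLp g) else 0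

theorem borelApply_add (u : H) {g g' : spectrum ℝ T → ℝ} (h : MemLp g 2 (vectorMeasureAt hT u))
    (h' : MemLp g' 2 (vectorMeasureAt hT u)) :
    borelApply hT u (g + g') = borelApply hT u g + borelApply hT u g' := by
  rw [borelApply, borelApply, borelApply, dif_pos h, dif_pos h', dif_pos (h.add h'),
    MemLp.toLp_add, map_add]

theorem borelApply_congr (u : H) {g g' : spectrum ℝ T → ℝ} (h : MemLp g 2 (vectorMeasureAt hT u))
    (e : g =ᵐ[vectorMeasureAt hT u] g') : borelApply hT u g = borelApply hT u g' := by
  have h' : MemLp g' 2 (vectorMeasureAt hT u) := (memLp_congr_ae e).mp h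
  rw [borelApply, borelApply, dif_pos h, dif_pos h', (MemLp.toLp_eq_toLp_iff h h').mpr e]

theorem borelApply_continuous (u : H) (f : C(spectrum ℝ T, ℝ)) :
    borelApply hT u f = cfcHom hT f u := by
  rw [borelApply, dif_pos (memLp_continuous f), ← lpApply_toLp]
  rfl

theorem norm_borelApply_sq (u : H) {g : spectrum ℝ T → ℝ}
    (h : MemLp g 2 (vectorMeasureAt hT u)) :
    ‖borelApply hT u g‖ ^ 2 = ∫ x, g x ^ 2 ∂(vectorMeasureAt hT u) := by
  rw [borelApply, dif_pos h, norm_lpApply, ← real_inner_self_eq_norm_sq, L2.inner_def]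
  refine integral_congr_ae ?_
  filter_upwards [h.coeFn_toLp] with x hx
  rw [hx]
  simp [sq]

theorem tendsto_borelApply (u : H) {g : spectrum ℝ T → ℝ}
    (h : MemLp g 2 (vectorMeasureAt hT u)) {f : ℕ → C(spectrum ℝ T, ℝ)}
    (hf : Tendsto (fun n => eLpNorm (fun x => f n x - g x) 2 (vectorMeasureAt hT u)) atTop (𝓝 0)) :
    Tendsto (fun n => cfcHom hT (f n) u) atTop (𝓝 (borelApply hT u g)) := by
  have h1 : Tendsto (fun n => ContinuousMap.toLp (E := ℝ) 2 (vectorMeasureAt hT u) ℝ (f n)) atTop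
      (𝓝 (h.toLp g)) := by
    rw [Lp.tendsto_Lp_iff_tendsto_eLpNorm']
    refine hf.congr fun n => eLpNorm_congr_ae ?_
    filter_upwards [ContinuousMap.coeFn_toLp (𝕜 := ℝ) (p := 2) (vectorMeasureAt hT u) (f n),
      h.coeFn_toLp] with x h1 h2
    rw [Pi.sub_apply, h1, h2]
  have h2 := ((lpApply hT u).continuous.tendsto _).comp h1
  rw [borelApply, dif_pos h]
  refine h2.congr fun n => ?_
  exact lpApply_toLp hT u (f n)

/-- One sequence approximates g simultaneously for every measure below ν. Taking ν to be a sum of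
vector measures, linearity and symmetry in the vectors pass to the limit from f(T). -/
theorem exists_continuous_approx {ν : Measure (spectrum ℝ T)} [IsFiniteMeasure ν]
    {g : spectrum ℝ T → ℝ} (h : MemLp g 2 ν) : ∃ f : ℕ → C(spectrum ℝ T, ℝ),
      ∀ μ : Measure (spectrum ℝ T), μ ≤ ν →
      Tendsto (fun n => eLpNorm (fun x => f n x - g x) 2 μ) atTop (𝓝 0) := by
  have h1 : ∀ n : ℕ, ∃ f : C(spectrum ℝ T, ℝ),
      eLpNorm (fun x => f x - g x) 2 ν ≤ ((n : ℝ≥0∞) + 1)⁻¹ := by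
    intro n
    obtain ⟨f, hf, -⟩ := h.exists_boundedContinuous_eLpNorm_sub_le (by norm_num)
      (ε := ((n : ℝ≥0∞) + 1)⁻¹) (by simp)
    refine ⟨f.toContinuousMap, ?_⟩
    rw [eLpNorm_sub_comm] at hf
    exact hf
  choose f hf using h1
  refine ⟨f, fun μ hμ => ?_⟩
  refine tendsto_of_tendsto_of_tendsto_of_le_of_le tendsto_const_nhds (h := fun n : ℕ => ((n : ℝ≥0∞) + 1)⁻¹) ?_
    (fun _ => bot_le) (fun n => (eLpNorm_mono_measure _ hμ).trans (hf n))
  have h2 := (tendsto_add_atTop_iff_nat 1).mpr ENNReal.tendsto_inv_nat_nhds_zero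
  simpa using h2

theorem memLp_indicator {α : Type*} [MeasurableSpace α] {ν : Measure α} [IsFiniteMeasure ν]
    {S : Set α}
    (hS : MeasurableSet S) : MemLp (S.indicator (fun _ => (1 : ℝ))) 2 ν :=
  memLp_indicator_const 2 hS 1 (Or.inr (measure_ne_top _ _))

theorem norm_borelApply_indicator_sq (u : H) {S : Set (spectrum ℝ T)} (hS : MeasurableSet S) :
    ‖borelApply hT u (S.indicator (fun _ => (1 : ℝ)))‖ ^ 2 = (vectorMeasureAt hT u).real S := by
  rw [norm_borelApply_sq hT u (memLp_indicator hS), ← integral_indicator_one hS]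
  congr 1
  ext x
  by_cases hx : x ∈ S <;> simp [hx]

/-- The spectral projection of a bounded self-adjoint operator. -/
noncomputable def boundedProjection (S : Set (spectrum ℝ T)) (hS : MeasurableSet S) : H →L[ℂ] H :=
  LinearMap.mkContinuous
    { toFun := fun u => borelApply hT u (S.indicator (fun _ => (1 : ℝ)))
      map_add' := fun u v => by
        obtain ⟨f, hf⟩ := exists_continuous_approx (memLp_indicator hS
          (ν := vectorMeasureAt hT (u + v) + (vectorMeasureAt hT u + vectorMeasureAt hT v)))
        have h0 := tendsto_borelApply hT (u + v) (memLp_indicator hS)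
          (hf _ (Measure.le_add_right le_rfl))
        have h1 := tendsto_borelApply hT u (memLp_indicator hS)
          (hf _ (le_trans (Measure.le_add_right le_rfl) (Measure.le_add_left le_rfl)))
        have h2 := tendsto_borelApply hT v (memLp_indicator hS)
          (hf _ (le_trans (Measure.le_add_left le_rfl) (Measure.le_add_left le_rfl)))
        refine tendsto_nhds_unique h0 ?_
        simpa using h1.add h2
      map_smul' := fun c u => by
        obtain ⟨f, hf⟩ := exists_continuous_approx (memLp_indicator hS
          (ν := vectorMeasureAt hT (c • u) + vectorMeasureAt hT u))
        have h0 := tendsto_borelApply hT (c • u) (memLp_indicator hS)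
          (hf _ (Measure.le_add_right le_rfl))
        have h1 := tendsto_borelApply hT u (memLp_indicator hS) (hf _ (Measure.le_add_left le_rfl))
        refine tendsto_nhds_unique h0 ?_
        simpa using h1.const_smul c } 1 (by
    intro u
    -- The squared norm of the image is the measure of S, at most the total mass ‖u‖².
    refine (pow_le_pow_iff_left₀ (norm_nonneg _) (by positivity) two_ne_zero).mp ?_
    simp only [LinearMap.coe_mk, AddHom.coe_mk, one_mul]
    rw [norm_borelApply_indicator_sq hT u hS, ← vectorMeasureAt_univ hT u]
    exact measureReal_mono (subset_univ _))

theorem boundedProjection_apply {S : Set (spectrum ℝ T)} (hS : MeasurableSet S) (u : H) :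
    boundedProjection hT S hS u = borelApply hT u (S.indicator (fun _ => (1 : ℝ))) := rfl

theorem boundedProjection_symm {S : Set (spectrum ℝ T)} (hS : MeasurableSet S) (u v : H) :
    inner ℂ (boundedProjection hT S hS u) v = inner ℂ u (boundedProjection hT S hS v) := by
  obtain ⟨f, hf⟩ := exists_continuous_approx (memLp_indicator hS
    (ν := vectorMeasureAt hT u + vectorMeasureAt hT v))
  have h1 := tendsto_borelApply hT u (memLp_indicator hS) (hf _ (Measure.le_add_right le_rfl))
  have h2 := tendsto_borelApply hT v (memLp_indicator hS) (hf _ (Measure.le_add_left le_rfl))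
  have h3 := h1.inner (𝕜 := ℂ) (tendsto_const_nhds (x := v))
  have h4 := (tendsto_const_nhds (x := u)).inner (𝕜 := ℂ) h2
  simp only [cfcHom_symm] at h3
  exact tendsto_nhds_unique h3 h4

/-- Limit of Re ⟪u, f(T) u⟫ = ∫ f dμ along continuous f. On a finite measure space L² convergence
implies L¹ convergence, so the integrals converge too. -/
theorem inner_boundedProjection {S : Set (spectrum ℝ T)} (hS : MeasurableSet S) (u : H) :
    (inner ℂ u (boundedProjection hT S hS u)).re = (vectorMeasureAt hT u).real S := by
  obtain ⟨f, hf⟩ := exists_continuous_approx (memLp_indicator hS (ν := vectorMeasureAt hT u))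
  have h1 := tendsto_borelApply hT u (memLp_indicator hS) (hf _ le_rfl)
  have h4 := (tendsto_const_nhds (x := u)).inner (𝕜 := ℂ) h1
  have h5 := (Complex.continuous_re.tendsto _).comp h4
  have h6 : Tendsto (fun n => ∫ x, f n x ∂(vectorMeasureAt hT u)) atTop
      (𝓝 (∫ x, S.indicator (fun _ => (1 : ℝ)) x ∂(vectorMeasureAt hT u))) := by
    refine tendsto_integral_of_L1' _ (memLp_indicator hS).1
      (Eventually.of_forall fun n => (memLp_continuous (f n)).integrable (by norm_num)) ?_
    have h7 : Tendsto (fun n => eLpNorm (fun x => f n x - S.indicator (fun _ => (1 : ℝ)) x) 2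
        (vectorMeasureAt hT u) * (vectorMeasureAt hT u) univ ^ (1 / (1 : ℝ≥0∞).toReal -
          1 / (2 : ℝ≥0∞).toReal)) atTop (𝓝 0) := by
      have := ENNReal.Tendsto.mul_const (hf (vectorMeasureAt hT u) le_rfl)
        (b := (vectorMeasureAt hT u) univ ^ (1 / (1 : ℝ≥0∞).toReal - 1 / (2 : ℝ≥0∞).toReal))
        (Or.inr (ENNReal.rpow_ne_top_of_nonneg (by norm_num) (measure_ne_top _ _)))
      simpa using this
    refine tendsto_of_tendsto_of_tendsto_of_le_of_le tendsto_const_nhds h7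
      (fun _ => bot_le) (fun n => ?_)
    exact eLpNorm_le_eLpNorm_mul_rpow_measure_univ (by norm_num)
      (((f n).continuous.aestronglyMeasurable).sub (memLp_indicator hS).1)
  have h8 : ∀ n, (inner ℂ u (cfcHom hT (f n) u)).re = ∫ x, f n x ∂(vectorMeasureAt hT u) :=
    fun n => (integral_vectorMeasureAt hT u (f n)).symm
  have h9 := tendsto_nhds_unique (h5.congr h8) h6
  rw [boundedProjection_apply, h9]
  exact integral_indicator_one hS

/-- For symmetric E, both ⟪u, E u⟫ and ‖E u‖² are the measure of S. Hence the quadratic form of E² -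
E vanishes, and over ℂ this forces E² = E. -/
theorem isStarProjection_boundedProjection {S : Set (spectrum ℝ T)} (hS : MeasurableSet S) :
    IsStarProjection (boundedProjection hT S hS) := by
  set E := boundedProjection hT S hS with hE
  have hs : ∀ u v, inner ℂ (E u) v = inner ℂ u (E v) := boundedProjection_symm hT hS
  refine ⟨?_, ContinuousLinearMap.isSelfAdjoint_iff_isSymmetric.mpr hs⟩
  have h : (E * E - E).toLinearMap = 0 := by
    rw [← inner_map_self_eq_zero]
    intro u
    have h1 : inner ℂ (E (E u)) u = inner ℂ (E u) (E u) := hs _ _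
    have h2 : inner ℂ (E u) u = ((inner ℂ u (E u)).re : ℂ) := by
      rw [hs]
      refine (Complex.conj_eq_iff_re.mp ?_).symm
      rw [inner_conj_symm, hs]
    simp only [ContinuousLinearMap.coe_coe, sub_apply,
      mul_apply_eq_comp, inner_sub_left]
    rw [h1, h2, inner_boundedProjection hT hS, ← norm_borelApply_indicator_sq hT u hS,
      inner_self_eq_norm_sq_to_K]
    simp [hE, boundedProjection_apply]
  have h2 : E * E - E = 0 := by
    ext u
    exact DFunLike.congr_fun h u
  exact sub_eq_zero.mp h2

theorem boundedProjection_union {S S' : Set (spectrum ℝ T)} (hS : MeasurableSet S)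
    (hS' : MeasurableSet S') (hd : Disjoint S S') (u : H) :
    boundedProjection hT (S ∪ S') (hS.union hS') u =
      boundedProjection hT S hS u + boundedProjection hT S' hS' u := by
  simp only [boundedProjection_apply]
  rw [← borelApply_add hT u (memLp_indicator hS) (memLp_indicator hS')]
  rw [Set.indicator_union_of_disjoint hd]
  rfl

theorem boundedProjection_empty (u : H) : boundedProjection hT ∅ MeasurableSet.empty u = 0 := by
  have := norm_borelApply_indicator_sq hT u MeasurableSet.empty
  rw [boundedProjection_apply]
  simpa using this

theorem boundedProjection_biUnion {S : ℕ → Set (spectrum ℝ T)} (hS : ∀ n, MeasurableSet (S n))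
    (hd : Pairwise (fun m n => Disjoint (S m) (S n))) (F : Finset ℕ) (u : H) :
    boundedProjection hT (⋃ n ∈ F, S n) (F.measurableSet_biUnion fun n _ => hS n) u =
      ∑ n ∈ F, boundedProjection hT (S n) (hS n) u := by
  induction F using Finset.induction_on with
  | empty => simpa using boundedProjection_empty hT u
  | insert a F ha ih =>
    rw [Finset.sum_insert ha, ← ih, ← boundedProjection_union]
    · congr 2
      simp
    · simp only [Set.disjoint_iUnion_right]
      intro i hi
      exact hd (by rintro rfl; exact ha hi)

/-- The squared distance to a finite partial sum is the scalar measure of the remaining sets, so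
strong convergence reduces to countable additivity of that measure. -/
theorem hasSum_boundedProjection {S : ℕ → Set (spectrum ℝ T)} (hS : ∀ n, MeasurableSet (S n))
    (hd : Pairwise (fun m n => Disjoint (S m) (S n))) (u : H) :
    HasSum (fun n => boundedProjection hT (S n) (hS n) u)
      (boundedProjection hT (⋃ n, S n) (MeasurableSet.iUnion hS) u) := by
  have h1 : ∀ F : Finset ℕ, ‖∑ n ∈ F, boundedProjection hT (S n) (hS n) u -
      boundedProjection hT (⋃ n, S n) (MeasurableSet.iUnion hS) u‖ ^ 2 =
      (vectorMeasureAt hT u).real (⋃ n, S n) - ∑ n ∈ F, (vectorMeasureAt hT u).real (S n) := by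
    intro F
    have hF := F.measurableSet_biUnion fun n _ => hS n
    have hsub : (⋃ n ∈ F, S n) ⊆ ⋃ n, S n := iUnion₂_subset fun n _ => subset_iUnion S n
    have hdiff := (MeasurableSet.iUnion hS).diff hF
    have h2 : boundedProjection hT (⋃ n, S n) (MeasurableSet.iUnion hS) u =
        boundedProjection hT _ hF u + boundedProjection hT _ hdiff u := by
      rw [← boundedProjection_union hT hF hdiff disjoint_sdiff_right]
      congr 2
      rw [Set.union_sdiff_cancel hsub]
    rw [h2, ← boundedProjection_biUnion hT hS hd, sub_add_cancel_left, norm_neg,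
      boundedProjection_apply, norm_borelApply_indicator_sq hT u hdiff,
      measureReal_sdiff hsub hF, measureReal_biUnion_finset (fun i _ j _ hij => hd hij)
      (fun n _ => hS n)]
  rw [HasSum, tendsto_iff_norm_sub_tendsto_zero]
  have h3 : HasSum (fun n => (vectorMeasureAt hT u).real (S n))
      ((vectorMeasureAt hT u).real (⋃ n, S n)) := by
    have h4 := measure_iUnion (μ := vectorMeasureAt hT u) hd hS
    have h5 := ENNReal.hasSum_toReal (by rw [← h4]; exact measure_ne_top _ _)
    rw [← ENNReal.tsum_toReal_eq (fun n => measure_ne_top _ _), ← h4] at h5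
    exact h5
  have h4 := Tendsto.const_sub ((vectorMeasureAt hT u).real (⋃ n, S n)) (f := fun F : Finset ℕ => ∑ n ∈ F, (vectorMeasureAt hT u).real (S n)) h3
  rw [sub_self] at h4
  have h5 := (h4.congr fun F => (h1 F).symm).sqrt
  simpa using h5

theorem boundedProjection_univ : boundedProjection hT univ MeasurableSet.univ = 1 := by
  ext u
  rw [boundedProjection_apply, indicator_univ]
  have := borelApply_continuous hT u 1
  rw [map_one] at this
  exact this

open Classical in
/-- The image of the spectral measure of `T` under a measurable map `ψ`. -/
noncomputable def pushforwardPVM (ψ : spectrum ℝ T → ℝ) (hψ : Measurable ψ) :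
    ProjectionValuedMeasure H where
  toFun S := if h : MeasurableSet S then boundedProjection hT (ψ ⁻¹' S) (hψ h) else 0
  isStarProjection S hS := by
    rw [dif_pos hS]
    exact isStarProjection_boundedProjection hT (hψ hS)
  univ := by
    rw [dif_pos MeasurableSet.univ]
    exact boundedProjection_univ hT
  hasSum_iUnion S hS hd u := by
    simp only [hS, dif_pos, MeasurableSet.iUnion hS]
    simp only [preimage_iUnion]
    exact hasSum_boundedProjection hT (fun n => hψ (hS n))
      (fun m n hmn => (hd hmn).preimage ψ) u

theorem scalarMeasure_pushforwardPVM (ψ : spectrum ℝ T → ℝ) (hψ : Measurable ψ) (u : H) :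
    (pushforwardPVM hT ψ hψ).scalarMeasure u = (vectorMeasureAt hT u).map ψ := by
  ext S hS
  rw [Measure.map_apply hψ hS, ProjectionValuedMeasure.scalarMeasure,
    Measure.ofMeasurable_apply _ hS, pushforwardPVM]
  simp only [hS, dif_pos]
  rw [inner_boundedProjection hT (hψ hS), ofReal_measureReal]

end BoundedSpectral

/-! ### Self-adjointness and spectral measure from surjectivity of A - z at one real z -/

section Resolvent

variable {H : Type*} [NormedAddCommGroup H] [InnerProductSpace ℂ H] [CompleteSpace H]

section Bounded

variable {T : H →L[ℂ] H} (hT : IsSelfAdjoint T)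

/-- The inclusion of the spectrum, as a continuous function. -/
def spectrumId (T : H →L[ℂ] H) : C(spectrum ℝ T, ℝ) := ⟨Subtype.val, continuous_subtype_val⟩

theorem cfcHom_spectrumId : cfcHom hT (spectrumId T) = T := by
  have h := cfcHom_id (R := ℝ) hT
  exact h

/-- From ⟪Tw, f(T) Tw⟫ = ⟪w, (x² f)(T) w⟫. The density x² compensates the singularity of 1/x when
vectors in the range of T are considered. -/
theorem vectorMeasureAt_map (w : H) : vectorMeasureAt hT (T w) =
    (vectorMeasureAt hT w).withDensity (fun x => ENNReal.ofReal ((x : ℝ) ^ 2)) := by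
  have hm : Measurable fun x : spectrum ℝ T => ENNReal.ofReal ((x : ℝ) ^ 2) := by fun_prop
  have hfin : IsFiniteMeasure ((vectorMeasureAt hT w).withDensity
      (fun x => ENNReal.ofReal ((x : ℝ) ^ 2))) :=
    isFiniteMeasure_withDensity_ofReal
      ((memLp_continuous (spectrumId T * spectrumId T)).integrable (q := 2)
        (by norm_num) |>.congr (Eventually.of_forall fun x => (sq (x : ℝ)).symm)).2
  refine ext_of_forall_integral_eq_of_IsFiniteMeasure fun f => ?_
  rw [integral_withDensity_eq_integral_toReal_smul hm (by simp)]
  have h1 := integral_vectorMeasureAt hT (T w) f.toContinuousMap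
  have h2 := integral_vectorMeasureAt hT w (spectrumId T * (f.toContinuousMap * spectrumId T))
  have h3 : inner ℂ (T w) (cfcHom hT f.toContinuousMap (T w)) = inner ℂ w
      (cfcHom hT (spectrumId T * (f.toContinuousMap * spectrumId T)) w) := by
    rw [map_mul, map_mul, cfcHom_spectrumId]
    exact (ContinuousLinearMap.isSelfAdjoint_iff_isSymmetric.mp hT) w _
  rw [h3, ← h2] at h1
  refine h1.trans (integral_congr_ae (Eventually.of_forall fun x => ?_))
  simp only [ContinuousMap.mul_apply, smul_eq_mul]
  rw [ENNReal.toReal_ofReal (sq_nonneg _)]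
  change (x : ℝ) * (f x * x) = _
  ring

/-- T corresponds to multiplication by x, first on continuous functions and then by approximation,
since x is bounded on the spectrum. -/
theorem map_borelApply (u : H) {g : spectrum ℝ T → ℝ} (hg : MemLp g 2 (vectorMeasureAt hT u)) :
    T (borelApply hT u g) = borelApply hT u (fun x : spectrum ℝ T => (x : ℝ) * g x) := by
  obtain ⟨C, hC⟩ := (isCompact_range (spectrumId T).continuous).isBounded.exists_norm_le
  have hC' : ∀ x : spectrum ℝ T, ‖(x : ℝ)‖ ≤ C := fun x => hC _ ⟨x, rfl⟩
  have key : ∀ f : spectrum ℝ T → ℝ, AEStronglyMeasurable f (vectorMeasureAt hT u) →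
      eLpNorm (fun x : spectrum ℝ T => (x : ℝ) * f x) 2 (vectorMeasureAt hT u) ≤
      ENNReal.ofReal C * eLpNorm f 2 (vectorMeasureAt hT u) := by
    intro f hf
    refine eLpNorm_le_mul_eLpNorm_of_ae_le_mul (Eventually.of_forall fun x => ?_) 2
    rw [norm_mul]
    exact mul_le_mul_of_nonneg_right (hC' x) (norm_nonneg _)
  have hg' : MemLp (fun x : spectrum ℝ T => (x : ℝ) * g x) 2 (vectorMeasureAt hT u) :=
    ⟨(continuous_subtype_val.aestronglyMeasurable).mul hg.1,
      (key g hg.1).trans_lt (ENNReal.mul_lt_top (by simp) hg.2)⟩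
  obtain ⟨f, hf⟩ := exists_continuous_approx hg
  have h1 := (T.continuous.tendsto _).comp (tendsto_borelApply hT u hg (hf _ le_rfl))
  have h2 : Tendsto (fun n => cfcHom hT (spectrumId T * f n) u) atTop
      (𝓝 (borelApply hT u (fun x : spectrum ℝ T => (x : ℝ) * g x))) := by
    refine tendsto_borelApply hT u hg' ?_
    have h3 := ENNReal.Tendsto.const_mul (a := ENNReal.ofReal C) (hf _ le_rfl) (by simp)
    rw [mul_zero] at h3
    refine tendsto_of_tendsto_of_tendsto_of_le_of_le tendsto_const_nhds h3
      (fun _ => bot_le) (fun n => ?_)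
    refine le_trans (le_of_eq ?_) (key _ ((f n).continuous.aestronglyMeasurable.sub hg.1))
    congr 1
    ext x
    change (x : ℝ) * f n x - x * g x = x * (f n x - g x)
    ring
  have h4 : ∀ n, cfcHom hT (spectrumId T * f n) u = T (cfcHom hT (f n) u) := by
    intro n
    rw [map_mul, cfcHom_spectrumId, mul_apply_eq_comp]
  simp only [h4] at h2
  exact tendsto_nhds_unique h1 h2

/-- T annihilates the spectral projection of {0}, so injectivity leaves no mass there. The
conventional value 0⁻¹ = 0 is then harmless in the change of variable t = z + x⁻¹. -/
theorem vectorMeasureAt_zero (hinj : Function.Injective T) (u : H) :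
    ∀ᵐ x : spectrum ℝ T ∂(vectorMeasureAt hT u), (x : ℝ) ≠ 0 := by
  have hS : MeasurableSet {x : spectrum ℝ T | (x : ℝ) = 0} :=
    measurableSet_eq_fun measurable_subtype_coe measurable_const
  have h1 := map_borelApply hT u (memLp_indicator hS)
  have h2 : (fun x : spectrum ℝ T => (x : ℝ) *
      {x : spectrum ℝ T | (x : ℝ) = 0}.indicator (fun _ => (1 : ℝ)) x) = (0 : C(spectrum ℝ T, ℝ)) := by
    ext x
    by_cases hx : (x : ℝ) = 0 <;> simp [hx]
  rw [h2, borelApply_continuous, map_zero] at h1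
  have h3 := hinj (h1.trans (map_zero T).symm)
  have h4 := norm_borelApply_indicator_sq hT u hS
  rw [h3, norm_zero, zero_pow two_ne_zero, eq_comm, measureReal_eq_zero_iff] at h4
  rw [ae_iff]
  simpa using h4

end Bounded

/-- A symmetric A with A - z onto is injective after the shift: if (A - z) x = 0 and x = (A - z) y,
then ‖x‖² = ⟪(A - z) x, y⟫ = 0. The everywhere defined inverse inherits symmetry. -/
theorem exists_resolvent {A : H →ₗ.[ℂ] H}
    (hsym : ∀ x y : A.domain, inner ℂ (A x) (y : H) = inner ℂ (x : H) (A y)) (z : ℝ)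
    (hsurj : ∀ f : H, ∃ x : A.domain, A x - (z : ℂ) • (x : H) = f) :
    ∃ T : H →L[ℂ] H, IsSelfAdjoint T ∧ Function.Injective T ∧
      (∀ f, ∃ x : A.domain, (x : H) = T f ∧ A x - (z : ℂ) • (x : H) = f) ∧
      ∀ x : A.domain, T (A x - (z : ℂ) • (x : H)) = x := by
  have hsym' : ∀ x y : A.domain, inner ℂ (A x - (z : ℂ) • (x : H)) (y : H) =
      inner ℂ (x : H) (A y - (z : ℂ) • (y : H)) := by
    intro x y
    rw [inner_sub_left, inner_sub_right, hsym, inner_smul_left, inner_smul_right]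
    simp
  have hinj : ∀ x : A.domain, A x - (z : ℂ) • (x : H) = 0 → (x : H) = 0 := by
    intro x hx
    obtain ⟨y, hy⟩ := hsurj x
    have h := hsym' x y
    rw [hx, hy, inner_zero_left] at h
    exact inner_self_eq_zero.mp h.symm
  choose R hR using hsurj
  have hR' : ∀ f (x : A.domain), A x - (z : ℂ) • (x : H) = f → x = R f := by
    intro f x hx
    have h := hinj (x - R f) (by
      rw [LinearPMap.map_sub, Submodule.coe_sub, smul_sub, sub_sub_sub_comm, hx, hR, sub_self])
    rw [Submodule.coe_sub, sub_eq_zero] at h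
    exact Subtype.ext h
  let T₀ : H →ₗ[ℂ] H :=
    { toFun := fun f => (R f : H)
      map_add' := fun f g => by
        rw [← Submodule.coe_add]
        congr 1
        refine (hR' _ _ ?_).symm
        rw [LinearPMap.map_add, Submodule.coe_add, smul_add, add_sub_add_comm, hR, hR]
      map_smul' := fun c f => by
        rw [RingHom.id_apply, ← Submodule.coe_smul]
        congr 1
        refine (hR' _ _ ?_).symm
        rw [LinearPMap.map_smul, Submodule.coe_smul, smul_comm, ← smul_sub, hR] }
  have hT₀ : T₀.IsSymmetric := by
    intro f g
    change inner ℂ (R f : H) g = inner ℂ f (R g : H)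
    have h := hsym' (R f) (R g)
    rw [hR, hR] at h
    exact h.symm
  -- Hellinger–Toeplitz: an everywhere defined symmetric operator is bounded.
  let T : H →L[ℂ] H := ⟨T₀, hT₀.continuous⟩
  refine ⟨T, ContinuousLinearMap.isSelfAdjoint_iff_isSymmetric.mpr hT₀, ?_,
    fun f => ⟨R f, rfl, hR f⟩, fun x => ?_⟩
  · intro f g hfg
    have h : R f = R g := Subtype.ext hfg
    rw [← hR f, ← hR g, h]
  · exact congrArg Subtype.val (hR' _ x rfl).symm

/-- Anything orthogonal to the range of A - z vanishes. This gives density of the domain, and it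
also shows that the adjoint has no larger domain than A. -/
theorem isSelfAdjoint_of_surjective {A : H →ₗ.[ℂ] H}
    (hsym : ∀ x y : A.domain, inner ℂ (A x) (y : H) = inner ℂ (x : H) (A y)) (z : ℝ)
    (hsurj : ∀ f : H, ∃ x : A.domain, A x - (z : ℂ) • (x : H) = f) : IsSelfAdjoint A := by
  have hdense : Dense (A.domain : Set H) := by
    rw [Submodule.dense_iff_topologicalClosure_eq_top, Submodule.topologicalClosure_eq_top_iff,
      Submodule.eq_bot_iff]
    intro v hv
    obtain ⟨w, rfl⟩ := hsurj v
    have hv' : ∀ x : A.domain, inner ℂ (w : H) (A x - (z : ℂ) • (x : H)) = 0 := by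
      intro x
      have h := Submodule.inner_left_of_mem_orthogonal x.2 hv
      rw [inner_sub_left, hsym, inner_smul_left] at h
      rw [inner_sub_right, inner_smul_right]
      simpa using h
    obtain ⟨y, hy⟩ := hsurj w
    have h := hv' y
    rw [hy] at h
    have hw : w = 0 := Subtype.ext (inner_self_eq_zero.mp h)
    rw [hw]
    simp
  have hle : A ≤ A† := LinearPMap.IsFormalAdjoint.le_adjoint hdense fun x y => hsym x y
  rw [LinearPMap.isSelfAdjoint_def]
  refine (LinearPMap.eq_of_le_of_domain_eq hle (le_antisymm hle.1 ?_)).symm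
  intro y hy
  obtain ⟨x, hx⟩ := hsurj (A† ⟨y, hy⟩ - (z : ℂ) • y)
  obtain ⟨v, hv⟩ := hsurj (y - x)
  have h1 : inner ℂ (A† ⟨y, hy⟩) (v : H) = inner ℂ y (A v) :=
    LinearPMap.adjoint_isFormalAdjoint hdense ⟨y, hy⟩ v
  -- Since (A† - z) y = (A - z) x, the vector y - x is orthogonal to the range of A - z, in
  -- particular to itself.
  have h2 : inner ℂ (y - x) (y - x) = 0 := by
    nth_rewrite 2 [← hv]
    have h3 := congrArg (fun t => inner ℂ t (v : H)) hx
    simp only [inner_sub_left, inner_smul_left, hsym, h1] at h3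
    simp only [inner_sub_left, inner_sub_right, inner_smul_right]
    simp only [Complex.conj_ofReal] at h3
    linear_combination -h3
  have h3 := sub_eq_zero.mp (inner_self_eq_zero.mp h2)
  rw [h3]
  exact x.2

/-- The spectral theorem for symmetric operators with a real number in the resolvent set. -/
theorem exists_isSpectralMeasureOf {A : H →ₗ.[ℂ] H}
    (hsym : ∀ x y : A.domain, inner ℂ (A x) (y : H) = inner ℂ (x : H) (A y)) (z : ℝ)
    (hsurj : ∀ f : H, ∃ x : A.domain, A x - (z : ℂ) • (x : H) = f) :
    ∃ E : ProjectionValuedMeasure H, E.IsSpectralMeasureOf A := by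
  obtain ⟨T, hT, hinj, hT1, hT2⟩ := exists_resolvent hsym z hsurj
  have hTs := ContinuousLinearMap.isSelfAdjoint_iff_isSymmetric.mp hT
  -- If t is the spectral variable of A, that of the resolvent is x = 1/(t - z); so the spectral
  -- measure of A is the image of that of T under x ↦ z + x⁻¹.
  have hψ : Measurable fun x : spectrum ℝ T => z + (x : ℝ)⁻¹ := by fun_prop
  have hρ : Measurable fun x : spectrum ℝ T => ENNReal.ofReal ((x : ℝ) ^ 2) := by fun_prop
  refine ⟨pushforwardPVM hT _ hψ, fun u => ?_, fun u => ?_⟩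
  · rw [scalarMeasure_pushforwardPVM, lintegral_map (by fun_prop) hψ]
    constructor
    · intro hu
      have hu' : T (A ⟨u, hu⟩ - (z : ℂ) • u) = u := hT2 ⟨u, hu⟩
      set w := A ⟨u, hu⟩ - (z : ℂ) • u
      rw [← hu', vectorMeasureAt_map, lintegral_withDensity_eq_lintegral_mul _ hρ (by fun_prop)]
      -- For u = T w the density x² turns (z + x⁻¹)² into (z x + 1)², bounded on the spectrum. At x
      -- = 0 only an inequality remains, which suffices.
      have h1 : MemLp (fun x : spectrum ℝ T => z * (x : ℝ) + 1) 2 (vectorMeasureAt hT w) :=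
        memLp_continuous (⟨fun x : spectrum ℝ T => z * (x : ℝ) + 1, by fun_prop⟩ : C(_, ℝ))
      refine lt_of_le_of_lt (lintegral_mono fun x => ?_) h1.integrable_sq.lintegral_lt_top
      rw [Pi.mul_apply, ← ENNReal.ofReal_mul (sq_nonneg _)]
      refine ENNReal.ofReal_le_ofReal ?_
      by_cases hx : (x : ℝ) = 0
      · simp [hx]
      · refine le_of_eq ?_
        field_simp
        try ring
    · intro h
      have h1 : MemLp (fun x : spectrum ℝ T => z + (x : ℝ)⁻¹) 2 (vectorMeasureAt hT u) := by
        rw [memLp_two_iff_integrable_sq hψ.aestronglyMeasurable]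
        refine ⟨by fun_prop, ?_⟩
        rw [hasFiniteIntegral_iff_ofReal (Eventually.of_forall fun x => sq_nonneg _)]
        exact h
      have h2 : MemLp (fun x : spectrum ℝ T => (x : ℝ)⁻¹) 2 (vectorMeasureAt hT u) := by
        have := h1.sub (memLp_const z)
        refine this.congr_norm (by fun_prop) (Eventually.of_forall fun x => ?_)
        simp
      -- Since x⁻¹ is square integrable, u = T v with v = x⁻¹(T) u. Thus u lies in the range of T,
      -- which is contained in the domain of A.
      have h3 := map_borelApply hT u h2
      have h4 : borelApply hT u (fun x => (x : ℝ) * (x : ℝ)⁻¹) = u := by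
        have h5 := borelApply_continuous hT u 1
        rw [map_one, one_apply_eq_self] at h5
        nth_rewrite 2 [← h5]
        refine (borelApply_congr hT u (memLp_continuous 1) ?_).symm
        filter_upwards [vectorMeasureAt_zero hT hinj u] with x hx
        simp [hx]
      rw [h4] at h3
      obtain ⟨x, hx, -⟩ := hT1 (borelApply hT u fun x => (x : ℝ)⁻¹)
      rw [← h3, ← hx]
      exact x.2
  · obtain ⟨u, hu⟩ := u
    have hu' : T (A ⟨u, hu⟩ - (z : ℂ) • u) = u := hT2 ⟨u, hu⟩
    rw [scalarMeasure_pushforwardPVM, integral_map hψ.aemeasurable (by fun_prop)]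
    set w := A ⟨u, hu⟩ - (z : ℂ) • u with hw
    have hAu : A ⟨u, hu⟩ = w + (z : ℂ) • T w := by
      rw [hu']
      simp [hw]
    simp only at hu' ⊢
    -- Writing u = T w reduces both sides to the integral of x + z x² against the measure at w.
    rw [hAu, ← hu', vectorMeasureAt_map, integral_withDensity_eq_integral_toReal_smul hρ (by simp)]
    have h1 := integral_vectorMeasureAt hT w (spectrumId T + z • (spectrumId T * spectrumId T))
    have h2 : ∫ x : spectrum ℝ T, (ENNReal.ofReal ((x : ℝ) ^ 2)).toReal • (z + (x : ℝ)⁻¹)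
        ∂(vectorMeasureAt hT w) = ∫ x, (spectrumId T + z • (spectrumId T * spectrumId T)) x
        ∂(vectorMeasureAt hT w) := by
      refine integral_congr_ae (Eventually.of_forall fun x => ?_)
      simp only [smul_eq_mul]
      rw [ENNReal.toReal_ofReal (sq_nonneg _)]
      change (x : ℝ) ^ 2 * (z + (x : ℝ)⁻¹) = (x : ℝ) + z * ((x : ℝ) * x)
      by_cases hx : (x : ℝ) = 0
      · simp [hx]
      · field_simp
        try ring
    rw [h2, h1, map_add, map_smul, map_mul, cfcHom_spectrumId]
    have h3 : (T + z • (T * T)) w = T w + (z : ℂ) • T (T w) := by simp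
    have h4 : inner ℂ (T w) (w + (z : ℂ) • T w) = inner ℂ w ((T + z • (T * T)) w) := by
      rw [h3, inner_add_right, inner_add_right, inner_smul_right, inner_smul_right]
      congr 1
      · exact hTs w w
      · congr 1
        exact hTs w (T w)
    rw [h4]
    symm
    refine Complex.conj_eq_iff_re.mp ?_
    rw [inner_conj_symm, ← h4, h3, inner_add_left, inner_add_right, inner_smul_left,
      inner_smul_right, Complex.conj_ofReal]
    congr 2
    exact hTs (T w) w

end Resolvent

/-! ## Counting by forms -/

section Forms

/-- The sesquilinear form of `M` has positive real part. -/
def IsPositiveForm {k : ℕ} (M : Fin k → Fin k → ℂ) : Prop :=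
  ∀ c : Fin k → ℂ, c ≠ 0 → 0 < (∑ i, ∑ j, starRingEnd ℂ (c i) * c j * M i j).re

/-- By homogeneity positivity need only be tested on the unit sphere, whose compactness makes it an
open condition on the matrix. This allows vectors to be replaced by approximations. -/
theorem IsPositiveForm.eventually {k : ℕ} {M : Fin k → Fin k → ℂ} (hM : IsPositiveForm M)
    {N : ℕ → Fin k → Fin k → ℂ} (hN : ∀ i j, Tendsto (fun m => N m i j) atTop (𝓝 (M i j))) :
    ∀ᶠ m in atTop, IsPositiveForm (N m) := by
  let Q : (Fin k → Fin k → ℂ) → (Fin k → ℂ) → ℝ :=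
    fun M c => (∑ i, ∑ j, starRingEnd ℂ (c i) * c j * M i j).re
  have hQ : Continuous fun p : (Fin k → Fin k → ℂ) × (Fin k → ℂ) => Q p.1 p.2 := by
    have hc : Continuous (starRingEnd ℂ) := Complex.continuous_conj
    refine Complex.continuous_re.comp (continuous_finsetSum _ fun i _ =>
      continuous_finsetSum _ fun j _ => ?_)
    refine ((hc.comp ?_).mul ?_).mul ?_ <;> fun_prop
  have hhom : ∀ M c (r : ℝ), Q M (fun i => (r : ℂ) * c i) = r ^ 2 * Q M c := by
    intro M c r
    simp only [Q]
    rw [← Complex.re_ofReal_mul]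
    congr 1
    rw [Finset.mul_sum]
    refine Finset.sum_congr rfl fun i _ => ?_
    rw [Finset.mul_sum]
    refine Finset.sum_congr rfl fun j _ => ?_
    simp only [map_mul, Complex.conj_ofReal]
    push_cast
    ring
  have hK : IsCompact (Metric.sphere (0 : Fin k → ℂ) 1) := isCompact_sphere 0 1
  have hpos : ∀ᶠ M' in 𝓝 M, ∀ c ∈ Metric.sphere (0 : Fin k → ℂ) 1, 0 < Q M' c := by
    refine hK.eventually_forall_of_forall_eventually fun c hc => ?_
    have hc0 : c ≠ 0 := by
      rintro rfl
      simp at hc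
    exact hQ.continuousAt.eventually (lt_mem_nhds (hM c hc0))
  have ht : Tendsto N atTop (𝓝 M) :=
    tendsto_pi_nhds.mpr fun i => tendsto_pi_nhds.mpr fun j => hN i j
  filter_upwards [ht.eventually hpos] with m hm c hc
  have hn : 0 < ‖c‖ := norm_pos_iff.mpr hc
  have h1 := hm (fun i => ((‖c‖⁻¹ : ℝ) : ℂ) * c i) (by
    have : (fun i => ((‖c‖⁻¹ : ℝ) : ℂ) * c i) = ((‖c‖⁻¹ : ℝ) : ℂ) • c := rfl
    rw [this, mem_sphere_zero_iff_norm, norm_smul, Complex.norm_real, norm_inv, norm_norm,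
      inv_mul_cancel₀ hn.ne'])
  rw [hhom] at h1
  exact pos_of_mul_pos_right h1 (sq_nonneg _)

theorem sum_form {H : Type*} [NormedAddCommGroup H] [InnerProductSpace ℂ H] {k : ℕ}
    (c : Fin k → ℂ) (v w : Fin k → H) :
    ∑ i, ∑ j, starRingEnd ℂ (c i) * c j * inner ℂ (v i) (w j) =
      inner ℂ (∑ i, c i • v i) (∑ j, c j • w j) := by
  rw [sum_inner]
  refine Finset.sum_congr rfl fun i _ => ?_
  rw [inner_sum]
  refine Finset.sum_congr rfl fun j _ => ?_
  rw [inner_smul_left, inner_smul_right]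
  ring

theorem isPositiveForm_gram {H : Type*} [NormedAddCommGroup H] [InnerProductSpace ℂ H] {k : ℕ}
    {v : Fin k → H} (hv : LinearIndependent ℂ v) :
    IsPositiveForm fun i j => inner ℂ (v i) (v j) := by
  intro c hc
  rw [sum_form, inner_self_eq_norm_sq_to_K]
  have h : ∑ i, c i • v i ≠ 0 := fun h => hc (funext (Fintype.linearIndependent_iff.mp hv c h))
  have h2 : 0 < ‖∑ i, c i • v i‖ := norm_pos_iff.mpr h
  have h3 : 0 < ‖∑ i, c i • v i‖ ^ 2 := by positivity
  exact_mod_cast h3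

end Forms

/-! ### Projection-valued measures and Glazman's lemma -/

namespace ProjectionValuedMeasure

variable {H : Type*} [NormedAddCommGroup H] [InnerProductSpace ℂ H] [CompleteSpace H]
variable (E : ProjectionValuedMeasure H)

theorem symm {S : Set ℝ} (hS : MeasurableSet S) (u v : H) :
    inner ℂ (E.toFun S u) v = inner ℂ u (E.toFun S v) :=
  (ContinuousLinearMap.isSelfAdjoint_iff_isSymmetric.mp (E.isStarProjection S hS).isSelfAdjoint) u v

theorem idem {S : Set ℝ} (hS : MeasurableSet S) (u : H) :
    E.toFun S (E.toFun S u) = E.toFun S u :=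
  DFunLike.congr_fun (E.isStarProjection S hS).isIdempotentElem.eq u

theorem inner_self {S : Set ℝ} (hS : MeasurableSet S) (u : H) :
    (inner ℂ u (E.toFun S u)).re = ‖E.toFun S u‖ ^ 2 := by
  have h : inner ℂ u (E.toFun S u) = inner ℂ (E.toFun S u) (E.toFun S u) := by
    rw [E.symm hS, E.idem hS]
  rw [h, inner_self_eq_norm_sq_to_K]
  norm_cast

theorem scalarMeasure_apply (u : H) {S : Set ℝ} (hS : MeasurableSet S) :
    E.scalarMeasure u S = ENNReal.ofReal (‖E.toFun S u‖ ^ 2) := by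
  rw [scalarMeasure, Measure.ofMeasurable_apply _ hS, E.inner_self hS]

theorem scalarMeasure_univ (u : H) : E.scalarMeasure u Set.univ = ENNReal.ofReal (‖u‖ ^ 2) := by
  rw [E.scalarMeasure_apply u MeasurableSet.univ, E.univ]
  simp

instance (u : H) : IsFiniteMeasure (E.scalarMeasure u) :=
  ⟨by rw [E.scalarMeasure_univ]; exact ENNReal.ofReal_lt_top⟩

theorem union_apply {S S' : Set ℝ} (hS : MeasurableSet S) (hS' : MeasurableSet S')
    (hd : Disjoint S S') (u : H) :
    E.toFun (S ∪ S') u = E.toFun S u + E.toFun S' u := by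
  let f : ℕ → Set ℝ := fun n => if n = 0 then S else if n = 1 then S' else ∅
  have hf : ⋃ n, f n = S ∪ S' := by
    ext x
    simp only [mem_iUnion, mem_union, f]
    constructor
    · rintro ⟨n, hn⟩
      split_ifs at hn <;> simp_all
    · rintro (h | h)
      · exact ⟨0, by simpa using h⟩
      · exact ⟨1, by simpa using h⟩
  have h1 := E.hasSum_iUnion f (fun n => by
      simp only [f]
      split_ifs
      exacts [hS, hS', MeasurableSet.empty]) (fun m n hmn => by
      simp only [f]
      split_ifs <;> first | exact absurd (by omega) hmn | simp_all [hd.symm]) u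
  rw [hf] at h1
  have h2 : HasSum (fun n => E.toFun (f n) u) (∑ n ∈ {0, 1}, E.toFun (f n) u) := by
    refine hasSum_sum_of_ne_finset_zero fun n hn => ?_
    simp only [Finset.mem_insert, Finset.mem_singleton, not_or] at hn
    simp [f, hn.1, hn.2, E.empty_apply]
  rw [h1.unique h2]
  simp [f]

theorem compl_apply {S : Set ℝ} (hS : MeasurableSet S) (u : H) :
    E.toFun S u + E.toFun Sᶜ u = u := by
  rw [← E.union_apply hS hS.compl disjoint_compl_right, union_compl_self, E.univ]
  rfl

theorem scalarMeasure_compl {S : Set ℝ} (hS : MeasurableSet S) (u : H) :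
    E.scalarMeasure (E.toFun S u) Sᶜ = 0 := by
  rw [E.scalarMeasure_apply _ hS.compl]
  have h := E.compl_apply hS (E.toFun S u)
  rw [E.idem hS, add_eq_left] at h
  simp [h]

/-- Cutting S down to bounded sets produces vectors on which the operator is defined; a vector in
the range of E(S) need not lie in the domain when S is unbounded. -/
theorem tendsto_inter (S : Set ℝ) (hS : MeasurableSet S) (u : H) :
    Tendsto (fun m : ℕ => E.toFun (S ∩ Icc (-(m : ℝ)) m) u) atTop (𝓝 (E.toFun S u)) := by
  rw [tendsto_iff_norm_sub_tendsto_zero]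
  have hB : ∀ m : ℕ, MeasurableSet (S ∩ Icc (-(m : ℝ)) m) := fun m => hS.inter measurableSet_Icc
  have h1 : Tendsto (fun m : ℕ => (E.scalarMeasure u) (S \ (S ∩ Icc (-(m : ℝ)) m))) atTop
      (𝓝 ((E.scalarMeasure u) (⋂ m : ℕ, S \ (S ∩ Icc (-(m : ℝ)) m)))) := by
    refine tendsto_measure_iInter_atTop (fun m => (hS.diff (hB m)).nullMeasurableSet) ?_
      ⟨0, measure_ne_top _ _⟩
    intro m n hmn
    have : (m : ℝ) ≤ n := by exact_mod_cast hmn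
    refine sdiff_subset_sdiff_right (inter_subset_inter_right _ (Icc_subset_Icc ?_ this))
    linarith
  have h2 : ⋂ m : ℕ, S \ (S ∩ Icc (-(m : ℝ)) m) = ∅ := by
    ext x
    simp only [mem_iInter, Set.mem_sdiff, mem_inter_iff, mem_Icc, mem_empty_iff_false, iff_false]
    intro h
    obtain ⟨m, hm⟩ := exists_nat_ge |x|
    exact (h m).2 ⟨(h m).1, abs_le.mp hm⟩
  rw [h2, measure_empty] at h1
  have h3 := ((ENNReal.tendsto_toReal ENNReal.zero_ne_top).comp h1).sqrt
  simp only [ENNReal.toReal_zero, Real.sqrt_zero] at h3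
  refine h3.congr fun m => ?_
  have h4 : E.toFun S u = E.toFun (S ∩ Icc (-(m : ℝ)) m) u +
      E.toFun (S \ (S ∩ Icc (-(m : ℝ)) m)) u := by
    rw [← E.union_apply (hB m) (hS.diff (hB m)) disjoint_sdiff_right,
      union_sdiff_cancel inter_subset_left]
  rw [h4, sub_add_cancel_left, norm_neg]
  simp only [Function.comp_apply]
  rw [E.scalarMeasure_apply _ (hS.diff (hB m)), ENNReal.toReal_ofReal (sq_nonneg _),
    Real.sqrt_sq (norm_nonneg _)]

theorem integral_one (u : H) (r : ℝ) : ∫ _, r ∂(E.scalarMeasure u) = r * ‖u‖ ^ 2 := by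
  rw [integral_const, measureReal_def, E.scalarMeasure_univ, ENNReal.toReal_ofReal (sq_nonneg _),
    smul_eq_mul, mul_comm]

theorem integrable_id {A : H →ₗ.[ℂ] H} (hE : E.IsSpectralMeasureOf A) {u : H}
    (hu : u ∈ A.domain) : Integrable (fun t : ℝ => t) (E.scalarMeasure u) := by
  have h : MemLp (fun t : ℝ => t) 2 (E.scalarMeasure u) := by
    rw [memLp_two_iff_integrable_sq (by fun_prop)]
    refine ⟨by fun_prop, ?_⟩
    rw [hasFiniteIntegral_iff_ofReal (Eventually.of_forall fun x => sq_nonneg _)]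
    exact (hE.1 u).mp hu
  exact h.integrable (by norm_num)

/-- Glazman's lemma, with σ = 1 for N₋ and σ = -1 for N₊. The form at a combination u is the
integral of σ(l - t) against the scalar measure of u: it is positive if u ≠ 0 is carried by S, and
nonpositive if E(S) u = 0. -/
theorem le_rank_iff {A : H →ₗ.[ℂ] H} (hE : E.IsSpectralMeasureOf A) {σ : ℝ} (l : ℝ)
    {S : Set ℝ} (hS : S = {t | σ * t < σ * l}) (k : ℕ) :
    (k : ℕ∞) ≤ Cardinal.toENat (Module.rank ℂ (E.toFun S).range) ↔
      ∃ v : Fin k → A.domain, IsPositiveForm fun i j =>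
        inner ℂ (v i : H) ((σ : ℂ) • ((l : ℂ) • (v j : H) - A (v j))) := by
  have hSm : MeasurableSet S := by
    rw [hS]
    exact measurableSet_lt (by fun_prop) (by fun_prop)
  have hform : ∀ (v : Fin k → A.domain) (c : Fin k → ℂ),
      (∑ i, ∑ j, starRingEnd ℂ (c i) * c j *
        inner ℂ (v i : H) ((σ : ℂ) • ((l : ℂ) • (v j : H) - A (v j)))).re =
      ∫ t, σ * (l - t) ∂(E.scalarMeasure (∑ i, c i • (v i : H))) := by
    intro v c
    rw [sum_form c (fun i => (v i : H))]
    have h1 : ∑ j, c j • ((σ : ℂ) • ((l : ℂ) • (v j : H) - A (v j))) =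
        (σ : ℂ) • ((l : ℂ) • ((∑ j, c j • v j : A.domain) : H) - A (∑ j, c j • v j)) := by
      rw [← LinearPMap.toFun_eq_coe, map_sum]
      simp only [map_smul, LinearPMap.toFun_eq_coe]
      rw [Submodule.coe_sum, Finset.smul_sum, ← Finset.sum_sub_distrib, Finset.smul_sum]
      refine Finset.sum_congr rfl fun j _ => ?_
      rw [Submodule.coe_smul, smul_comm (l : ℂ) (c j), ← smul_sub, smul_comm (c j)]
    have h2 : ∑ i, c i • (v i : H) = ((∑ i, c i • v i : A.domain) : H) := by
      rw [Submodule.coe_sum]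
      rfl
    rw [h1, h2, inner_smul_right, inner_sub_right, inner_smul_right, hE.2,
      inner_self_eq_norm_sq_to_K, integral_const_mul,
      integral_sub (integrable_const _) (E.integrable_id hE (SetLike.coe_mem _)), E.integral_one]
    rw [← Complex.ofReal_re (_ * _)]
    congr 1
    push_cast
    rfl
  constructor
  · intro h
    obtain ⟨e, hli⟩ := Module.le_rank_iff.mp (Cardinal.natCast_le_toENat.mp h)
    let w : Fin k → H := fun i => (e i : H)
    have hw : LinearIndependent ℂ w :=
      LinearIndependent.map' hli (Submodule.subtype _) (Submodule.ker_subtype _)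
    have hwS : ∀ i, E.toFun S (w i) = w i := by
      intro i
      obtain ⟨x, hx⟩ := (e i).2
      simp only [w]
      rw [← hx]
      exact E.idem hSm x
    have hB : ∀ m : ℕ, MeasurableSet (S ∩ Icc (-(m : ℝ)) m) := fun m => hSm.inter measurableSet_Icc
    have ht : ∀ i, Tendsto (fun m : ℕ => E.toFun (S ∩ Icc (-(m : ℝ)) m) (w i)) atTop (𝓝 (w i)) := by
      intro i
      have := E.tendsto_inter S hSm (w i)
      rwa [hwS] at this
    -- Truncation to a large bounded set keeps the Gram matrix positive definite, so linear
    -- independence survives while the vectors enter the domain.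
    obtain ⟨m, hm⟩ := ((isPositiveForm_gram hw).eventually
      (N := fun m i j => inner ℂ (E.toFun (S ∩ Icc (-(m : ℝ)) m) (w i))
        (E.toFun (S ∩ Icc (-(m : ℝ)) m) (w j))) fun i j => (ht i).inner (ht j)).exists
    set B := S ∩ Icc (-(m : ℝ)) m with hBdef
    have hae : ∀ x : H, ∀ᵐ t ∂(E.scalarMeasure (E.toFun B x)), t ∈ B := by
      intro x
      rw [ae_iff]
      exact E.scalarMeasure_compl (hB m) x
    have hdom : ∀ x : H, E.toFun B x ∈ A.domain := by
      intro x
      rw [hE.1]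
      refine lt_of_le_of_lt (lintegral_mono_ae (g := fun _ => ENNReal.ofReal ((m : ℝ) ^ 2)) ?_) ?_
      · filter_upwards [hae x] with t ht
        refine ENNReal.ofReal_le_ofReal ?_
        rw [sq_le_sq, Nat.abs_cast]
        exact abs_le.mpr ht.2
      · rw [lintegral_const]
        exact ENNReal.mul_lt_top ENNReal.ofReal_lt_top (measure_lt_top _ _)
    refine ⟨fun i => ⟨E.toFun B (w i), hdom _⟩, fun c hc => ?_⟩
    rw [hform]
    have h1 := hm c hc
    rw [sum_form, inner_self_eq_norm_sq_to_K] at h1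
    simp only
    set u := ∑ i, c i • E.toFun B (w i) with hu
    have hu' : u = E.toFun B (∑ i, c i • w i) := by
      rw [hu, map_sum]
      simp
    have hne : E.scalarMeasure u ≠ 0 := by
      intro h0
      have h2 := E.scalarMeasure_univ u
      rw [h0] at h2
      have h3 : 0 < ‖u‖ ^ 2 := by exact_mod_cast h1
      rw [Measure.coe_zero, Pi.zero_apply, eq_comm, ENNReal.ofReal_eq_zero] at h2
      exact absurd h3 (not_lt.mpr h2)
    have hpos : ∀ᵐ t ∂(E.scalarMeasure u), 0 < σ * (l - t) := by
      rw [hu']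
      filter_upwards [hae (∑ i, c i • w i)] with t ht
      have h4 := ht.1
      rw [hS] at h4
      simp only [mem_ofPred_eq] at h4
      linarith
    -- The integrand is strictly positive almost everywhere and the measure is nonzero.
    rw [integral_pos_iff_support_of_nonneg_ae (hpos.mono fun t ht => ht.le)]
    · refine lt_of_le_of_ne bot_le fun h0 => hne ?_
      rw [← Measure.measure_univ_eq_zero, ← nonpos_iff_eq_zero]
      have h5 : E.scalarMeasure u (Function.support fun t => σ * (l - t))ᶜ = 0 := by
        refine measure_mono_null ?_ (ae_iff.mp hpos)
        intro t ht
        simp only [mem_compl_iff, Function.mem_support, not_not] at ht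
        simp [ht]
      rw [← union_compl_self (Function.support fun t => σ * (l - t))]
      refine (measure_union_le _ _).trans (le_of_eq ?_)
      rw [h5, add_zero]
      exact h0.symm
    · refine ((integrable_const l).sub (E.integrable_id hE ?_)).const_mul σ
      rw [hu']
      exact hdom _
  · rintro ⟨v, hv⟩
    -- A linear relation among the projected vectors gives a combination whose measure lives off S,
    -- where σ(l - t) ≤ 0, against positivity of the form.
    have hli : LinearIndependent ℂ fun i => (⟨E.toFun S (v i : H), _, rfl⟩ : (E.toFun S).range) := by
      rw [Fintype.linearIndependent_iff]
      intro c hc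
      by_contra hne
      have hc0 : c ≠ 0 := fun h => hne fun i => congrFun h i
      have h1 := hv c hc0
      rw [hform] at h1
      have h2 : E.toFun S (∑ i, c i • (v i : H)) = 0 := by
        have := congrArg Subtype.val hc
        rw [map_sum]
        simpa using this
      have h3 : E.scalarMeasure (∑ i, c i • (v i : H)) S = 0 := by
        rw [E.scalarMeasure_apply _ hSm, h2]
        simp
      refine absurd h1 (not_lt.mpr (integral_nonpos_of_ae ?_))
      have h4 : ∀ᵐ t ∂(E.scalarMeasure (∑ i, c i • (v i : H))), t ∉ S := by
        rw [ae_iff]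
        simpa using h3
      filter_upwards [h4] with t ht
      rw [hS] at ht
      simp only [mem_ofPred_eq, not_lt] at ht
      simp only [Pi.zero_apply]
      linarith
    exact Cardinal.natCast_le_toENat.mpr (Module.le_rank_iff.mpr ⟨_, hli⟩)

end ProjectionValuedMeasure

/-! ### Counting functions as maximal ranks of positive forms -/

section Counting

variable {H : Type*} [NormedAddCommGroup H] [InnerProductSpace ℂ H] [CompleteSpace H]

theorem le_Nminus_iff {A : H →ₗ.[ℂ] H}
    (hA : ∃ E : ProjectionValuedMeasure H, E.IsSpectralMeasureOf A) (l : ℝ) (k : ℕ) :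
    (k : ℕ∞) ≤ Nminus l A ↔ ∃ v : Fin k → A.domain, IsPositiveForm fun i j =>
      inner ℂ (v i : H) ((l : ℂ) • (v j : H) - A (v j)) := by
  rw [Nminus, spectralProjection, dif_pos hA,
    hA.choose.le_rank_iff hA.choose_spec (σ := 1) l (by ext; simp)]
  simp

theorem le_Nplus_iff {A : H →ₗ.[ℂ] H}
    (hA : ∃ E : ProjectionValuedMeasure H, E.IsSpectralMeasureOf A) (l : ℝ) (k : ℕ) :
    (k : ℕ∞) ≤ Nplus l A ↔ ∃ v : Fin k → A.domain, IsPositiveForm fun i j =>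
      inner ℂ (v i : H) (A (v j) - (l : ℂ) • (v j : H)) := by
  rw [Nplus, spectralProjection, dif_pos hA,
    hA.choose.le_rank_iff hA.choose_spec (σ := -1) l (by ext; simp)]
  simp

theorem eq_of_forall_natCast_le_iff {a b : ℕ∞} (h : ∀ k : ℕ, (k : ℕ∞) ≤ a ↔ (k : ℕ∞) ≤ b) :
    a = b :=
  le_antisymm (ENat.forall_natCast_le_iff_le.mp fun k hk => (h k).mp hk)
    (ENat.forall_natCast_le_iff_le.mp fun k hk => (h k).mpr hk)

end Counting

/-! ## Hermite functions -/

section Moments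

/-- Expand the exponential and integrate termwise; the partial sums are dominated by exp(|t||y|)
|g|. -/
theorem integral_cexp_mul_eq_zero {g : ℝ → ℝ} (hm : AEStronglyMeasurable g)
    (hexp : ∀ c : ℝ, Integrable fun y => Real.exp (c * |y|) * |g y|)
    (h0 : ∀ n : ℕ, ∫ y, y ^ n * g y = 0) (t : ℝ) :
    ∫ y : ℝ, Complex.exp (t * y * Complex.I) * g y = 0 := by
  have hF : ∀ n : ℕ, ∫ y : ℝ, ((t * y * Complex.I : ℂ) ^ n / n.factorial) * g y = 0 := by
    intro n
    have h1 : ∀ y : ℝ, ((t * y * Complex.I : ℂ) ^ n / n.factorial) * g y =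
        ((t * Complex.I) ^ n / n.factorial) * ((y ^ n * g y : ℝ) : ℂ) := by
      intro y
      push_cast
      ring
    simp only [h1]
    rw [integral_const_mul, integral_complex_ofReal, h0]
    simp
  have h := hasSum_integral_of_dominated_convergence (μ := volume)
    (F := fun (n : ℕ) (y : ℝ) => ((t * y * Complex.I : ℂ) ^ n / n.factorial) * g y)
    (f := fun y => Complex.exp (t * y * Complex.I) * g y)
    (fun n y => (|t| * |y|) ^ n / n.factorial * |g y|) ?_ ?_ ?_ ?_ ?_
  · simp only [hF] at h
    exact h.unique hasSum_zero
  · intro n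
    exact (by fun_prop : Continuous fun y : ℝ => ((t * y * Complex.I : ℂ) ^ n / n.factorial)).aestronglyMeasurable.mul
      (Complex.continuous_ofReal.comp_aestronglyMeasurable hm)
  · intro n
    refine Eventually.of_forall fun y => le_of_eq ?_
    simp
  · exact Eventually.of_forall fun y => (Real.summable_pow_div_factorial _).mul_right _
  · have h2 : (fun y => ∑' n : ℕ, (|t| * |y|) ^ n / n.factorial * |g y|) =
        fun y => Real.exp (|t| * |y|) * |g y| := by
      ext y
      rw [tsum_mul_right, Real.exp_eq_exp_ℝ, NormedSpace.exp_eq_tsum_div]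
    rw [h2]
    exact hexp |t|
  · refine Eventually.of_forall fun y => ?_
    have h3 := NormedSpace.expSeries_div_hasSum_exp (t * y * Complex.I : ℂ)
    rw [← Complex.exp_eq_exp_ℂ] at h3
    exact h3.mul_right _

/-- The Fourier transform of g vanishes, so the finite measures with densities g⁺ and g⁻ have the
same characteristic function and coincide. -/
theorem ae_eq_zero_of_moments {g : ℝ → ℝ} (hm : AEStronglyMeasurable g)
    (hexp : ∀ c : ℝ, Integrable fun y => Real.exp (c * |y|) * |g y|)
    (h0 : ∀ n : ℕ, ∫ y, y ^ n * g y = 0) : g =ᵐ[volume] 0 := by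
  have hg : Integrable g := by
    have := hexp 0
    simp only [zero_mul, Real.exp_zero, one_mul] at this
    exact (integrable_norm_iff hm).mp this
  have hfin := isFiniteMeasure_withDensity_ofReal hg.2
  have hfin' := isFiniteMeasure_withDensity_ofReal hg.neg.2
  have hpm : ∀ {f : ℝ → ℝ}, Integrable f → ∀ t : ℝ,
      charFun (volume.withDensity fun y => ENNReal.ofReal (f y)) t =
      ∫ y : ℝ, Complex.exp (t * y * Complex.I) * ((max (f y) 0 : ℝ) : ℂ) := by
    intro f hf t
    rw [charFun_apply_real, integral_withDensity_eq_integral_toReal_smul₀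
      hf.1.aemeasurable.ennreal_ofReal (by simp)]
    refine integral_congr_ae (Eventually.of_forall fun y => ?_)
    simp only [ENNReal.toReal_ofReal', Complex.real_smul]
    ring
  have hint : ∀ {f : ℝ → ℝ}, Integrable f → ∀ t : ℝ,
      Integrable fun y : ℝ => Complex.exp (t * y * Complex.I) * ((max (f y) 0 : ℝ) : ℂ) := by
    intro f hf t
    refine hf.pos_part.ofReal.bdd_mul (c := 1) (by fun_prop) ?_
    refine Eventually.of_forall fun y => le_of_eq ?_
    have : (t * y * Complex.I : ℂ) = ((t * y : ℝ) : ℂ) * Complex.I := by push_cast; ring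
    rw [this, Complex.norm_exp_ofReal_mul_I]
  have heq : (volume.withDensity fun y => ENNReal.ofReal (g y)) =
      volume.withDensity fun y => ENNReal.ofReal ((-g) y) := by
    refine Measure.ext_of_charFun ?_
    ext t
    rw [hpm hg, hpm hg.neg, ← sub_eq_zero, ← integral_sub (hint hg t) (hint hg.neg t),
      ← integral_cexp_mul_eq_zero hm hexp h0 t]
    refine integral_congr_ae (Eventually.of_forall fun y => ?_)
    simp only [Pi.neg_apply]
    rw [← mul_sub, ← Complex.ofReal_sub]
    congr 2
    rcases le_total 0 (g y) with h | h
    · rw [max_eq_left h, max_eq_right (by linarith)]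
      ring
    · rw [max_eq_right h, max_eq_left (by linarith)]
      ring
  have h2 := (withDensity_eq_iff hg.1.aemeasurable.ennreal_ofReal
    hg.neg.1.aemeasurable.ennreal_ofReal
    (hg.lintegral_lt_top.ne)).mp heq
  filter_upwards [h2] with y hy
  have h3 := congrArg ENNReal.toReal hy
  simp only [ENNReal.toReal_ofReal', Pi.neg_apply] at h3
  rcases le_total 0 (g y) with h | h
  · rw [max_eq_left h, max_eq_right (by linarith)] at h3
    exact h3
  · rw [max_eq_right h, max_eq_left (by linarith)] at h3
    simp only [Pi.zero_apply]
    linarith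

end Moments

/-! ### Ladder relations, orthonormality and completeness of the Hermite functions -/

section Hermite

open Polynomial in
/-- Normalized Hermite polynomials. -/
noncomputable def hermitePoly : ℕ → ℝ[X]
  | 0 => C (Real.pi ^ (-(1 / 4) : ℝ))
  | n + 1 => C (Real.sqrt (2 * (n + 1)))⁻¹ * (C 2 * X * hermitePoly n - derivative (hermitePoly n))

open Polynomial in
-- The induction step is the Hermite equation, itself obtained by differentiating the induction
-- hypothesis. The truncated index n - 1 at n = 0 is multiplied by √0.
theorem derivative_hermitePoly (n : ℕ) :
    derivative (hermitePoly n) = C (Real.sqrt (2 * n)) * hermitePoly (n - 1) := by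
  induction n with
  | zero => simp [hermitePoly]
  | succ n ih =>
    -- The Hermite differential equation 2xp' - p'' = 2np for the polynomial of degree n.
    have h1 : C 2 * X * derivative (hermitePoly n) - derivative (derivative (hermitePoly n)) =
        C (2 * n : ℝ) * hermitePoly n := by
      cases n with
      | zero => simp [hermitePoly]
      | succ m =>
        rw [ih]
        simp only [derivative_mul, derivative_C, zero_mul, zero_add, Nat.add_sub_cancel]
        have h2 : hermitePoly (m + 1) = C (Real.sqrt (2 * (m + 1)))⁻¹ *
          (C 2 * X * hermitePoly m - derivative (hermitePoly m)) := rfl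
        have h3 : (C (2 * ((m + 1 : ℕ) : ℝ)) : ℝ[X]) * C (Real.sqrt (2 * (m + 1)))⁻¹ =
            C (Real.sqrt (2 * ((m + 1 : ℕ) : ℝ))) := by
          rw [← C_mul]
          congr 1
          push_cast
          have : 0 < Real.sqrt (2 * ((m : ℝ) + 1)) := Real.sqrt_pos.mpr (by positivity)
          rw [mul_inv_eq_iff_eq_mul₀ this.ne', Real.mul_self_sqrt (by positivity)]
        rw [h2, ← mul_assoc (C _) (C _), h3]
        ring
    have h4 : (C (Real.sqrt (2 * (n + 1)))⁻¹ : ℝ[X]) * C (2 + 2 * n : ℝ) =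
        C (Real.sqrt (2 * ((n + 1 : ℕ) : ℝ))) := by
      rw [← C_mul]
      congr 1
      push_cast
      have : 0 < Real.sqrt (2 * ((n : ℝ) + 1)) := Real.sqrt_pos.mpr (by positivity)
      rw [inv_mul_eq_iff_eq_mul₀ this.ne', Real.mul_self_sqrt (by positivity)]
      ring
    rw [hermitePoly, Nat.add_sub_cancel, ← h4]
    simp only [derivative_mul, derivative_C, derivative_sub, derivative_X, zero_mul, zero_add,
      mul_one]
    rw [C_add]
    linear_combination (C (Real.sqrt (2 * (n + 1)))⁻¹ : ℝ[X]) * h1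

/-- The Hermite functions, an orthonormal basis of `L²(ℝ)`. -/
noncomputable def hermiteFun (n : ℕ) (y : ℝ) : ℝ :=
  (hermitePoly n).eval y * Real.exp (-y ^ 2 / 2)

theorem contDiff_hermiteFun (n : ℕ) : ContDiff ℝ ∞ (hermiteFun n) := by
  unfold hermiteFun
  have : ContDiff ℝ ∞ fun y : ℝ => (hermitePoly n).eval y := by
    have h := Polynomial.contDiff_aeval (𝕜 := ℝ) (hermitePoly n) ∞
    simp only [Polynomial.coe_aeval_eq_eval] at h
    exact h
  fun_prop

theorem continuous_hermiteFun (n : ℕ) : Continuous (hermiteFun n) :=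
  (contDiff_hermiteFun n).continuous

theorem hermiteFun_succ (n : ℕ) (y : ℝ) : Real.sqrt (2 * (n + 1)) * hermiteFun (n + 1) y =
    (2 * y * (hermitePoly n).eval y - (hermitePoly n).derivative.eval y) * Real.exp (-y ^ 2 / 2) := by
  have : 0 < Real.sqrt (2 * ((n : ℝ) + 1)) := Real.sqrt_pos.mpr (by positivity)
  simp only [hermiteFun, hermitePoly, Polynomial.eval_mul, Polynomial.eval_C, Polynomial.eval_sub,
    Polynomial.eval_X]
  field_simp

theorem sqrt_two_mul_eq (x : ℝ) : Real.sqrt (2 * x) = 2 * Real.sqrt (x / 2) := by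
  have h : (2 : ℝ) * x = 2 ^ 2 * (x / 2) := by ring
  rw [h, Real.sqrt_mul (by positivity), Real.sqrt_sq (by norm_num)]

theorem mul_hermiteFun (n : ℕ) (y : ℝ) : y * hermiteFun n y =
    Real.sqrt ((n + 1) / 2) * hermiteFun (n + 1) y + Real.sqrt (n / 2) * hermiteFun (n - 1) y := by
  have h1 := hermiteFun_succ n y
  have h2 := derivative_hermitePoly n
  rw [sqrt_two_mul_eq] at h1 h2
  rw [h2, Polynomial.eval_mul, Polynomial.eval_C] at h1
  simp only [hermiteFun] at h1 ⊢
  linear_combination -(1 / 2) * h1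

theorem hasDerivAt_hermiteFun (n : ℕ) (y : ℝ) : HasDerivAt (hermiteFun n)
    (Real.sqrt (n / 2) * hermiteFun (n - 1) y - Real.sqrt ((n + 1) / 2) * hermiteFun (n + 1) y) y := by
  have h0 : HasDerivAt (fun y : ℝ => Real.exp (-y ^ 2 / 2)) (Real.exp (-y ^ 2 / 2) * (-y)) y := by
    have h : HasDerivAt (fun y : ℝ => -y ^ 2 / 2) (-y) y := by
      have := ((hasDerivAt_pow 2 y).neg).div_const 2
      refine this.congr_deriv ?_
      simp
      ring
    exact h.exp
  refine (((hermitePoly n).hasDerivAt y).mul h0).congr_deriv ?_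
  have h1 := hermiteFun_succ n y
  have h2 := derivative_hermitePoly n
  rw [sqrt_two_mul_eq] at h1 h2
  rw [h2, Polynomial.eval_mul, Polynomial.eval_C] at h1 ⊢
  simp only [hermiteFun] at h1 ⊢
  linear_combination (1 / 2) * h1

/-- A polynomial is O(exp |y|), and |y| - y²/2 ≤ 1 - y²/4 because (|y| - 2)² ≥ 0. -/
theorem exists_polynomial_bound (p : Polynomial ℝ) : ∃ C, ∀ y : ℝ,
    |p.eval y * Real.exp (-y ^ 2 / 2)| ≤ C * Real.exp (-(1 / 4) * y ^ 2) := by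
  have h1 : ∃ C, 0 ≤ C ∧ ∀ y : ℝ, |p.eval y| ≤ C * Real.exp |y| := by
    induction p using Polynomial.induction_on' with
    | add p q hp hq =>
      obtain ⟨C, hC, h⟩ := hp
      obtain ⟨D, hD, h'⟩ := hq
      refine ⟨C + D, by positivity, fun y => ?_⟩
      rw [Polynomial.eval_add, add_mul]
      exact (abs_add_le _ _).trans (add_le_add (h y) (h' y))
    | monomial n a =>
      refine ⟨|a| * n.factorial, by positivity, fun y => ?_⟩
      rw [Polynomial.eval_monomial, abs_mul, abs_pow, mul_assoc]
      refine mul_le_mul_of_nonneg_left ?_ (abs_nonneg a)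
      have := Real.pow_div_factorial_le_exp |y| (abs_nonneg y) n
      rw [div_le_iff₀ (by positivity)] at this
      linarith
  obtain ⟨C, hC, h⟩ := h1
  refine ⟨C * Real.exp 1, fun y => ?_⟩
  rw [abs_mul, Real.abs_exp]
  calc |p.eval y| * Real.exp (-y ^ 2 / 2) ≤ C * Real.exp |y| * Real.exp (-y ^ 2 / 2) :=
        mul_le_mul_of_nonneg_right (h y) (Real.exp_pos _).le
    _ = C * Real.exp (|y| + -y ^ 2 / 2) := by rw [Real.exp_add]; ring
    _ ≤ C * Real.exp (1 + -(1 / 4) * y ^ 2) := by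
        refine mul_le_mul_of_nonneg_left (Real.exp_le_exp.mpr ?_) hC
        nlinarith [sq_nonneg (|y| - 2), sq_abs y]
    _ = _ := by rw [Real.exp_add]; ring

theorem exists_hermiteFun_bound (n : ℕ) : ∃ C, ∀ y : ℝ,
    |hermiteFun n y| ≤ C * Real.exp (-(1 / 4) * y ^ 2) := exists_polynomial_bound _

theorem memLp_exp_neg_mul_sq {b : ℝ} (hb : 0 < b) :
    MemLp (fun y : ℝ => Real.exp (-b * y ^ 2)) 2 := by
  rw [memLp_two_iff_integrable_sq (by fun_prop)]
  have := integrable_exp_neg_mul_sq (b := 2 * b) (by linarith)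
  refine this.congr (Eventually.of_forall fun y => ?_)
  simp only
  rw [← Real.exp_nat_mul]
  congr 1
  push_cast
  ring

theorem memLp_gaussian : MemLp (fun y : ℝ => Real.exp (-(1 / 4) * y ^ 2)) 2 :=
  memLp_exp_neg_mul_sq (by norm_num)

theorem memLp_hermiteFun (n : ℕ) : MemLp (hermiteFun n) 2 := by
  obtain ⟨C, hC⟩ := exists_hermiteFun_bound n
  refine (memLp_gaussian.const_mul C).mono' (continuous_hermiteFun n).aestronglyMeasurable
    (Eventually.of_forall fun y => ?_)
  simpa using hC y

theorem integrable_hermiteFun_mul (m n : ℕ) : Integrable fun y => hermiteFun m y * hermiteFun n y :=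
  (memLp_hermiteFun m).integrable_mul (memLp_hermiteFun n)

/-- Creation and annihilation are adjoint: χₙ' = yχₙ - √(2(n+1)) χₙ₊₁ and χₘ' = √(2m) χₘ₋₁ - yχₘ,
and integration by parts cancels the terms with y. Orthonormality follows by induction. -/
theorem integral_hermiteFun_succ_mul (m n : ℕ) :
    Real.sqrt (2 * (n + 1)) * ∫ y, hermiteFun (n + 1) y * hermiteFun m y =
      Real.sqrt (2 * m) * ∫ y, hermiteFun n y * hermiteFun (m - 1) y := by
  have hd : ∀ k y, HasDerivAt (hermiteFun k) (y * hermiteFun k y -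
      Real.sqrt (2 * (k + 1)) * hermiteFun (k + 1) y) y := by
    intro k y
    refine (hasDerivAt_hermiteFun k y).congr_deriv ?_
    rw [mul_hermiteFun, sqrt_two_mul_eq]
    ring
  have hd' : ∀ k y, HasDerivAt (hermiteFun k) (Real.sqrt (2 * k) * hermiteFun (k - 1) y -
      y * hermiteFun k y) y := by
    intro k y
    refine (hasDerivAt_hermiteFun k y).congr_deriv ?_
    rw [mul_hermiteFun, sqrt_two_mul_eq]
    ring
  have hy : Integrable fun y => y * hermiteFun n y * hermiteFun m y := by
    simp only [mul_hermiteFun, add_mul, mul_assoc]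
    exact ((integrable_hermiteFun_mul _ _).const_mul _).add
      ((integrable_hermiteFun_mul _ _).const_mul _)
  have h1 := integral_mul_deriv_eq_deriv_mul_of_integrable (fun y _ => hd n y) (fun y _ => hd' m y)
    (by
      refine (((integrable_hermiteFun_mul n (m - 1)).const_mul (Real.sqrt (2 * m))).sub hy).congr
        (Eventually.of_forall fun y => ?_)
      simp only [Pi.sub_apply, Pi.mul_apply]
      ring)
    (by
      refine (hy.sub ((integrable_hermiteFun_mul (n + 1) m).const_mul
        (Real.sqrt (2 * (n + 1))))).congr (Eventually.of_forall fun y => ?_)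
      simp only [Pi.sub_apply, Pi.mul_apply]
      ring)
    (integrable_hermiteFun_mul n m)
  have h2 : ∫ y, hermiteFun n y * (Real.sqrt (2 * m) * hermiteFun (m - 1) y - y * hermiteFun m y) =
      Real.sqrt (2 * m) * (∫ y, hermiteFun n y * hermiteFun (m - 1) y) -
      ∫ y, y * hermiteFun n y * hermiteFun m y := by
    rw [← integral_const_mul, ← integral_sub ((integrable_hermiteFun_mul _ _).const_mul _) hy]
    refine integral_congr_ae (Eventually.of_forall fun y => ?_)
    simp only
    ring
  have h3 : ∫ y, (y * hermiteFun n y - Real.sqrt (2 * (n + 1)) * hermiteFun (n + 1) y) *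
      hermiteFun m y = (∫ y, y * hermiteFun n y * hermiteFun m y) -
      Real.sqrt (2 * (n + 1)) * ∫ y, hermiteFun (n + 1) y * hermiteFun m y := by
    rw [← integral_const_mul, ← integral_sub hy ((integrable_hermiteFun_mul _ _).const_mul _)]
    refine integral_congr_ae (Eventually.of_forall fun y => ?_)
    simp only
    ring
  rw [h2, h3] at h1
  linarith

theorem integral_hermiteFun_zero_sq : ∫ y, hermiteFun 0 y * hermiteFun 0 y = 1 := by
  have h1 : ∀ y : ℝ, hermiteFun 0 y * hermiteFun 0 y =
      Real.pi ^ (-(1 / 2) : ℝ) * Real.exp (-1 * y ^ 2) := by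
    intro y
    simp only [hermiteFun, hermitePoly, Polynomial.eval_C]
    have h2 : Real.exp (-1 * y ^ 2) = Real.exp (-y ^ 2 / 2) * Real.exp (-y ^ 2 / 2) := by
      rw [← Real.exp_add]; ring_nf
    have h3 : Real.pi ^ (-(1 / 2) : ℝ) = Real.pi ^ (-(1 / 4) : ℝ) * Real.pi ^ (-(1 / 4) : ℝ) := by
      rw [← Real.rpow_add Real.pi_pos]; norm_num
    rw [h2, h3]
    ring
  simp only [h1]
  rw [integral_const_mul, integral_gaussian, div_one, Real.sqrt_eq_rpow,
    ← Real.rpow_add Real.pi_pos]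
  norm_num

theorem integral_hermiteFun_mul (n m : ℕ) :
    ∫ y, hermiteFun n y * hermiteFun m y = if n = m then 1 else 0 := by
  have hs : ∀ n : ℕ, Real.sqrt (2 * ((n : ℝ) + 1)) ≠ 0 := fun n =>
    (Real.sqrt_pos.mpr (by positivity)).ne'
  induction n generalizing m with
  | zero =>
    cases m with
    | zero => simpa using integral_hermiteFun_zero_sq
    | succ m =>
      have h := integral_hermiteFun_succ_mul 0 m
      simp only [mul_comm (hermiteFun (m + 1) _)] at h
      rw [Nat.cast_zero, mul_zero, Real.sqrt_zero, zero_mul] at h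
      rw [(mul_eq_zero.mp h).resolve_left (hs m)]
      simp
  | succ n ih =>
    cases m with
    | zero =>
      have h := integral_hermiteFun_succ_mul 0 n
      rw [Nat.cast_zero, mul_zero, Real.sqrt_zero, zero_mul] at h
      rw [(mul_eq_zero.mp h).resolve_left (hs n)]
      simp
    | succ m =>
      have h := integral_hermiteFun_succ_mul (m + 1) n
      rw [Nat.add_sub_cancel, ih m] at h
      by_cases hnm : n = m
      · subst hnm
        push_cast at h
        rw [if_pos rfl]
        exact mul_left_cancel₀ (hs n) (by simpa using h)
      · rw [if_neg hnm, mul_zero] at h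
        rw [(mul_eq_zero.mp h).resolve_left (hs n), if_neg (by omega)]

/-- The spare Gaussian decay lets Hermite functions be paired with functions outside L², such as y
f(y) with f in L². -/
theorem memLp_exp_mul_hermiteFun (n : ℕ) :
    MemLp (fun y => Real.exp (1 / 8 * y ^ 2) * hermiteFun n y) 2 := by
  obtain ⟨C, hC⟩ := exists_hermiteFun_bound n
  refine ((memLp_exp_neg_mul_sq (b := 1 / 8) (by norm_num)).const_mul C).mono'
    ((by fun_prop : Continuous fun y : ℝ => Real.exp (1 / 8 * y ^ 2)).mul
      (continuous_hermiteFun n)).aestronglyMeasurable (Eventually.of_forall fun y => ?_)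
  rw [norm_mul, Real.norm_eq_abs, Real.abs_exp, Real.norm_eq_abs]
  refine (mul_le_mul_of_nonneg_left (hC y) (Real.exp_pos _).le).trans (le_of_eq ?_)
  rw [mul_left_comm, ← Real.exp_add]
  congr 2
  ring

theorem integrable_hermiteFun_mul_of_weighted {f : ℝ → ℝ}
    (hf : MemLp (fun y => Real.exp (-(1 / 8) * y ^ 2) * f y) 2) (n : ℕ) :
    Integrable fun y => hermiteFun n y * f y := by
  refine ((memLp_exp_mul_hermiteFun n).integrable_mul hf).congr (Eventually.of_forall fun y => ?_)
  simp only [Pi.mul_apply]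
  have : Real.exp (1 / 8 * y ^ 2) * Real.exp (-(1 / 8) * y ^ 2) = 1 := by
    rw [← Real.exp_add, neg_mul, add_neg_cancel, Real.exp_zero]
  linear_combination (hermiteFun n y * f y) * this

/-- By the three-term recurrence, vanishing Hermite coefficients make every moment of exp(-y²/2) f
vanish. The weighted hypothesis instead of f in L² is needed to identify y f(y) from its
coefficients. -/
theorem ae_eq_zero_of_hermite_real {f : ℝ → ℝ} (hm : AEStronglyMeasurable f)
    (hf : MemLp (fun y => Real.exp (-(1 / 8) * y ^ 2) * f y) 2)
    (h0 : ∀ n, ∫ y, hermiteFun n y * f y = 0) : f =ᵐ[volume] 0 := by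
  have hint : ∀ (c : ℝ), Integrable fun y => Real.exp (c * |y|) *
      |Real.exp (-y ^ 2 / 2) * f y| := by
    intro c
    -- The constant exp(2c²) completes the square: c|y| - 3y²/8 ≤ 2c² - y²/4 since (|y| - 4c)² ≥ 0.
    -- The remaining factor exp(-y²/8) belongs to f.
    have h1 : MemLp (fun y : ℝ => Real.exp (c * |y|) * Real.exp (-(3 / 8) * y ^ 2)) 2 := by
      refine (memLp_gaussian.const_mul (Real.exp (2 * c ^ 2))).mono' (by fun_prop)
        (Eventually.of_forall fun y => ?_)
      rw [← Real.exp_add, ← Real.exp_add, Real.norm_eq_abs, Real.abs_exp]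
      refine Real.exp_le_exp.mpr ?_
      nlinarith [sq_nonneg (|y| - 4 * c), sq_abs y]
    refine (h1.integrable_mul hf.norm).congr (Eventually.of_forall fun y => ?_)
    have h2 : Real.exp (-(3 / 8) * y ^ 2) * Real.exp (-(1 / 8) * y ^ 2) =
        Real.exp (-y ^ 2 / 2) := by
      rw [← Real.exp_add]
      congr 1
      ring
    simp only [Pi.mul_apply]
    rw [abs_mul, Real.abs_exp, norm_mul, Real.norm_eq_abs, Real.norm_eq_abs, Real.abs_exp, ← h2]
    ring
  have hk : ∀ k m : ℕ, Integrable (fun y => y ^ k * hermiteFun m y * f y) ∧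
      ∫ y, y ^ k * hermiteFun m y * f y = 0 := by
    intro k
    induction k with
    | zero =>
      intro m
      simp only [pow_zero, one_mul]
      exact ⟨integrable_hermiteFun_mul_of_weighted hf m, h0 m⟩
    | succ k ih =>
      intro m
      have h1 : ∀ y, y ^ (k + 1) * hermiteFun m y * f y =
          Real.sqrt ((m + 1) / 2) * (y ^ k * hermiteFun (m + 1) y * f y) +
          Real.sqrt (m / 2) * (y ^ k * hermiteFun (m - 1) y * f y) := by
        intro y
        have := mul_hermiteFun m y
        linear_combination (y ^ k * f y) * this
      simp only [h1]
      refine ⟨((ih _).1.const_mul _).add ((ih _).1.const_mul _), ?_⟩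
      rw [integral_add ((ih _).1.const_mul _) ((ih _).1.const_mul _), integral_const_mul,
        integral_const_mul, (ih _).2, (ih _).2]
      simp
  have h2 := ae_eq_zero_of_moments (g := fun y => Real.exp (-y ^ 2 / 2) * f y)
    ((by fun_prop : Continuous fun y : ℝ => Real.exp (-y ^ 2 / 2)).aestronglyMeasurable.mul hm)
    hint fun n => by
      have h3 := (hk n 0).2
      have h4 : ∀ y : ℝ, y ^ n * hermiteFun 0 y * f y =
          Real.pi ^ (-(1 / 4) : ℝ) * (y ^ n * (Real.exp (-y ^ 2 / 2) * f y)) := by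
        intro y
        simp only [hermiteFun, hermitePoly, Polynomial.eval_C]
        ring
      simp only [h4] at h3
      rw [integral_const_mul] at h3
      exact (mul_eq_zero.mp h3).resolve_left (Real.rpow_pos_of_pos Real.pi_pos _).ne'
  filter_upwards [h2] with y hy
  exact (mul_eq_zero.mp hy).resolve_left (Real.exp_pos _).ne'

theorem memLp_hermiteFun_complex (n : ℕ) : MemLp (fun y => (hermiteFun n y : ℂ)) 2 :=
  (memLp_hermiteFun n).ofReal

theorem integrable_hermiteFun_mul_complex {f : ℝ → ℂ} (hf : MemLp f 2) (n : ℕ) :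
    Integrable fun y => (hermiteFun n y : ℂ) * f y :=
  (memLp_hermiteFun_complex n).integrable_mul hf

theorem ae_eq_zero_of_hermite_of_weighted {f : ℝ → ℂ} (hm : AEStronglyMeasurable f)
    (hf : MemLp (fun y => ((Real.exp (-(1 / 8) * y ^ 2) : ℝ) : ℂ) * f y) 2)
    (h0 : ∀ n, ∫ y, (hermiteFun n y : ℂ) * f y = 0) : f =ᵐ[volume] 0 := by
  have hre : MemLp (fun y => Real.exp (-(1 / 8) * y ^ 2) * (f y).re) 2 := by
    simpa only [RCLike.re_to_complex, Complex.re_ofReal_mul] using hf.re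
  have him : MemLp (fun y => Real.exp (-(1 / 8) * y ^ 2) * (f y).im) 2 := by
    simpa only [RCLike.im_to_complex, Complex.im_ofReal_mul] using hf.im
  have hi : ∀ n, Integrable fun y => (hermiteFun n y : ℂ) * f y := fun n => by
    refine (((integrable_hermiteFun_mul_of_weighted hre n).ofReal (𝕜 := ℂ)).add
      (((integrable_hermiteFun_mul_of_weighted him n).ofReal (𝕜 := ℂ)).mul_const
        Complex.I)).congr (Eventually.of_forall fun y => ?_)
    apply Complex.ext <;> simp
  have h1 := ae_eq_zero_of_hermite_real (Complex.continuous_re.comp_aestronglyMeasurable hm) hre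
    fun n => by
      have := congrArg Complex.re (h0 n)
      have h2 := Complex.reCLM.integral_comp_comm (hi n)
      rw [Complex.reCLM_apply, this] at h2
      simpa using h2
  have h2 := ae_eq_zero_of_hermite_real (Complex.continuous_im.comp_aestronglyMeasurable hm) him
    fun n => by
      have := congrArg Complex.im (h0 n)
      have h2 := Complex.imCLM.integral_comp_comm (hi n)
      rw [Complex.imCLM_apply, this] at h2
      simpa using h2
  filter_upwards [h1, h2] with y h3 h4
  exact Complex.ext h3 h4

theorem ae_eq_zero_of_hermite {f : ℝ → ℂ} (hf : MemLp f 2)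
    (h0 : ∀ n, ∫ y, (hermiteFun n y : ℂ) * f y = 0) : f =ᵐ[volume] 0 := by
  refine ae_eq_zero_of_hermite_of_weighted hf.1 (hf.mono ?_ (Eventually.of_forall fun y => ?_)) h0
  · exact (by fun_prop : Continuous fun y : ℝ =>
      ((Real.exp (-(1 / 8) * y ^ 2) : ℝ) : ℂ)).aestronglyMeasurable.mul hf.1
  · rw [norm_mul, Complex.norm_real, Real.norm_eq_abs, Real.abs_exp]
    refine mul_le_of_le_one_left (norm_nonneg _) (Real.exp_le_one_iff.mpr ?_)
    nlinarith [sq_nonneg y]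

/-- The Hilbert space `L²(ℝ)`. -/
abbrev L2Line : Type := Lp ℂ 2 (volume : Measure ℝ)

/-- Hermite functions as elements of `L²(ℝ)`. -/
noncomputable def hermiteLp (n : ℕ) : L2Line := (memLp_hermiteFun_complex n).toLp _

theorem coeFn_hermiteLp (n : ℕ) : hermiteLp n =ᵐ[volume] fun y => (hermiteFun n y : ℂ) :=
  MemLp.coeFn_toLp _

theorem inner_hermiteLp (n : ℕ) (f : L2Line) :
    inner ℂ (hermiteLp n) f = ∫ y, (hermiteFun n y : ℂ) * f y := by
  rw [L2.inner_def]
  refine integral_congr_ae ?_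
  filter_upwards [coeFn_hermiteLp n] with y hy
  rw [hy, RCLike.inner_apply, mul_comm]
  congr 1
  exact Complex.conj_ofReal _

theorem orthonormal_hermiteLp : Orthonormal ℂ hermiteLp := by
  rw [orthonormal_iff_ite]
  intro n m
  rw [inner_hermiteLp]
  have h1 : ∫ y, (hermiteFun n y : ℂ) * hermiteLp m y =
      ∫ y, ((hermiteFun n y * hermiteFun m y : ℝ) : ℂ) := by
    refine integral_congr_ae ?_
    filter_upwards [coeFn_hermiteLp m] with y hy
    rw [hy]
    push_cast
    rfl
  rw [h1, integral_complex_ofReal, integral_hermiteFun_mul]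
  split_ifs <;> simp

/-- The Hermite basis of `L²(ℝ)`. -/
noncomputable def hermiteBasis : HilbertBasis ℕ ℂ L2Line :=
  HilbertBasis.mkOfOrthogonalEqBot orthonormal_hermiteLp (by
    rw [Submodule.eq_bot_iff]
    intro f hf
    refine (Lp.eq_zero_iff_ae_eq_zero).mpr (ae_eq_zero_of_hermite (Lp.memLp f) fun n => ?_)
    rw [← inner_hermiteLp]
    exact Submodule.inner_right_of_mem_orthogonal (Submodule.subset_span (mem_range_self n)) hf)

theorem hermiteBasis_apply (n : ℕ) : hermiteBasis n = hermiteLp n := by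
  simp [hermiteBasis]

theorem hasSum_norm_inner_hermiteLp (f : L2Line) :
    HasSum (fun n => ‖inner ℂ (hermiteLp n) f‖ ^ 2) (‖f‖ ^ 2) := by
  have h := hermiteBasis.hasSum_inner_mul_inner f f
  have h2 := Complex.hasSum_re h
  rw [inner_self_eq_norm_sq_to_K] at h2
  convert h2 using 1
  · ext n
    rw [hermiteBasis_apply, ← inner_conj_symm f, mul_comm, Complex.mul_conj, Complex.normSq_eq_norm_sq]
    norm_cast
  · norm_cast

end Hermite

/-! ## Sobolev functions on the line, with a possible jump at the origin -/

section Primitive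

theorem absolutelyContinuous_const (c : ℂ) (r s : ℝ) :
    AbsolutelyContinuousOnInterval (fun _ : ℝ => c) r s :=
  (contDiff_const.contDiffOn (𝕜 := ℝ) (n := 1)).absolutelyContinuousOnInterval

theorem intervalIntegrable_of_locallyIntegrable {f : ℝ → ℂ} (hf : LocallyIntegrable f) (r s : ℝ) :
    IntervalIntegrable f volume r s :=
  (hf.integrableOn_isCompact isCompact_uIcc).intervalIntegrable

/-- The statement for real primitives is applied to the real and imaginary parts. -/
theorem absolutelyContinuous_primitive {f : ℝ → ℂ} (hf : LocallyIntegrable f) {r s : ℝ}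
    (h0 : (0 : ℝ) ∈ uIcc r s) (a : ℂ) :
    AbsolutelyContinuousOnInterval (fun x => a + ∫ t in (0 : ℝ)..x, f t) r s := by
  have hi : ∀ x y, IntervalIntegrable f volume x y := intervalIntegrable_of_locallyIntegrable hf
  have h1 : IntervalIntegrable (fun t => (f t).re) volume r s :=
    ⟨(hi r s).1.re, (hi r s).2.re⟩
  have h2 : IntervalIntegrable (fun t => (f t).im) volume r s :=
    ⟨(hi r s).1.im, (hi r s).2.im⟩
  have h3 := ((h1.absolutelyContinuousOnInterval_intervalIntegral h0).smul
    (absolutelyContinuous_const 1 r s)).add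
    ((h2.absolutelyContinuousOnInterval_intervalIntegral h0).smul
    (absolutelyContinuous_const Complex.I r s))
  have h4 := (absolutelyContinuous_const a r s).add h3
  refine (congrArg (fun g => AbsolutelyContinuousOnInterval g r s) ?_).mp h4
  ext x
  simp only [Pi.add_apply, Pi.smul_apply', Complex.real_smul, mul_one]
  congr 1
  have h5 := Complex.reCLM.intervalIntegral_comp_comm (hi 0 x)
  have h6 := Complex.imCLM.intervalIntegral_comp_comm (hi 0 x)
  simp only [Complex.reCLM_apply, Complex.imCLM_apply] at h5 h6
  rw [h5, h6]
  exact Complex.re_add_im _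

theorem continuous_primitive {f : ℝ → ℂ} (hf : LocallyIntegrable f) (a : ℂ) :
    Continuous (fun x => a + ∫ t in (0 : ℝ)..x, f t) :=
  continuous_const.add (intervalIntegral.continuous_primitive (intervalIntegrable_of_locallyIntegrable hf) 0)

theorem locallyIntegrable_mul_continuous {f g : ℝ → ℂ} (hf : LocallyIntegrable f)
    (hg : Continuous g) : LocallyIntegrable fun x => f x * g x := by
  have h := (locallyIntegrableOn_univ.mpr hf).mul_continuousOn hg.continuousOn isOpen_univ.isLocallyClosed
  exact locallyIntegrableOn_univ.mp h

/-- The product of the primitives minus the primitive of fG + gF is absolutely continuous with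
derivative zero almost everywhere, hence constant. -/
theorem integral_primitive_mul {f g : ℝ → ℂ} (hf : LocallyIntegrable f) (hg : LocallyIntegrable g)
    (a b : ℂ) (s : ℝ) :
    ∫ x in (0 : ℝ)..s, (f x * (b + ∫ t in (0 : ℝ)..x, g t) + g x * (a + ∫ t in (0 : ℝ)..x, f t)) =
      (a + ∫ t in (0 : ℝ)..s, f t) * (b + ∫ t in (0 : ℝ)..s, g t) - a * b := by
  set F : ℝ → ℂ := fun x => a + ∫ t in (0 : ℝ)..x, f t with hF
  set G : ℝ → ℂ := fun x => b + ∫ t in (0 : ℝ)..x, g t with hG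
  have hk : LocallyIntegrable fun x => f x * G x + g x * F x :=
    (locallyIntegrable_mul_continuous hf (continuous_primitive hg b)).add
      (locallyIntegrable_mul_continuous hg (continuous_primitive hf a))
  have h0 : (0 : ℝ) ∈ uIcc (-|s|) |s| := by
    rw [uIcc_of_le (by linarith [abs_nonneg s])]
    exact ⟨by linarith [abs_nonneg s], abs_nonneg s⟩
  have hs : s ∈ uIcc (-|s|) |s| := by
    rw [uIcc_of_le (by linarith [abs_nonneg s])]
    exact ⟨neg_abs_le s, le_abs_self s⟩
  have hac := ((absolutelyContinuous_primitive hf h0 a).smul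
    (absolutelyContinuous_primitive hg h0 b)).sub (absolutelyContinuous_primitive hk h0 0)
  obtain ⟨C, hC⟩ := hac.const_of_ae_hasDerivAt_zero (by
    filter_upwards [LocallyIntegrable.ae_hasDerivAt_integral hf,
      LocallyIntegrable.ae_hasDerivAt_integral hg, LocallyIntegrable.ae_hasDerivAt_integral hk] with x h1 h2 h3 _
    refine ((((h1 0).const_add a).mul ((h2 0).const_add b)).sub
      ((h3 0).const_add 0)).congr_deriv ?_
    ring)
  have e := (hC s hs).trans (hC 0 h0).symm
  simp only [Pi.sub_apply, smul_eq_mul, Pi.mul_apply, intervalIntegral.integral_same, add_zero,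
    zero_add, sub_zero] at e
  rw [sub_eq_iff_eq_add] at e
  rw [e]
  ring

end Primitive

/-! ### Integration by parts across a possible jump at the origin -/

section HalfLine

/-- `v` is the derivative of `u` off the origin, and `a`, `b` are the values of `u` at `0+`, `0-`. -/
def HalfDeriv (u v : ℝ → ℂ) (a b : ℂ) : Prop :=
  (∀ᵐ x : ℝ, 0 < x → u x = a + ∫ t in (0 : ℝ)..x, v t) ∧
    ∀ᵐ x : ℝ, x < 0 → u x = b + ∫ t in (0 : ℝ)..x, v t

theorem memLp_locallyIntegrable {f : ℝ → ℂ} (hf : MemLp f 2) : LocallyIntegrable f :=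
  hf.locallyIntegrable (by norm_num)

/-- By the product rule the product of the two functions has a limit at infinity. As it is
integrable that limit is 0, so only the boundary term at 0+ remains. -/
theorem integral_Ioi_deriv_mul {f f' g g' : ℝ → ℂ} {a b : ℂ} (hf : MemLp f 2) (hf' : MemLp f' 2)
    (hg : MemLp g 2) (hg' : MemLp g' 2)
    (h1 : ∀ᵐ x : ℝ, 0 < x → f x = a + ∫ t in (0 : ℝ)..x, f' t)
    (h2 : ∀ᵐ x : ℝ, 0 < x → g x = b + ∫ t in (0 : ℝ)..x, g' t) :
    ∫ x in Ioi (0 : ℝ), (f' x * g x + g' x * f x) = -(a * b) := by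
  have lf := memLp_locallyIntegrable hf'
  have lg := memLp_locallyIntegrable hg'
  have i1 : Integrable (fun x => f' x * g x + g' x * f x) :=
    (hf'.integrable_mul hg).add (hg'.integrable_mul hf)
  have h1' := (ae_restrict_iff' (measurableSet_Ioi (a := (0 : ℝ)))).mpr h1
  have h2' := (ae_restrict_iff' (measurableSet_Ioi (a := (0 : ℝ)))).mpr h2
  have e1 : (fun x => f' x * g x + g' x * f x) =ᵐ[volume.restrict (Ioi (0 : ℝ))]
      fun x => f' x * (b + ∫ t in (0 : ℝ)..x, g' t) + g' x * (a + ∫ t in (0 : ℝ)..x, f' t) := by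
    filter_upwards [h1', h2'] with x hx hx'
    rw [hx, hx']
  have i2 : IntegrableOn (fun x => (a + ∫ t in (0 : ℝ)..x, f' t) *
      (b + ∫ t in (0 : ℝ)..x, g' t)) (Ioi 0) := by
    refine (hf.integrable_mul hg).integrableOn.congr ?_
    filter_upwards [h1', h2'] with x hx hx'
    rw [Pi.mul_apply, hx, hx']
  rw [integral_congr_ae e1]
  have i3 := (integrable_congr e1).mp i1.integrableOn
  have t1 := intervalIntegral_tendsto_integral_Ioi 0 i3 tendsto_id
  simp only [id, integral_primitive_mul lf lg] at t1
  have t2 := t1.add_const (a * b)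
  simp only [sub_add_cancel] at t2
  have hz := IntegrableAtFilter.eq_zero_of_tendsto (μ := volume)
    ⟨Ioi 0, Ioi_mem_atTop 0, i2⟩ (fun s hs => by
      obtain ⟨r, hr⟩ := mem_atTop_sets.mp hs
      refine top_unique (le_trans ?_ (measure_mono (fun x hx => hr x hx : Ici r ⊆ s)))
      simp) t2
  linear_combination hz

/-- Reflection reduces the negative half-line to the positive one. -/
theorem reflect_halfDeriv {f f' : ℝ → ℂ} {b : ℂ}
    (h : ∀ᵐ x : ℝ, x < 0 → f x = b + ∫ t in (0 : ℝ)..x, f' t) :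
    ∀ᵐ x : ℝ, 0 < x → f (-x) = b + ∫ t in (0 : ℝ)..x, -f' (-t) := by
  have hq := (Measure.measurePreserving_neg (volume : Measure ℝ)).quasiMeasurePreserving.ae h
  filter_upwards [hq] with x hx hx0
  rw [hx (by simpa using hx0), intervalIntegral.integral_neg, intervalIntegral.integral_comp_neg,
    neg_zero, ← intervalIntegral.integral_symm]

theorem memLp_comp_neg {f : ℝ → ℂ} (hf : MemLp f 2) : MemLp (fun x => f (-x)) 2 :=
  hf.comp_measurePreserving (Measure.measurePreserving_neg volume)

/-- Integration by parts for functions that may jump at the origin. -/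
theorem HalfDeriv.integral_mul {f f' g g' : ℝ → ℂ} {a b a' b' : ℂ} (hf : MemLp f 2)
    (hf' : MemLp f' 2) (hg : MemLp g 2) (hg' : MemLp g' 2) (h : HalfDeriv f f' a b)
    (h' : HalfDeriv g g' a' b') :
    ∫ x, (f' x * g x + g' x * f x) = b * b' - a * a' := by
  have i1 : Integrable (fun x => f' x * g x + g' x * f x) :=
    (hf'.integrable_mul hg).add (hg'.integrable_mul hf)
  rw [← intervalIntegral.integral_Iic_add_Ioi (b := 0) i1.integrableOn i1.integrableOn,
    integral_Ioi_deriv_mul hf hf' hg hg' h.1 h'.1]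
  have h3 := integral_Ioi_deriv_mul (memLp_comp_neg hf) (memLp_comp_neg hf').neg
    (memLp_comp_neg hg) (memLp_comp_neg hg').neg (reflect_halfDeriv h.2) (reflect_halfDeriv h'.2)
  have h4 := integral_comp_neg_Ioi (0 : ℝ) (fun x => f' x * g x + g' x * f x)
  rw [neg_zero] at h4
  rw [← h4]
  have h5 : ∀ x : ℝ, f' (-x) * g (-x) + g' (-x) * f (-x) = -((-fun x => f' (-x)) x * g (-x) +
      (-fun x => g' (-x)) x * f (-x)) := by
    intro x
    simp only [Pi.neg_apply]
    ring
  simp only [h5]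
  rw [integral_neg, h3]
  ring

theorem HalfDeriv.conj {f f' : ℝ → ℂ} {a b : ℂ} (h : HalfDeriv f f' a b) :
    HalfDeriv (fun x => starRingEnd ℂ (f x)) (fun x => starRingEnd ℂ (f' x)) (starRingEnd ℂ a)
      (starRingEnd ℂ b) := by
  refine ⟨?_, ?_⟩
  · filter_upwards [h.1] with x hx h0
    rw [hx h0, map_add, intervalIntegral.intervalIntegral_eq_integral_uIoc,
      intervalIntegral.intervalIntegral_eq_integral_uIoc, integral_conj]
    simp [h0.le]
  · filter_upwards [h.2] with x hx h0
    rw [hx h0, map_add, intervalIntegral.intervalIntegral_eq_integral_uIoc,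
      intervalIntegral.intervalIntegral_eq_integral_uIoc, integral_conj]
    simp [not_le.mpr h0]

theorem HalfDeriv.add {f f' g g' : ℝ → ℂ} {a b a' b' : ℂ} (hf' : MemLp f' 2) (hg' : MemLp g' 2)
    (h : HalfDeriv f f' a b) (h' : HalfDeriv g g' a' b') :
    HalfDeriv (f + g) (f' + g') (a + a') (b + b') := by
  have e : ∀ x : ℝ, ∫ t in (0 : ℝ)..x, (f' + g') t =
      (∫ t in (0 : ℝ)..x, f' t) + ∫ t in (0 : ℝ)..x, g' t := fun x =>
    intervalIntegral.integral_add (intervalIntegrable_of_locallyIntegrable (memLp_locallyIntegrable hf') _ _)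
      (intervalIntegrable_of_locallyIntegrable (memLp_locallyIntegrable hg') _ _)
  refine ⟨?_, ?_⟩
  · filter_upwards [h.1, h'.1] with x hx hx' h0
    rw [Pi.add_apply, hx h0, hx' h0, e]
    ring
  · filter_upwards [h.2, h'.2] with x hx hx' h0
    rw [Pi.add_apply, hx h0, hx' h0, e]
    ring

theorem HalfDeriv.const_mul {f f' : ℝ → ℂ} {a b : ℂ} (c : ℂ) (h : HalfDeriv f f' a b) :
    HalfDeriv (c • f) (c • f') (c * a) (c * b) := by
  have e : ∀ x : ℝ, ∫ t in (0 : ℝ)..x, (c • f') t = c * ∫ t in (0 : ℝ)..x, f' t := fun x =>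
    intervalIntegral.integral_smul c f'
  refine ⟨?_, ?_⟩
  · filter_upwards [h.1] with x hx h0
    rw [Pi.smul_apply, hx h0, e, smul_eq_mul]
    ring
  · filter_upwards [h.2] with x hx h0
    rw [Pi.smul_apply, hx h0, e, smul_eq_mul]
    ring

theorem HalfDeriv.congr {f f' g g' : ℝ → ℂ} {a b : ℂ} (h : HalfDeriv f f' a b)
    (e : f =ᵐ[volume] g) (e' : f' =ᵐ[volume] g') : HalfDeriv g g' a b := by
  have e2 : ∀ x : ℝ, ∫ t in (0 : ℝ)..x, f' t = ∫ t in (0 : ℝ)..x, g' t := fun x =>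
    intervalIntegral.integral_congr_ae (by filter_upwards [e'] with y hy _ using hy)
  refine ⟨?_, ?_⟩
  · filter_upwards [h.1, e] with x hx hx' h0
    rw [← hx', hx h0, e2]
  · filter_upwards [h.2, e] with x hx hx' h0
    rw [← hx', hx h0, e2]

/-- Multiplication by the sign function flips the value at `0-`. -/
theorem HalfDeriv.sign_mul {f f' : ℝ → ℂ} {a b : ℂ} (h : HalfDeriv f f' a b) :
    HalfDeriv (fun x => (SignType.sign x : ℂ) * f x) (fun x => (SignType.sign x : ℂ) * f' x)
      a (-b) := by
  refine ⟨?_, ?_⟩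
  · filter_upwards [h.1] with x hx h0
    rw [sign_pos h0]
    have : ∫ t in (0 : ℝ)..x, ((SignType.sign t : ℂ)) * f' t = ∫ t in (0 : ℝ)..x, f' t := by
      refine intervalIntegral.integral_congr_ae (Eventually.of_forall fun t ht => ?_)
      rw [uIoc_of_le h0.le] at ht
      rw [sign_pos ht.1]
      simp
    rw [this, hx h0]
    simp
  · filter_upwards [h.2] with x hx h0
    rw [sign_neg h0]
    have : ∫ t in (0 : ℝ)..x, ((SignType.sign t : ℂ)) * f' t = ∫ t in (0 : ℝ)..x, -f' t := by
      refine intervalIntegral.integral_congr_ae ?_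
      have hne : ∀ᵐ t : ℝ, t ≠ 0 := by simp [ae_iff]
      filter_upwards [hne] with t ht0 ht
      rw [uIoc_of_ge h0.le] at ht
      rw [sign_neg (lt_of_le_of_ne ht.2 ht0)]
      simp
    rw [this, hx h0, intervalIntegral.integral_neg]
    simp
    ring

end HalfLine

/-! ### Weak derivatives on the line as derivatives of primitives -/

section WeakLine

/-- `v` is the weak derivative of `u` on the open set `O` of the line. -/
def HasWeakDerivLine (O : Set ℝ) (u v : ℝ → ℂ) : Prop :=
  ∀ θ : ℝ → ℝ, ContDiff ℝ ∞ θ → HasCompactSupport θ → tsupport θ ⊆ O →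
    ∫ x, deriv θ x • u x = -∫ x, θ x • v x

theorem continuous_deriv_test {θ : ℝ → ℝ} (h : ContDiff ℝ ∞ θ) : Continuous (deriv θ) :=
  h.continuous_deriv (by simp)

theorem hasDerivAt_test {θ : ℝ → ℝ} (h : ContDiff ℝ ∞ θ) (x : ℝ) : HasDerivAt θ (deriv θ x) x :=
  ((h.differentiable (by simp)) x).hasDerivAt

theorem integrable_test_smul_line {f : ℝ → ℂ} (hf : LocallyIntegrable f) {θ : ℝ → ℝ}
    (hθ : Continuous θ) (hc : HasCompactSupport θ) : Integrable (fun x => θ x • f x) :=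
  hf.integrable_smul_left_of_hasCompactSupport hθ hc

theorem test_eq_primitive {θ : ℝ → ℝ} (h : ContDiff ℝ ∞ θ) (x : ℝ) :
    (θ 0 : ℂ) + ∫ t in (0 : ℝ)..x, ((deriv θ t : ℝ) : ℂ) = θ x := by
  rw [intervalIntegral.integral_ofReal, intervalIntegral.integral_deriv_eq_sub
    (fun t _ => (hasDerivAt_test h t).differentiableAt)
    ((continuous_deriv_test h).intervalIntegrable _ _)]
  push_cast
  ring

/-- The product rule for primitives is integrated over [-R, R], outside which the test function
vanishes. -/
theorem integral_deriv_smul_primitive {v : ℝ → ℂ} (hv : LocallyIntegrable v) {θ : ℝ → ℝ}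
    (h : ContDiff ℝ ∞ θ) (hc : HasCompactSupport θ) :
    ∫ x, deriv θ x • (∫ t in (0 : ℝ)..x, v t) = -∫ x, θ x • v x := by
  have hP : Continuous fun x => ∫ t in (0 : ℝ)..x, v t := by
    have := continuous_primitive hv 0
    simpa using this
  have i1 := integrable_test_smul_line (hP.locallyIntegrable (μ := volume))
    (continuous_deriv_test h) hc.deriv
  have i2 := integrable_test_smul_line hv h.continuous hc
  rw [← add_eq_zero_iff_eq_neg, ← integral_add i1 i2]
  obtain ⟨R, hR⟩ := hc.isCompact.isBounded.subset_ball 0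
  have hout : ∀ x : ℝ, R ≤ |x| → θ x = 0 := by
    intro x hx
    by_contra hne
    have := hR (subset_tsupport θ hne)
    rw [mem_ball_zero_iff, Real.norm_eq_abs] at this
    linarith
  have hout' : ∀ x : ℝ, R ≤ |x| → deriv θ x = 0 := by
    intro x hx
    by_contra hne
    have := hR (support_deriv_subset hne)
    rw [mem_ball_zero_iff, Real.norm_eq_abs] at this
    linarith
  have e := intervalIntegral.integral_eq_integral_of_support_subset (μ := volume)
    (f := fun x => deriv θ x • (∫ t in (0 : ℝ)..x, v t) + θ x • v x) (a := -R) (b := R) (by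
      intro x hx
      by_contra hne
      refine hx ?_
      have hx' : R ≤ |x| := by
        rw [mem_Ioc, not_and_or, not_lt, not_le] at hne
        rcases hne with h1 | h1
        · exact le_abs.mpr (Or.inr (by linarith))
        · exact le_abs.mpr (Or.inl h1.le)
      simp [hout x hx', hout' x hx'])
  rw [← e]
  have hd : LocallyIntegrable (fun x => ((deriv θ x : ℝ) : ℂ)) :=
    (Complex.continuous_ofReal.comp (continuous_deriv_test h)).locallyIntegrable (μ := volume)
  have key : ∀ s : ℝ, R ≤ |s| →
      ∫ x in (0 : ℝ)..s, (deriv θ x • (∫ t in (0 : ℝ)..x, v t) + θ x • v x) = 0 := by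
    intro s hs
    have := integral_primitive_mul hd hv (θ 0) 0 s
    simp only [test_eq_primitive h, zero_add, hout s hs] at this
    simp only [Complex.real_smul]
    rw [← sub_zero (∫ x in (0 : ℝ)..s, _)]
    rw [Complex.ofReal_zero, zero_mul, mul_zero, sub_zero] at this
    rw [sub_zero, ← this]
    refine intervalIntegral.integral_congr fun x _ => ?_
    ring
  have i3 : ∀ r s, IntervalIntegrable (fun x => deriv θ x • (∫ t in (0 : ℝ)..x, v t) + θ x • v x)
    volume r s := fun r s => (i1.add i2).intervalIntegrable
  rw [← intervalIntegral.integral_add_adjacent_intervals (i3 (-R) 0) (i3 0 R),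
    intervalIntegral.integral_symm, key R (le_abs_self R),
    key (-R) (by rw [abs_neg]; exact le_abs_self R)]
  simp

/-- A primitive started to the left of the support vanishes to the right of it because the mean is
zero. Order-connectedness of O keeps the hull of the support inside O. -/
theorem exists_test_primitive {O : Set ℝ} (hO : O.OrdConnected) {ψ : ℝ → ℝ} (h : ContDiff ℝ ∞ ψ)
    (hc : HasCompactSupport ψ) (hs : tsupport ψ ⊆ O) (h0 : ∫ x, ψ x = 0) :
    ∃ θ : ℝ → ℝ, ContDiff ℝ ∞ θ ∧ HasCompactSupport θ ∧ tsupport θ ⊆ O ∧ deriv θ = ψ := by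
  rcases (tsupport ψ).eq_empty_or_nonempty with he | hne
  · have : ψ = 0 := tsupport_eq_empty_iff.mp he
    subst this
    refine ⟨0, contDiff_const, HasCompactSupport.zero, ?_, ?_⟩
    · rw [he]
      exact empty_subset _
    · ext x
      exact deriv_const x 0
  set p := sInf (tsupport ψ)
  set q := sSup (tsupport ψ)
  have hp : p ∈ tsupport ψ := hc.isCompact.sInf_mem hne
  have hq : q ∈ tsupport ψ := hc.isCompact.sSup_mem hne
  have hK : tsupport ψ ⊆ Icc p q := fun x hx =>
    ⟨csInf_le hc.isCompact.bddBelow hx, le_csSup hc.isCompact.bddAbove hx⟩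
  have hout : ∀ x, x ∉ Icc p q → ψ x = 0 := fun x hx =>
    image_eq_zero_of_notMem_tsupport fun h => hx (hK h)
  have hcont := h.continuous
  let θ : ℝ → ℝ := fun x => ∫ t in (p - 1)..x, ψ t
  have hd : ∀ x, HasDerivAt θ (ψ x) x := fun x =>
    intervalIntegral.integral_hasDerivAt_right (hcont.intervalIntegrable _ _)
      hcont.stronglyMeasurable.stronglyMeasurableAtFilter hcont.continuousAt
  have hd' : deriv θ = ψ := funext fun x => (hd x).deriv
  have hsup : Function.support θ ⊆ Icc p q := by
    intro x hx
    by_contra hne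
    refine hx ?_
    rw [mem_Icc, not_and_or, not_le, not_le] at hne
    rcases hne with h1 | h1
    · refine intervalIntegral.integral_zero_ae (Eventually.of_forall fun t ht => ?_)
      refine hout t fun ht' => ?_
      have h2 := ht.2
      have : max (p - 1) x < p := max_lt (by linarith) h1
      linarith [ht'.1]
    · simp only [θ]
      rw [← h0]
      refine intervalIntegral.integral_eq_integral_of_support_subset fun t ht => ?_
      have := hK (subset_tsupport ψ ht)
      exact ⟨by linarith [this.1], by linarith [this.2]⟩
  have hts : tsupport θ ⊆ Icc p q := closure_minimal hsup isClosed_Icc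
  refine ⟨θ, ?_, ?_, hts.trans (hO.out (hs hp) (hs hq)), hd'⟩
  · rw [contDiff_infty_iff_deriv, hd']
    exact ⟨fun x => (hd x).differentiableAt, h⟩
  · exact isCompact_Icc.of_isClosed_subset (isClosed_tsupport θ) hts

/-- The lemma of du Bois-Reymond. -/
theorem ae_const_of_weakDeriv_zero {O : Set ℝ} (ho : IsOpen O) (hO : O.OrdConnected)
    (hne : O.Nonempty) {w : ℝ → ℂ} (hw : LocallyIntegrable w)
    (h : ∀ θ : ℝ → ℝ, ContDiff ℝ ∞ θ → HasCompactSupport θ → tsupport θ ⊆ O →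
      ∫ x, deriv θ x • w x = 0) : ∃ c : ℂ, ∀ᵐ x, x ∈ O → w x = c := by
  obtain ⟨x₀, hx₀⟩ := hne
  obtain ⟨ρ₀, hρs, hρc, hρ, hρr, hρ1⟩ :=
    exists_contDiff_tsupport_subset (n := ⊤) (ho.mem_nhds hx₀)
  have hρ : ContDiff ℝ ∞ ρ₀ := hρ
  have hpos : 0 < ∫ x, ρ₀ x := hρ.continuous.integral_pos_of_hasCompactSupport_nonneg_nonzero hρc
    (fun x => (hρr ⟨x, rfl⟩).1) (by rw [hρ1]; exact one_ne_zero)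
  set I := ∫ x, ρ₀ x
  refine ⟨(I⁻¹ : ℝ) • ∫ x, ρ₀ x • w x, ?_⟩
  set c := (I⁻¹ : ℝ) • ∫ x, ρ₀ x • w x with hcdef
  have hwc : LocallyIntegrable fun x => w x - c := hw.sub (locallyIntegrable_const c)
  have key : ∀ ψ : ℝ → ℝ, ContDiff ℝ ∞ ψ → HasCompactSupport ψ → tsupport ψ ⊆ O →
      ∫ x, ψ x • (w x - c) = 0 := by
    intro ψ h1 h2 h3
    have iψ := integrable_test_smul_line hw h1.continuous h2
    have iρ := integrable_test_smul_line hw hρ.continuous hρc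
    have jψ : Integrable ψ := h1.continuous.integrable_of_hasCompactSupport h2
    have jρ : Integrable ρ₀ := hρ.continuous.integrable_of_hasCompactSupport hρc
    set J := ∫ x, ψ x
    -- Subtracting the right multiple of a fixed bump makes ψ mean-free, hence a derivative of a
    -- test function in O.
    obtain ⟨θ, t1, t2, t3, t4⟩ := exists_test_primitive hO (ψ := fun x => ψ x - (J * I⁻¹) * ρ₀ x)
      (h1.sub (contDiff_const.mul hρ)) (h2.sub hρc.mul_left)
      ((tsupport_sub ψ _).trans (union_subset h3 ((closure_mono (by
        intro x hx h0
        simp [h0] at hx)).trans hρs))) (by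
        rw [integral_sub jψ (jρ.const_mul _), integral_const_mul]
        change J - J * I⁻¹ * I = 0
        field_simp
        ring)
    have h4 := h θ t1 t2 t3
    rw [t4] at h4
    have h5 : ∫ x, (ψ x - J * I⁻¹ * ρ₀ x) • w x = (∫ x, ψ x • w x) - J • c := by
      have iρ' : Integrable (fun x => (J * I⁻¹) • ρ₀ x • w x) := iρ.smul (J * I⁻¹)
      rw [hcdef, smul_smul, ← integral_smul, ← integral_sub iψ iρ']
      refine integral_congr_ae (Eventually.of_forall fun x => ?_)
      simp only [sub_smul, mul_smul]
    rw [h5] at h4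
    have h6 : ∫ x, ψ x • (w x - c) = (∫ x, ψ x • w x) - J • c := by
      rw [← integral_smul_const, ← integral_sub iψ (jψ.smul_const c)]
      simp only [smul_sub]
    rw [h6, h4]
  have h7 := ho.ae_eq_zero_of_integral_contDiff_smul_eq_zero (hwc.locallyIntegrableOn O) key
  filter_upwards [h7] with x hx hxO
  exact sub_eq_zero.mp (hx hxO)

theorem HasWeakDerivLine.exists_primitive {O : Set ℝ} (ho : IsOpen O) (hO : O.OrdConnected)
    (hne : O.Nonempty) {u v : ℝ → ℂ} (hu : LocallyIntegrable u) (hv : LocallyIntegrable v)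
    (h : HasWeakDerivLine O u v) : ∃ a : ℂ, ∀ᵐ x, x ∈ O → u x = a + ∫ t in (0 : ℝ)..x, v t := by
  have hP : Continuous fun x => ∫ t in (0 : ℝ)..x, v t := by
    have := continuous_primitive hv 0
    simpa using this
  obtain ⟨a, ha⟩ := ae_const_of_weakDeriv_zero ho hO hne (hu.sub hP.locallyIntegrable)
    (fun θ h1 h2 h3 => by
      have i1 := integrable_test_smul_line hu (continuous_deriv_test h1) h2.deriv
      have i2 := integrable_test_smul_line (hP.locallyIntegrable (μ := volume))
        (continuous_deriv_test h1) h2.deriv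
      have h4 : ∫ x, deriv θ x • (u - fun x => ∫ t in (0 : ℝ)..x, v t) x =
          (∫ x, deriv θ x • u x) - ∫ x, deriv θ x • ∫ t in (0 : ℝ)..x, v t := by
        rw [← integral_sub i1 i2]
        simp only [Pi.sub_apply, smul_sub]
      rw [h4, h θ h1 h2 h3, integral_deriv_smul_primitive hv h1 h2, sub_self])
  refine ⟨a, ?_⟩
  filter_upwards [ha] with x hx hxO
  rw [← hx hxO, Pi.sub_apply, sub_add_cancel]

theorem HasWeakDerivLine.mono {O O' : Set ℝ} (hO : O' ⊆ O) {u v : ℝ → ℂ}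
    (h : HasWeakDerivLine O u v) : HasWeakDerivLine O' u v :=
  fun θ h1 h2 h3 => h θ h1 h2 (h3.trans hO)

theorem HasWeakDerivLine.exists_halfDeriv {u v : ℝ → ℂ} (hu : MemLp u 2) (hv : MemLp v 2)
    (h : HasWeakDerivLine {x | x ≠ 0} u v) : ∃ a b, HalfDeriv u v a b := by
  have lu := memLp_locallyIntegrable hu
  have lv := memLp_locallyIntegrable hv
  obtain ⟨a, ha⟩ := (h.mono (O' := Ioi 0) fun x hx => (ne_of_gt hx)).exists_primitive isOpen_Ioi
    ordConnected_Ioi ⟨1, by simp⟩ lu lv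
  obtain ⟨b, hb⟩ := (h.mono (O' := Iio 0) fun x hx => (ne_of_lt hx)).exists_primitive isOpen_Iio
    ordConnected_Iio ⟨-1, by simp⟩ lu lv
  exact ⟨a, b, ha, hb⟩

theorem HasWeakDerivLine.exists_halfDeriv_univ {u v : ℝ → ℂ} (hu : MemLp u 2) (hv : MemLp v 2)
    (h : HasWeakDerivLine univ u v) : ∃ a, HalfDeriv u v a a := by
  obtain ⟨a, ha⟩ := h.exists_primitive isOpen_univ ordConnected_univ univ_nonempty
    (memLp_locallyIntegrable hu) (memLp_locallyIntegrable hv)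
  exact ⟨a, by filter_upwards [ha] with x hx _ using hx (mem_univ x),
    by filter_upwards [ha] with x hx _ using hx (mem_univ x)⟩

theorem memLp_test {θ : ℝ → ℝ} (h : Continuous θ) (hc : HasCompactSupport θ) :
    MemLp (fun x => (θ x : ℂ)) 2 :=
  (h.memLp_of_hasCompactSupport hc).ofReal

theorem halfDeriv_test {θ : ℝ → ℝ} (h : ContDiff ℝ ∞ θ) :
    HalfDeriv (fun x => (θ x : ℂ)) (fun x => ((deriv θ x : ℝ) : ℂ)) (θ 0) (θ 0) :=
  ⟨Eventually.of_forall fun x _ => (test_eq_primitive h x).symm,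
    Eventually.of_forall fun x _ => (test_eq_primitive h x).symm⟩

end WeakLine

/-! ### The equation -w'' + ζ²w = f on the whole line -/

section Solve

/-- A test function as an element of `L²(ℝ)`. -/
noncomputable def testLp {θ : ℝ → ℝ} (h : Continuous θ) (hc : HasCompactSupport θ) : L2Line :=
  (memLp_test h hc).toLp _

theorem inner_testLp {θ : ℝ → ℝ} (h : Continuous θ) (hc : HasCompactSupport θ) (f : L2Line) :
    inner ℂ (testLp h hc) f = ∫ x, θ x • f x := by
  rw [L2.inner_def]
  refine integral_congr_ae ?_
  filter_upwards [(memLp_test h hc).coeFn_toLp] with x hx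
  rw [testLp, hx, RCLike.inner_apply, Complex.real_smul, mul_comm]
  congr 1
  exact Complex.conj_ofReal _

/-- Solvability of `-w'' + ζ² w = f` on the whole line. -/
theorem exists_solution (f : L2Line) {ζ : ℝ} (hζ : 0 < ζ) : ∃ w w' : L2Line, ∃ a d : ℂ,
    HalfDeriv w w' a a ∧ HalfDeriv w' (((ζ : ℂ) ^ 2 • w - f : L2Line) : ℝ → ℂ) d d := by
  -- Lax–Milgram by orthogonal projection: orthogonality to all (θ', ζθ) says weakly that a pair has
  -- the form (ζw, w'). Projecting (f/ζ, 0) onto the space K of such pairs yields the solution.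
  let S : Set (WithLp 2 (L2Line × L2Line)) := {p | ∃ (θ : ℝ → ℝ) (h : ContDiff ℝ ∞ θ)
    (hc : HasCompactSupport θ), p = WithLp.toLp 2
      (testLp (continuous_deriv_test h) hc.deriv, (ζ : ℂ) • testLp h.continuous hc)}
  let K : Submodule ℂ (WithLp 2 (L2Line × L2Line)) := (Submodule.span ℂ S)ᗮ
  set g : WithLp 2 (L2Line × L2Line) := WithLp.toLp 2 (((ζ : ℂ)⁻¹) • f, 0) with hg
  obtain ⟨p, hp, q, hq, hpq⟩ := K.exists_add_mem_mem_orthogonal g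
  have hp' : ∀ (θ : ℝ → ℝ) (h : ContDiff ℝ ∞ θ) (hc : HasCompactSupport θ),
      inner ℂ (testLp (continuous_deriv_test h) hc.deriv) p.fst +
        (ζ : ℂ) * inner ℂ (testLp h.continuous hc) p.snd = 0 := by
    intro θ h hc
    have := Submodule.inner_right_of_mem_orthogonal (Submodule.subset_span
      (show WithLp.toLp 2 (testLp (continuous_deriv_test h) hc.deriv,
        (ζ : ℂ) • testLp h.continuous hc) ∈ S from ⟨θ, h, hc, rfl⟩)) hp
    rw [WithLp.prod_inner_apply] at this
    change inner ℂ (testLp (continuous_deriv_test h) hc.deriv) p.fst +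
      inner ℂ ((ζ : ℂ) • testLp h.continuous hc) p.snd = 0 at this
    rwa [inner_smul_left, Complex.conj_ofReal] at this
  -- The pairs (ζθ, θ') themselves lie in K, by integration by parts of test functions.
  -- Orthogonality of the residual to them is the weak form of w'' = ζ²w - f.
  have hmem : ∀ (θ : ℝ → ℝ) (h : ContDiff ℝ ∞ θ) (hc : HasCompactSupport θ),
      WithLp.toLp 2 ((ζ : ℂ) • testLp h.continuous hc,
        testLp (continuous_deriv_test h) hc.deriv) ∈ K := by
    intro θ h hc
    rw [Submodule.mem_orthogonal]
    intro x hx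
    induction hx using Submodule.span_induction with
    | zero => simp
    | add x y _ _ h1 h2 => rw [inner_add_left, h1, h2, add_zero]
    | smul c x _ h1 => rw [inner_smul_left, h1, mul_zero]
    | mem x hx =>
      obtain ⟨η, k, kc, rfl⟩ := hx
      rw [WithLp.prod_inner_apply]
      simp only [inner_smul_left, inner_smul_right, Complex.conj_ofReal]
      rw [← mul_add, inner_testLp, inner_testLp]
      have e1 : ∫ x, deriv η x • (testLp h.continuous hc) x = ∫ x, deriv η x • (θ x : ℂ) := by
        refine integral_congr_ae ?_
        filter_upwards [(memLp_test h.continuous hc).coeFn_toLp] with x hx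
        rw [testLp, hx]
      have e2 : ∫ x, η x • (testLp (continuous_deriv_test h) hc.deriv) x =
          ∫ x, η x • ((deriv θ x : ℝ) : ℂ) := by
        refine integral_congr_ae ?_
        filter_upwards [(memLp_test (continuous_deriv_test h) hc.deriv).coeFn_toLp] with x hx
        rw [testLp, hx]
      have h3 := HalfDeriv.integral_mul (memLp_test k.continuous kc)
        (memLp_test (continuous_deriv_test k) kc.deriv) (memLp_test h.continuous hc)
        (memLp_test (continuous_deriv_test h) hc.deriv) (halfDeriv_test k) (halfDeriv_test h)
      rw [e1, e2, ← integral_add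
        (integrable_test_smul_line (memLp_locallyIntegrable (memLp_test h.continuous hc))
          (continuous_deriv_test k) kc.deriv)
        (integrable_test_smul_line (memLp_locallyIntegrable
          (memLp_test (continuous_deriv_test h) hc.deriv)) k.continuous kc)]
      rw [sub_self] at h3
      rw [← mul_zero (ζ : ℂ), ← h3]
      congr 1
      refine integral_congr_ae (Eventually.of_forall fun x => ?_)
      simp only [Complex.real_smul]
      ring
  have hζ' : (ζ : ℂ) ≠ 0 := by exact_mod_cast hζ.ne'
  have hq1 : q.fst = ((ζ : ℂ)⁻¹) • f - p.fst := by
    have := congrArg WithLp.fst hpq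
    simp only [hg, WithLp.toLp_fst, WithLp.add_fst] at this
    rw [this]
    abel
  have hq2 : q.snd = -p.snd := by
    have := congrArg WithLp.snd hpq
    simp only [hg, WithLp.toLp_snd, WithLp.add_snd] at this
    exact eq_neg_of_add_eq_zero_right this.symm
  have hq' : ∀ (θ : ℝ → ℝ) (h : ContDiff ℝ ∞ θ) (hc : HasCompactSupport θ),
      inner ℂ (testLp h.continuous hc) f - (ζ : ℂ) * inner ℂ (testLp h.continuous hc) p.fst -
        inner ℂ (testLp (continuous_deriv_test h) hc.deriv) p.snd = 0 := by
    intro θ h hc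
    have := Submodule.inner_right_of_mem_orthogonal (hmem θ h hc) hq
    rw [WithLp.prod_inner_apply] at this
    change inner ℂ ((ζ : ℂ) • testLp h.continuous hc) q.fst +
      inner ℂ (testLp (continuous_deriv_test h) hc.deriv) q.snd = 0 at this
    rw [hq1, hq2, inner_smul_left, inner_sub_right, inner_smul_right, inner_neg_right,
      Complex.conj_ofReal] at this
    field_simp at this
    linear_combination this
  have d1 : HasWeakDerivLine univ (((ζ : ℂ)⁻¹ • p.fst : L2Line) : ℝ → ℂ) p.snd := by
    intro θ h hc _
    rw [← inner_testLp (continuous_deriv_test h) hc.deriv, ← inner_testLp h.continuous hc,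
      inner_smul_right]
    have := hp' θ h hc
    field_simp
    linear_combination this
  have d2 : HasWeakDerivLine univ p.snd
      (((ζ : ℂ) ^ 2 • ((ζ : ℂ)⁻¹ • p.fst) - f : L2Line) : ℝ → ℂ) := by
    intro θ h hc _
    rw [← inner_testLp (continuous_deriv_test h) hc.deriv, ← inner_testLp h.continuous hc,
      inner_sub_right, inner_smul_right, inner_smul_right]
    have := hq' θ h hc
    field_simp
    linear_combination -this
  obtain ⟨a, ha⟩ := d1.exists_halfDeriv_univ (Lp.memLp _) (Lp.memLp _)
  obtain ⟨d, hd⟩ := d2.exists_halfDeriv_univ (Lp.memLp _) (Lp.memLp _)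
  exact ⟨_, _, a, d, ha, hd⟩

end Solve

/-! ### Green's formula, the trace inequality and Landau's inequality -/

section Green

theorem inner_self_ofReal {H : Type*} [NormedAddCommGroup H] [InnerProductSpace ℂ H] (v : H) :
    inner ℂ v v = ((‖v‖ ^ 2 : ℝ) : ℂ) := by
  rw [inner_self_eq_norm_sq_to_K]
  norm_cast

theorem HalfDeriv.congr_Lp {u v : L2Line} {f g : ℝ → ℂ} {a b : ℂ} (h : HalfDeriv f g a b)
    (e : u =ᵐ[volume] f) (e' : v =ᵐ[volume] g) : HalfDeriv u v a b :=
  h.congr e.symm e'.symm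

theorem HalfDeriv.add_Lp {u u' v v' : L2Line} {a b c d : ℂ} (h : HalfDeriv u u' a b)
    (h' : HalfDeriv v v' c d) :
    HalfDeriv (u + v : L2Line) (u' + v' : L2Line) (a + c) (b + d) :=
  (HalfDeriv.add (Lp.memLp u') (Lp.memLp v') h h').congr_Lp (Lp.coeFn_add u v)
    (Lp.coeFn_add u' v')

theorem HalfDeriv.smul_Lp {u u' : L2Line} {a b : ℂ} (c : ℂ) (h : HalfDeriv u u' a b) :
    HalfDeriv (c • u : L2Line) (c • u' : L2Line) (c * a) (c * b) :=
  (h.const_mul c).congr_Lp (Lp.coeFn_smul c u) (Lp.coeFn_smul c u')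

theorem HalfDeriv.zero_Lp : HalfDeriv (0 : L2Line) (0 : L2Line) 0 0 :=
  HalfDeriv.congr_Lp (f := 0) (g := 0)
    ⟨Eventually.of_forall fun x _ => by simp, Eventually.of_forall fun x _ => by simp⟩
    (Lp.coeFn_zero _ _ _) (Lp.coeFn_zero _ _ _)

theorem HalfDeriv.sum_Lp {ι : Type*} (s : Finset ι) {u u' : ι → L2Line} {a b : ι → ℂ}
    (h : ∀ i, HalfDeriv (u i) (u' i) (a i) (b i)) :
    HalfDeriv (∑ i ∈ s, u i : L2Line) (∑ i ∈ s, u' i : L2Line) (∑ i ∈ s, a i) (∑ i ∈ s, b i) := by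
  classical
  induction s using Finset.induction_on with
  | empty => simpa using HalfDeriv.zero_Lp
  | insert i s hi ih =>
    simp only [Finset.sum_insert hi]
    exact (h i).add_Lp ih

theorem inner_L2Line (u v : L2Line) : inner ℂ u v = ∫ x, starRingEnd ℂ (u x) * v x := by
  rw [L2.inner_def]
  refine integral_congr_ae (Eventually.of_forall fun x => ?_)
  simp only [RCLike.inner_apply, mul_comm]

/-- Green's formula. -/
theorem HalfDeriv.green {u u' v v' : L2Line} {a b c d : ℂ} (h : HalfDeriv u u' a b)
    (h' : HalfDeriv v v' c d) :
    inner ℂ u' v + inner ℂ u v' = starRingEnd ℂ b * d - starRingEnd ℂ a * c := by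
  have := HalfDeriv.integral_mul (Lp.memLp u).star (Lp.memLp u').star (Lp.memLp v)
    (Lp.memLp v') h.conj h'
  rw [← this, inner_L2Line, inner_L2Line, ← integral_add]
  · refine integral_congr_ae (Eventually.of_forall fun x => ?_)
    simp only [Pi.star_apply, RCLike.star_def]
    ring
  · exact (Lp.memLp u').star.integrable_mul (Lp.memLp v)
  · exact (Lp.memLp u).star.integrable_mul (Lp.memLp v')

theorem norm_sign_mul (x : ℝ) (hx : x ≠ 0) (z : ℂ) : ‖(SignType.sign x : ℂ) * z‖ = ‖z‖ := by
  rcases lt_or_gt_of_ne hx with h | h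
  · rw [sign_neg h]
    simp
  · rw [sign_pos h]
    simp

theorem ae_ne_zero : ∀ᵐ x : ℝ, x ≠ 0 := by simp [ae_iff]

theorem memLp_sign_mul (u : L2Line) : MemLp (fun x => (SignType.sign x : ℂ) * u x) 2 := by
  refine (Lp.memLp u).of_le ?_ ?_
  · refine AEStronglyMeasurable.mul ?_ (Lp.memLp u).1
    have : (fun x : ℝ => (SignType.sign x : ℂ)) =
        fun x => if 0 < x then 1 else if x < 0 then -1 else 0 := by
      ext x
      rw [sign_apply]
      split_ifs <;> simp
    rw [this]
    exact (Measurable.ite measurableSet_Ioi measurable_const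
      (Measurable.ite measurableSet_Iio measurable_const measurable_const)).aestronglyMeasurable
  · filter_upwards [ae_ne_zero] with x hx
    rw [norm_sign_mul x hx]

/-- Multiplication by the sign function on `L²(ℝ)`. -/
noncomputable def signMul (u : L2Line) : L2Line := (memLp_sign_mul u).toLp _

theorem coeFn_signMul (u : L2Line) : signMul u =ᵐ[volume] fun x => (SignType.sign x : ℂ) * u x :=
  MemLp.coeFn_toLp _

theorem norm_signMul (u : L2Line) : ‖signMul u‖ = ‖u‖ := by
  refine le_antisymm (Lp.norm_le_norm_of_ae_le ?_) (Lp.norm_le_norm_of_ae_le ?_)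
  all_goals
    filter_upwards [coeFn_signMul u, ae_ne_zero] with x hx h0
    rw [hx, norm_sign_mul x h0]

theorem HalfDeriv.signMul {u u' : L2Line} {a b : ℂ} (h : HalfDeriv u u' a b) :
    HalfDeriv (signMul u) (SmilanskySolomyak.signMul u') a (-b) :=
  h.sign_mul.congr_Lp (coeFn_signMul u) (coeFn_signMul u')

theorem inner_signMul_left (u v : L2Line) : inner ℂ (signMul u) v = inner ℂ u (signMul v) := by
  rw [inner_L2Line, inner_L2Line]
  refine integral_congr_ae ?_
  filter_upwards [coeFn_signMul u, coeFn_signMul v, ae_ne_zero] with x hu hv h0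
  rw [hu, hv]
  rcases lt_or_gt_of_ne h0 with h | h
  · rw [sign_neg h]
    simp
  · rw [sign_pos h]
    simp

/-- Multiplying by the sign flips the value at 0-, so Green's formula yields the sum of the boundary
terms instead of their difference. -/
theorem HalfDeriv.inner_signMul {u u' : L2Line} {a b : ℂ} (h : HalfDeriv u u' a b) :
    2 * (inner ℂ u (SmilanskySolomyak.signMul u')).re = -(‖a‖ ^ 2 + ‖b‖ ^ 2) := by
  have h1 := congrArg Complex.re (h.green h.signMul)
  have h2 : (inner ℂ u' (SmilanskySolomyak.signMul u)).re =
      (inner ℂ u (SmilanskySolomyak.signMul u')).re := by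
    rw [← inner_signMul_left, ← inner_conj_symm]
    exact Complex.conj_re _
  rw [Complex.add_re, h2, mul_neg, Complex.sub_re, Complex.neg_re, mul_comm, Complex.mul_conj,
    mul_comm, Complex.mul_conj, Complex.ofReal_re, Complex.ofReal_re, Complex.normSq_eq_norm_sq,
    Complex.normSq_eq_norm_sq] at h1
  linarith

/-- The trace inequality. -/
theorem HalfDeriv.trace_le {u u' : L2Line} {a b : ℂ} (h : HalfDeriv u u' a b) {ζ : ℝ}
    (hζ : 0 ≤ ζ) : ζ * (‖a‖ ^ 2 + ‖b‖ ^ 2) ≤ ‖u'‖ ^ 2 + ζ ^ 2 * ‖u‖ ^ 2 := by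
  have h1 := h.inner_signMul
  have h2 := (abs_le.mp ((Complex.abs_re_le_norm _).trans
    (norm_inner_le_norm u (SmilanskySolomyak.signMul u')))).1
  rw [norm_signMul] at h2
  have h3 : ‖a‖ ^ 2 + ‖b‖ ^ 2 ≤ 2 * (‖u‖ * ‖u'‖) := by linarith
  nlinarith [mul_le_mul_of_nonneg_left h3 hζ, sq_nonneg (‖u'‖ - ζ * ‖u‖)]

/-- Landau's inequality on the two half-lines. -/
theorem HalfDeriv.landau {u u' u'' : L2Line} {a b c d : ℂ} (h : HalfDeriv u u' a b)
    (h' : HalfDeriv u' u'' c d) (ζ : ℝ) :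
    ζ ^ 2 * ‖u'‖ ^ 2 ≤ ‖u''‖ ^ 2 + (ζ ^ 2 * ‖u‖) ^ 2 := by
  have key : ∀ (t : ℝ), 0 ≤ t → t ^ 2 * ‖u'‖ ^ 2 ≤ ‖u''‖ ^ 2 + (t ^ 2 * ‖u‖) ^ 2 := by
    intro t ht
    set s := SmilanskySolomyak.signMul u' with hs
    have h1 := h.inner_signMul
    have h2 := h'.inner_signMul
    rw [← inner_signMul_left, ← hs] at h2
    rw [← hs] at h1
    have h3 := congrArg Complex.re (h.green h')
    rw [inner_self_ofReal, Complex.add_re, Complex.ofReal_re] at h3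
    have hns : ‖s‖ = ‖u'‖ := norm_signMul u'
    -- A sum of squares as in the proof on a half-line: with s = sign · u' all cross terms can be
    -- evaluated by Green's formula.
    have h4 : 0 ≤ ‖((t : ℂ) ^ 2) • u + (t : ℂ) • s + u''‖ ^ 2 := sq_nonneg _
    have e1 : ‖((t : ℂ) ^ 2) • u + (t : ℂ) • s + u''‖ ^ 2 = (t ^ 2 * ‖u‖) ^ 2 + t ^ 2 * ‖u'‖ ^ 2 +
        ‖u''‖ ^ 2 + 2 * (t ^ 3 * (inner ℂ u s).re + t * (inner ℂ s u'').re +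
          t ^ 2 * (inner ℂ u u'').re) := by
      rw [@norm_add_sq ℂ, @norm_add_sq ℂ, inner_add_left, inner_smul_left, inner_smul_left,
        inner_smul_left, inner_smul_right, norm_smul, norm_smul, hns]
      simp only [map_pow, Complex.conj_ofReal, map_add, RCLike.re_to_complex]
      rw [← Complex.ofReal_pow, ← mul_assoc, ← Complex.ofReal_mul, Complex.re_ofReal_mul,
        Complex.re_ofReal_mul, Complex.re_ofReal_mul, Complex.norm_real, Complex.norm_real,
        Real.norm_of_nonneg ht, Real.norm_of_nonneg (sq_nonneg t)]
      ring
    rw [e1] at h4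
    have e2 : (starRingEnd ℂ b * d - starRingEnd ℂ a * c).re =
        b.re * d.re + b.im * d.im - a.re * c.re - a.im * c.im := by
      simp
      ring
    rw [e2] at h3
    have e3 : ∀ z : ℂ, ‖z‖ ^ 2 = z.re ^ 2 + z.im ^ 2 := fun z => by
      rw [← Complex.normSq_eq_norm_sq, Complex.normSq_apply]
      ring
    have h3'' : ‖u'‖ ^ 2 + (inner ℂ u u'').re =
      b.re * d.re + b.im * d.im - a.re * c.re - a.im * c.im := by
      rw [← h3]
    rw [e3 a, e3 b] at h1
    rw [e3 c, e3 d] at h2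
    have h5 : (inner ℂ u u'').re =
      b.re * d.re + b.im * d.im - a.re * c.re - a.im * c.im - ‖u'‖ ^ 2 := by linarith
    have h6 : (inner ℂ u s).re = -(a.re ^ 2 + a.im ^ 2 + (b.re ^ 2 + b.im ^ 2)) / 2 := by linarith
    have h7 : (inner ℂ s u'').re = -(c.re ^ 2 + c.im ^ 2 + (d.re ^ 2 + d.im ^ 2)) / 2 := by linarith
    rw [h5, h6, h7] at h4
    -- The boundary terms collect into -t(|ta + c|² + |tb - d|²), which has the favourable sign and
    -- is dropped.
    have h8 : 0 ≤ t * ((t * a.re + c.re) ^ 2 + (t * a.im + c.im) ^ 2 + (t * b.re - d.re) ^ 2 +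
      (t * b.im - d.im) ^ 2) := by positivity
    linarith
  have := key |ζ| (abs_nonneg ζ)
  rwa [sq_abs] at this

end Green

/-! ### A priori bounds for the solution on the line -/

section SolveBounds

/-- Pairing the equation with w gives ‖w'‖² + ζ²‖w‖² = Re ⟪w, f⟫; the three bounds follow by
Cauchy–Schwarz. -/
theorem norm_solution_le {w w' f : L2Line} {a d : ℂ} {ζ : ℝ} (hζ : 0 < ζ)
    (h : HalfDeriv w w' a a) (h' : HalfDeriv w' (((ζ : ℂ) ^ 2 • w - f : L2Line) : ℝ → ℂ) d d) :
    ζ ^ 2 * ‖w‖ ≤ ‖f‖ ∧ ζ * ‖w'‖ ≤ ‖f‖ ∧ ‖(ζ : ℂ) ^ 2 • w - f‖ ≤ 2 * ‖f‖ := by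
  have h1 := congrArg Complex.re (h.green h')
  rw [sub_self, inner_self_ofReal, inner_sub_right, inner_smul_right,
    inner_self_ofReal] at h1
  have h2 : ‖w'‖ ^ 2 + ζ ^ 2 * ‖w‖ ^ 2 - (inner ℂ w f).re = 0 := by
    rw [← Complex.zero_re, ← h1, Complex.add_re, Complex.sub_re, ← add_sub_assoc,
      ← Complex.ofReal_pow, ← Complex.ofReal_mul, Complex.ofReal_re, Complex.ofReal_re]
  have h3 : (inner ℂ w f).re ≤ ‖w‖ * ‖f‖ :=
    (Complex.re_le_norm _).trans (norm_inner_le_norm w f)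
  have e1 : ζ ^ 2 * ‖w‖ ≤ ‖f‖ := by
    rcases (norm_nonneg w).eq_or_lt with h0 | h0
    · rw [← h0, mul_zero]
      exact norm_nonneg f
    · refine le_of_mul_le_mul_left ?_ h0
      nlinarith [sq_nonneg ‖w'‖]
  refine ⟨e1, ?_, ?_⟩
  · refine le_of_sq_le_sq ?_ (norm_nonneg f)
    nlinarith [norm_nonneg f, mul_le_mul_of_nonneg_right e1 (norm_nonneg f), sq_nonneg ‖w‖,
      sq_nonneg (ζ * ‖w‖), mul_nonneg (sq_nonneg ζ) (sq_nonneg (ζ * ‖w‖)),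
      mul_le_mul_of_nonneg_left (show ‖w'‖ ^ 2 + ζ ^ 2 * ‖w‖ ^ 2 ≤ ‖w‖ * ‖f‖ by linarith)
        (sq_nonneg ζ)]
  · refine (norm_sub_le _ _).trans ?_
    rw [norm_smul, norm_pow, Complex.norm_real, Real.norm_of_nonneg hζ.le]
    linarith

end SolveBounds

/-! ### Piecewise exponentials times linear functions -/

section ExpFun

/-- A piecewise exponential-linear function on the line. -/
noncomputable def expFun (k : ℝ) (p q p' q' : ℂ) (x : ℝ) : ℂ :=
  if 0 < x then ((Real.exp (-k * |x|) : ℝ) : ℂ) * (p + q * x)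
  else ((Real.exp (-k * |x|) : ℝ) : ℂ) * (p' + q' * x)

theorem memLp_exp_neg_mul_abs {k : ℝ} (hk : 0 < k) :
    MemLp (fun x : ℝ => Real.exp (-k * |x|)) 2 := by
  rw [memLp_two_iff_integrable_sq (by fun_prop)]
  have e : (fun x : ℝ => Real.exp (-k * |x|) ^ 2) = fun x => Real.exp (-(2 * k) * |x|) := by
    ext x
    rw [← Real.exp_nat_mul]
    congr 1
    push_cast
    ring
  rw [e, ← integrableOn_univ, ← Iic_union_Ioi (a := (0 : ℝ))]
  refine IntegrableOn.union ?_ ?_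
  · refine (integrableOn_exp_mul_Iic (a := 2 * k) (by linarith) 0).congr_fun (fun x hx => ?_)
      measurableSet_Iic
    simp only
    rw [abs_of_nonpos hx, neg_mul_neg]
  · refine (integrableOn_exp_mul_Ioi (a := -(2 * k)) (by linarith) 0).congr_fun (fun x hx => ?_)
      measurableSet_Ioi
    simp only
    rw [abs_of_pos hx]

/-- Half of the exponential decay absorbs the linear factor. -/
theorem norm_expFun_le {k : ℝ} (hk : 0 < k) {p q p' q' : ℂ} {M : ℝ}
    (h : ‖p‖ + ‖q‖ * (2 / k) ≤ M) (h' : ‖p'‖ + ‖q'‖ * (2 / k) ≤ M) (x : ℝ) :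
    ‖expFun k p q p' q' x‖ ≤ M * Real.exp (-(k / 2) * |x|) := by
  have key : ∀ r s : ℂ, ‖r‖ + ‖s‖ * (2 / k) ≤ M →
      ‖((Real.exp (-k * |x|) : ℝ) : ℂ) * (r + s * x)‖ ≤ M * Real.exp (-(k / 2) * |x|) := by
    intro r s hrs
    have e : Real.exp (-k * |x|) = Real.exp (-(k / 2) * |x|) * Real.exp (-(k / 2) * |x|) := by
      rw [← Real.exp_add]
      congr 1
      ring
    have h1 : ‖r + s * x‖ ≤ ‖r‖ + ‖s‖ * |x| := by
      refine (norm_add_le _ _).trans (le_of_eq ?_)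
      rw [norm_mul, Complex.norm_real, Real.norm_eq_abs]
    have h2 : Real.exp (-(k / 2) * |x|) * (k / 2 * |x|) ≤ 1 := by
      have h3 := Real.add_one_le_exp (k / 2 * |x|)
      rw [neg_mul, Real.exp_neg, inv_mul_le_iff₀ (Real.exp_pos _)]
      linarith
    have h4 : Real.exp (-(k / 2) * |x|) ≤ 1 := by
      refine Real.exp_le_one_iff.mpr ?_
      have := abs_nonneg x
      nlinarith
    have h5 : Real.exp (-(k / 2) * |x|) * |x| ≤ 2 / k := by
      rw [le_div_iff₀ hk]
      linarith
    rw [norm_mul, Complex.norm_real, Real.norm_eq_abs, Real.abs_exp, e, mul_assoc,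
      mul_comm M]
    refine mul_le_mul_of_nonneg_left ?_ (Real.exp_pos _).le
    calc _ ≤ Real.exp (-(k / 2) * |x|) * (‖r‖ + ‖s‖ * |x|) :=
          mul_le_mul_of_nonneg_left h1 (Real.exp_pos _).le
      _ = Real.exp (-(k / 2) * |x|) * ‖r‖ + ‖s‖ * (Real.exp (-(k / 2) * |x|) * |x|) := by ring
      _ ≤ 1 * ‖r‖ + ‖s‖ * (2 / k) := add_le_add
          (mul_le_mul_of_nonneg_right h4 (norm_nonneg _))
          (mul_le_mul_of_nonneg_left h5 (norm_nonneg _))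
      _ ≤ M := by rwa [one_mul]
  unfold expFun
  split_ifs
  · exact key p q h
  · exact key p' q' h'

theorem measurable_expFun (k : ℝ) (p q p' q' : ℂ) : Measurable (expFun k p q p' q') := by
  unfold expFun
  exact Measurable.ite measurableSet_Ioi (by fun_prop) (by fun_prop)

theorem memLp_expFun {k : ℝ} (hk : 0 < k) (p q p' q' : ℂ) : MemLp (expFun k p q p' q') 2 := by
  refine ((memLp_exp_neg_mul_abs (half_pos hk)).const_mul
    (max (‖p‖ + ‖q‖ * (2 / k)) (‖p'‖ + ‖q'‖ * (2 / k)))).mono'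
    (measurable_expFun k p q p' q').aestronglyMeasurable (Eventually.of_forall fun x => ?_)
  exact norm_expFun_le hk (le_max_left _ _) (le_max_right _ _) x

theorem hasDerivAt_exp_mul (k : ℝ) (p q : ℂ) (x : ℝ) :
    HasDerivAt (fun x : ℝ => ((Real.exp (k * x) : ℝ) : ℂ) * (p + q * x))
      (((Real.exp (k * x) : ℝ) : ℂ) * ((q + k * p) + k * q * x)) x := by
  have h1 : HasDerivAt (fun x : ℝ => ((Real.exp (k * x) : ℝ) : ℂ))
      ((Real.exp (k * x) * k : ℝ) : ℂ) x := by
    refine HasDerivAt.ofReal_comp ?_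
    simpa using ((hasDerivAt_id x).const_mul k).exp
  have h2 : HasDerivAt (fun x : ℝ => p + q * (x : ℂ)) (q * 1) x :=
    ((hasDerivAt_id x).ofReal_comp.const_mul q).const_add p
  refine (h1.mul h2).congr_deriv ?_
  push_cast
  ring

theorem integral_exp_mul_deriv (k : ℝ) (p q : ℂ) (x : ℝ) :
    ((Real.exp (k * x) : ℝ) : ℂ) * (p + q * x) =
      p + ∫ t in (0 : ℝ)..x, ((Real.exp (k * t) : ℝ) : ℂ) * ((q + k * p) + k * q * t) := by
  rw [intervalIntegral.integral_eq_sub_of_hasDerivAt (fun t _ => hasDerivAt_exp_mul k p q t)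
    ((by fun_prop : Continuous fun t : ℝ =>
      ((Real.exp (k * t) : ℝ) : ℂ) * ((q + k * p) + k * q * t)).intervalIntegrable _ _)]
  simp

theorem halfDeriv_expFun (k : ℝ) (p q p' q' : ℂ) :
    HalfDeriv (expFun k p q p' q') (expFun k (q - k * p) (-k * q) (q' + k * p') (k * q')) p p' := by
  refine ⟨Eventually.of_forall fun x hx => ?_, Eventually.of_forall fun x hx => ?_⟩
  · have h := integral_exp_mul_deriv (-k) p q x
    rw [expFun, if_pos hx, abs_of_pos hx, h]
    congr 1
    refine intervalIntegral.integral_congr_ae (Eventually.of_forall fun t ht => ?_)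
    rw [uIoc_of_le hx.le] at ht
    rw [expFun, if_pos ht.1, abs_of_pos ht.1]
    push_cast
    ring
  · have h := integral_exp_mul_deriv k p' q' x
    rw [expFun, if_neg hx.not_gt, abs_of_neg hx, neg_mul_neg, h]
    congr 1
    refine intervalIntegral.integral_congr_ae (Eventually.of_forall fun t ht => ?_)
    rw [uIoc_of_ge hx.le] at ht
    rw [expFun, if_neg ht.2.not_gt, abs_of_nonpos ht.2, neg_mul_neg]

/-- `expFun` as an element of `L²(ℝ)`. -/
noncomputable def expLp {k : ℝ} (hk : 0 < k) (p q p' q' : ℂ) : L2Line :=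
  (memLp_expFun hk p q p' q').toLp _

theorem coeFn_expLp {k : ℝ} (hk : 0 < k) (p q p' q' : ℂ) :
    expLp hk p q p' q' =ᵐ[volume] expFun k p q p' q' := MemLp.coeFn_toLp _

theorem halfDeriv_expLp {k : ℝ} (hk : 0 < k) (p q p' q' : ℂ) :
    HalfDeriv (expLp hk p q p' q') (expLp hk (q - k * p) (-k * q) (q' + k * p') (k * q')) p p' :=
  (halfDeriv_expFun k p q p' q').congr_Lp (coeFn_expLp _ _ _ _ _) (coeFn_expLp _ _ _ _ _)

theorem smul_expLp {k : ℝ} (hk : 0 < k) (c p q p' q' : ℂ) :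
    c • expLp hk p q p' q' = expLp hk (c * p) (c * q) (c * p') (c * q') := by
  refine Lp.ext ?_
  filter_upwards [Lp.coeFn_smul c (expLp hk p q p' q'), coeFn_expLp hk p q p' q',
    coeFn_expLp hk (c * p) (c * q) (c * p') (c * q')] with x h1 h2 h3
  rw [h1, h3, Pi.smul_apply, h2, expFun, expFun, smul_eq_mul]
  split_ifs <;> ring

/-- Derivatives exchange the odd and the even exponential up to the factor -k, and the two have
equal norms. Green's formula applied to the pair gives 2k‖·‖² = 2 without computing an integral. -/
theorem norm_expLp_one {k : ℝ} (hk : 0 < k) : ‖expLp hk 1 0 (-1) 0‖ ^ 2 = k⁻¹ ∧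
    ‖expLp hk 1 0 1 0‖ ^ 2 = k⁻¹ := by
  have h1 := halfDeriv_expLp hk 1 0 (-1) 0
  have e1 : expLp hk (0 - k * 1) (-k * 0) (0 + k * (-1)) (k * 0) = (-k : ℂ) • expLp hk 1 0 1 0 := by
    rw [smul_expLp]
    congr 1 <;> ring
  have e2 : ‖expLp hk 1 0 1 0‖ = ‖expLp hk 1 0 (-1) 0‖ := by
    refine le_antisymm (Lp.norm_le_norm_of_ae_le ?_) (Lp.norm_le_norm_of_ae_le ?_)
    all_goals
      filter_upwards [coeFn_expLp hk 1 0 1 0, coeFn_expLp hk 1 0 (-1) 0] with x h1 h2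
      rw [h1, h2, expFun, expFun]
      split_ifs <;> simp
  rw [e1] at h1
  have h2 := halfDeriv_expLp hk 1 0 1 0
  have e3 : expLp hk (0 - k * 1) (-k * 0) (0 + k * 1) (k * 0) = (-k : ℂ) • expLp hk 1 0 (-1) 0 := by
    rw [smul_expLp]
    congr 1 <;> ring
  rw [e3] at h2
  have h3 := congrArg Complex.re (h1.green h2)
  rw [inner_smul_left, inner_smul_right, inner_self_ofReal,
    inner_self_ofReal, e2] at h3
  have h4 : 2 * k * ‖expLp hk 1 0 (-1) 0‖ ^ 2 = 2 := by
    have h5 : -(2 * k * ‖expLp hk 1 0 (-1) 0‖ ^ 2) = -2 := by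
      refine (Eq.trans ?_ h3).trans ?_
      · rw [map_neg, Complex.conj_ofReal, ← Complex.ofReal_neg,
          ← Complex.ofReal_mul, ← Complex.ofReal_add, Complex.ofReal_re]
        ring
      · simp
        norm_num
    linarith
  have h5 : ‖expLp hk 1 0 (-1) 0‖ ^ 2 = k⁻¹ := by
    field_simp
    linarith
  exact ⟨h5, by rw [e2, h5]⟩

theorem norm_expLp_le {k : ℝ} (hk : 0 < k) {p q p' q' : ℂ} {M : ℝ}
    (h : ‖p‖ + ‖q‖ * (2 / k) ≤ M) (h' : ‖p'‖ + ‖q'‖ * (2 / k) ≤ M) :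
    ‖expLp hk p q p' q'‖ ^ 2 ≤ M ^ 2 * (2 / k) := by
  have hM : 0 ≤ M := le_trans (by positivity) h
  have h1 : ‖expLp hk p q p' q'‖ ≤ M * ‖expLp (half_pos hk) 1 0 1 0‖ := by
    refine Lp.norm_le_mul_norm_of_ae_le_mul ?_
    filter_upwards [coeFn_expLp hk p q p' q', coeFn_expLp (half_pos hk) 1 0 1 0] with x h1 h2
    rw [h1, h2]
    refine (norm_expFun_le hk h h' x).trans (le_of_eq ?_)
    simp only [expFun, zero_mul, add_zero, mul_one, ite_self, Complex.norm_real, Real.norm_eq_abs,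
      Real.abs_exp]
  calc _ ≤ (M * ‖expLp (half_pos hk) 1 0 1 0‖) ^ 2 := by gcongr
    _ = _ := by rw [mul_pow, (norm_expLp_one (half_pos hk)).2, inv_div]

end ExpFun

/-! ### Expansion of functions on the plane in Hermite functions of y -/

section Expansion

theorem inner_L2Plane (Φ Ψ : L2Plane) : inner ℂ Φ Ψ = ∫ p, starRingEnd ℂ (Φ p) * Ψ p := by
  rw [L2.inner_def]
  refine integral_congr_ae (Eventually.of_forall fun x => ?_)
  simp only [RCLike.inner_apply, mul_comm]

theorem memLp_prod_mul {f g : ℝ → ℂ} (hf : MemLp f 2) (hg : MemLp g 2) :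
    MemLp (fun p : ℝ × ℝ => f p.1 * g p.2) 2 := by
  have hm : AEStronglyMeasurable (fun p : ℝ × ℝ => f p.1 * g p.2) :=
    (hf.1.comp_fst (ν := volume)).mul (hg.1.comp_snd (μ := volume))
  rw [memLp_two_iff_integrable_sq_norm hm]
  have h1 := (memLp_two_iff_integrable_sq_norm hf.1).mp hf
  have h2 := (memLp_two_iff_integrable_sq_norm hg.1).mp hg
  refine (h1.mul_prod h2).congr (Eventually.of_forall fun p => ?_)
  simp only [norm_mul, mul_pow]

/-- The function `f(x) χₙ(y)`. -/
noncomputable def hermiteTensorFun (n : ℕ) (f : ℝ → ℂ) (p : ℝ × ℝ) : ℂ :=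
  f p.1 * (hermiteFun n p.2 : ℂ)

theorem memLp_hermiteTensorFun (n : ℕ) {f : ℝ → ℂ} (hf : MemLp f 2) :
    MemLp (hermiteTensorFun n f) 2 :=
  memLp_prod_mul hf (memLp_hermiteFun_complex n)

theorem ae_fst {P : ℝ → Prop} (h : ∀ᵐ x, P x) : ∀ᵐ p : ℝ × ℝ, P p.1 :=
  Measure.quasiMeasurePreserving_fst.ae h

/-- The embedding `f ↦ f(x) χₙ(y)` as a linear map. -/
noncomputable def hermiteTensorLin (n : ℕ) : L2Line →ₗ[ℂ] L2Plane where
  toFun f := (memLp_hermiteTensorFun n (Lp.memLp f)).toLp _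
  map_add' f g := by
    rw [← MemLp.toLp_add]
    refine MemLp.toLp_congr _ _ ?_
    filter_upwards [ae_fst (Lp.coeFn_add f g)] with p hp
    rw [Pi.add_apply, hermiteTensorFun, hp, Pi.add_apply, add_mul]
    rfl
  map_smul' c f := by
    rw [RingHom.id_apply, ← MemLp.toLp_const_smul]
    refine MemLp.toLp_congr _ _ ?_
    filter_upwards [ae_fst (Lp.coeFn_smul c f)] with p hp
    rw [Pi.smul_apply, hermiteTensorFun, hp, Pi.smul_apply, smul_mul_assoc]
    rfl

theorem coeFn_hermiteTensorLin (n : ℕ) (f : L2Line) :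
    hermiteTensorLin n f =ᵐ[volume] hermiteTensorFun n f :=
  (memLp_hermiteTensorFun n (Lp.memLp f)).coeFn_toLp

theorem inner_hermiteTensorLin (m n : ℕ) (f g : L2Line) :
    inner ℂ (hermiteTensorLin m f) (hermiteTensorLin n g) = if m = n then inner ℂ f g else 0 := by
  rw [inner_L2Plane]
  have e : ∫ p : ℝ × ℝ, starRingEnd ℂ (hermiteTensorLin m f p) * hermiteTensorLin n g p =
      ∫ p : ℝ × ℝ, (starRingEnd ℂ (f p.1) * g p.1) *
        ((hermiteFun m p.2 * hermiteFun n p.2 : ℝ) : ℂ) := by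
    refine integral_congr_ae ?_
    filter_upwards [coeFn_hermiteTensorLin m f, coeFn_hermiteTensorLin n g] with p h1 h2
    rw [h1, h2, hermiteTensorFun, hermiteTensorFun, map_mul, Complex.conj_ofReal]
    push_cast
    ring
  rw [e, Measure.volume_eq_prod, integral_prod_mul (μ := volume) (ν := volume)
    (fun x => starRingEnd ℂ (f x) * g x) (fun y => ((hermiteFun m y * hermiteFun n y : ℝ) : ℂ)),
    ← inner_L2Line, integral_complex_ofReal, integral_hermiteFun_mul]
  split_ifs <;> simp

/-- The isometric embedding `f ↦ f(x) χₙ(y)`. -/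
noncomputable def hermiteTensor (n : ℕ) : L2Line →ₗᵢ[ℂ] L2Plane :=
  (hermiteTensorLin n).isometryOfInner fun f g => by rw [inner_hermiteTensorLin, if_pos rfl]

theorem coeFn_hermiteTensor (n : ℕ) (f : L2Line) :
    hermiteTensor n f =ᵐ[volume] hermiteTensorFun n f := coeFn_hermiteTensorLin n f

theorem orthogonalFamily_hermiteTensor :
    OrthogonalFamily ℂ (fun _ : ℕ => L2Line) hermiteTensor := by
  intro m n hmn f g
  exact (inner_hermiteTensorLin m n f g).trans (if_neg hmn)

/-- The Hermite coefficients of the slices `Ψ(x, ·)`. -/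
noncomputable def sliceCoeff (n : ℕ) (Ψ : ℝ × ℝ → ℂ) (x : ℝ) : ℂ :=
  ∫ y : ℝ, (hermiteFun n y : ℂ) * Ψ (x, y)

theorem memLp_slice {Ψ : ℝ × ℝ → ℂ} (h : MemLp Ψ 2) : ∀ᵐ x, MemLp (fun y => Ψ (x, y)) 2 := by
  have h1 := (memLp_two_iff_integrable_sq_norm h.1).mp h
  filter_upwards [h1.prod_right_ae, h.1.prodMk_left] with x h2 h3
  exact (memLp_two_iff_integrable_sq_norm h3).mpr h2

theorem inner_hermiteTensor (n : ℕ) (f : L2Line) (Ψ : L2Plane) :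
    inner ℂ (hermiteTensor n f) Ψ = ∫ x, starRingEnd ℂ (f x) * sliceCoeff n Ψ x := by
  have i1 : Integrable (fun p : ℝ × ℝ => starRingEnd ℂ (hermiteTensorFun n f p) * Ψ p) :=
    (memLp_hermiteTensorFun n (Lp.memLp f)).star.integrable_mul (Lp.memLp Ψ)
  have e : inner ℂ (hermiteTensor n f) Ψ =
      ∫ p : ℝ × ℝ, starRingEnd ℂ (hermiteTensorFun n f p) * Ψ p := by
    rw [inner_L2Plane]
    refine integral_congr_ae ?_
    filter_upwards [coeFn_hermiteTensor n f] with p h1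
    rw [h1]
  refine (e.trans (integral_prod _ i1)).trans ?_
  refine integral_congr_ae (Eventually.of_forall fun x => ?_)
  simp only [hermiteTensorFun, map_mul, Complex.conj_ofReal, mul_assoc, sliceCoeff]
  rw [integral_const_mul]

theorem locallyIntegrable_sliceCoeff (n : ℕ) {Ψ : ℝ × ℝ → ℂ} (h : MemLp Ψ 2) :
    LocallyIntegrable (sliceCoeff n Ψ) := by
  rw [locallyIntegrable_iff]
  intro K hK
  have h1 : MemLp (K.indicator fun _ : ℝ => (1 : ℂ)) 2 :=
    memLp_indicator_const 2 hK.measurableSet 1 (Or.inr hK.measure_lt_top.ne)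
  have i1 : Integrable (fun p : ℝ × ℝ => hermiteTensorFun n (K.indicator fun _ : ℝ => (1 : ℂ)) p * Ψ p) :=
    (memLp_hermiteTensorFun n h1).integrable_mul h
  have i2 := i1.integral_prod_left
  rw [← integrable_indicator_iff hK.measurableSet]
  refine i2.congr (Eventually.of_forall fun x => ?_)
  simp only [hermiteTensorFun, mul_assoc]
  rw [integral_const_mul]
  by_cases hx : x ∈ K
  · simp [hx, sliceCoeff]
  · simp [hx]

theorem conj_testLp {θ : ℝ → ℝ} (h : Continuous θ) (hc : HasCompactSupport θ) :
    testLp h hc =ᵐ[volume] fun x => (θ x : ℂ) := (memLp_test h hc).coeFn_toLp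

theorem inner_hermiteTensor_testLp (n : ℕ) {θ : ℝ → ℝ} (h : Continuous θ)
    (hc : HasCompactSupport θ) (Ψ : L2Plane) :
    inner ℂ (hermiteTensor n (testLp h hc)) Ψ = ∫ x, θ x • sliceCoeff n Ψ x := by
  rw [inner_hermiteTensor]
  refine integral_congr_ae ?_
  filter_upwards [conj_testLp h hc] with x hx
  rw [hx, Complex.conj_ofReal, Complex.real_smul]

/-- Almost every slice vanishes by completeness of the Hermite functions; Fubini then gives a zero
norm. -/
theorem eq_zero_of_sliceCoeff {Ψ : ℝ × ℝ → ℂ} (hΨ : MemLp Ψ 2)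
    (h : ∀ n, sliceCoeff n Ψ =ᵐ[volume] 0) : Ψ =ᵐ[volume] 0 := by
  have h1 := (memLp_two_iff_integrable_sq_norm hΨ.1).mp hΨ
  have h2 : ∫ p : ℝ × ℝ, ‖Ψ p‖ ^ 2 = 0 := by
    rw [Measure.volume_eq_prod, integral_prod _ h1]
    refine integral_eq_zero_of_ae ?_
    filter_upwards [ae_all_iff.mpr h, memLp_slice hΨ] with x hx hm
    have h3 := ae_eq_zero_of_hermite hm hx
    refine integral_eq_zero_of_ae ?_
    filter_upwards [h3] with y hy
    rw [hy]
    simp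
  rw [integral_eq_zero_iff_of_nonneg (fun p => sq_nonneg _) h1] at h2
  filter_upwards [h2] with p hp
  simpa using hp

theorem isHilbertSum_hermiteTensor : IsHilbertSum ℂ (fun _ : ℕ => L2Line) hermiteTensor := by
  refine IsHilbertSum.mk orthogonalFamily_hermiteTensor ?_
  rw [top_le_iff, Submodule.topologicalClosure_eq_top_iff, Submodule.eq_bot_iff]
  intro Ψ hΨ
  rw [Lp.eq_zero_iff_ae_eq_zero]
  refine eq_zero_of_sliceCoeff (Lp.memLp Ψ) fun n => ?_
  refine ae_eq_zero_of_integral_contDiff_smul_eq_zero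
    (locallyIntegrable_sliceCoeff n (Lp.memLp Ψ)) fun θ h1 h2 => ?_
  rw [← inner_hermiteTensor_testLp n h1.continuous h2]
  exact Submodule.inner_right_of_mem_orthogonal (Submodule.mem_iSup_of_mem n
    (LinearMap.mem_range_self (hermiteTensor n).toLinearMap (testLp h1.continuous h2))) hΨ

/-- The space of sequences of Hermite coefficients. -/
abbrev CoeffSpace : Type := lp (fun _ : ℕ => L2Line) 2

/-- The expansion of functions on the plane in Hermite functions of the second variable. -/
noncomputable def hermiteExpansion : L2Plane ≃ₗᵢ[ℂ] CoeffSpace :=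
  isHilbertSum_hermiteTensor.linearIsometryEquiv

theorem hermiteExpansion_symm_single (n : ℕ) (f : L2Line) :
    hermiteExpansion.symm (lp.single 2 n f) = hermiteTensor n f :=
  isHilbertSum_hermiteTensor.linearIsometryEquiv_symm_apply_single f

theorem inner_hermiteTensor_left (n : ℕ) (f : L2Line) (Ψ : L2Plane) :
    inner ℂ (hermiteTensor n f) Ψ = inner ℂ f (hermiteExpansion Ψ n) := by
  rw [← hermiteExpansion_symm_single, ← hermiteExpansion.inner_map_map,
    LinearIsometryEquiv.apply_symm_apply, lp.inner_single_left]

/-- Both sides have the same integrals against test functions θ, namely the pairing of Ψ with θ(x)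
χₙ(y). -/
theorem hermiteExpansion_ae (Ψ : L2Plane) (n : ℕ) :
    hermiteExpansion Ψ n =ᵐ[volume] sliceCoeff n Ψ := by
  refine ae_eq_of_integral_contDiff_smul_eq (memLp_locallyIntegrable (Lp.memLp _))
    (locallyIntegrable_sliceCoeff n (Lp.memLp Ψ)) fun θ h1 h2 => ?_
  rw [← inner_hermiteTensor_testLp n h1.continuous h2, inner_hermiteTensor_left, inner_testLp]

end Expansion

/-! ### Product test functions and cutoffs in y -/

section ProductTest

theorem hasFDerivAt_mul_fst_snd {θ γ : ℝ → ℝ} (hθ : ContDiff ℝ ∞ θ) (hγ : ContDiff ℝ ∞ γ)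
    (p v : ℝ × ℝ) : fderiv ℝ (fun p : ℝ × ℝ => θ p.1 * γ p.2) p v =
      v.1 * (deriv θ p.1 * γ p.2) + v.2 * (θ p.1 * deriv γ p.2) := by
  have h1 : HasFDerivAt (fun p : ℝ × ℝ => θ p.1) _ p :=
    (hasDerivAt_test hθ p.1).hasFDerivAt.comp p hasFDerivAt_fst
  have h2 : HasFDerivAt (fun p : ℝ × ℝ => γ p.2) _ p :=
    (hasDerivAt_test hγ p.2).hasFDerivAt.comp p hasFDerivAt_snd
  have h3 : fderiv ℝ (fun p : ℝ × ℝ => θ p.1 * γ p.2) p = _ := (h1.mul h2).fderiv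
  rw [h3]
  simp
  ring

theorem contDiff_mul_fst_snd {θ γ : ℝ → ℝ} (hθ : ContDiff ℝ ∞ θ) (hγ : ContDiff ℝ ∞ γ) :
    ContDiff ℝ ∞ (fun p : ℝ × ℝ => θ p.1 * γ p.2) :=
  (hθ.comp contDiff_fst).mul (hγ.comp contDiff_snd)

theorem tsupport_mul_fst_snd (θ γ : ℝ → ℝ) :
    tsupport (fun p : ℝ × ℝ => θ p.1 * γ p.2) ⊆ tsupport θ ×ˢ tsupport γ := by
  refine closure_minimal (fun p hp => ?_) ((isClosed_tsupport θ).prod (isClosed_tsupport γ))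
  exact ⟨subset_tsupport θ (left_ne_zero_of_mul hp), subset_tsupport γ (right_ne_zero_of_mul hp)⟩

theorem hasCompactSupport_mul_fst_snd {θ γ : ℝ → ℝ} (hθ : HasCompactSupport θ)
    (hγ : HasCompactSupport γ) : HasCompactSupport (fun p : ℝ × ℝ => θ p.1 * γ p.2) :=
  (hθ.isCompact.prod hγ.isCompact).of_isClosed_subset (isClosed_tsupport _)
    (tsupport_mul_fst_snd θ γ)

theorem tendsto_integral_mul_fst_snd {θ : ℝ → ℝ} (hθ : Continuous θ) (hc : HasCompactSupport θ)
    {γ : ℕ → ℝ → ℝ} (hγ : ∀ m, Continuous (γ m)) {γ' : ℝ → ℝ} {g : ℝ → ℝ} (hg : MemLp g 2)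
    (hb : ∀ m y, |γ m y| ≤ g y) (hl : ∀ y, ∀ᶠ m in atTop, γ m y = γ' y) {f : ℝ × ℝ → ℂ}
    (hf : MemLp f 2) :
    Tendsto (fun m => ∫ p : ℝ × ℝ, (θ p.1 * γ m p.2) • f p) atTop
      (𝓝 (∫ p : ℝ × ℝ, (θ p.1 * γ' p.2) • f p)) := by
  have i1 : Integrable (fun p : ℝ × ℝ => ‖((θ p.1 : ℂ) * (g p.2 : ℂ)) * f p‖) :=
    ((memLp_prod_mul (memLp_test hθ hc) (hg.ofReal (K := ℂ))).integrable_mul hf).norm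
  refine tendsto_integral_of_dominated_convergence _ (fun m => ?_) i1 (fun m => ?_) ?_
  · exact (((hθ.comp continuous_fst).mul ((hγ m).comp continuous_snd)).aestronglyMeasurable).smul
      hf.1
  · refine Eventually.of_forall fun p => ?_
    rw [norm_smul, norm_mul, norm_mul, norm_mul, Complex.norm_real, Complex.norm_real]
    gcongr
    exact (hb m p.2).trans (le_abs_self _)
  · refine Eventually.of_forall fun p => ?_
    refine tendsto_const_nhds.congr' ?_
    filter_upwards [hl p.2] with m hm
    rw [hm]

/-- The function θ(x) χₙ(y) lacks compact support in y. Dilated bumps with uniformly bounded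
derivatives let it be reached from admissible tests by dominated convergence. -/
theorem exists_cutoff : ∃ η : ℕ → ℝ → ℝ, (∀ m, ContDiff ℝ ∞ (η m)) ∧
    (∀ m, HasCompactSupport (η m)) ∧ (∀ m y, |η m y| ≤ 1) ∧
    (∃ C, ∀ m y, |deriv (η m) y| ≤ C) ∧
    ∀ y, ∀ᶠ m in atTop, η m y = 1 ∧ deriv (η m) y = 0 := by
  let b : ContDiffBump (0 : ℝ) := ⟨1, 2, one_pos, one_lt_two⟩
  have hb : ContDiff ℝ ∞ b := b.contDiff
  obtain ⟨C, hC⟩ := b.hasCompactSupport.deriv.exists_bound_of_continuous (continuous_deriv_test hb)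
  have hpos : ∀ m : ℕ, (0 : ℝ) < (m : ℝ) + 1 := fun m => by positivity
  have hd : ∀ (m : ℕ) y, HasDerivAt (fun y : ℝ => b (((m : ℝ) + 1)⁻¹ * y))
      (deriv b (((m : ℝ) + 1)⁻¹ * y) * ((m : ℝ) + 1)⁻¹) y := fun m y =>
    (hasDerivAt_test hb _).comp y (by simpa using (hasDerivAt_id y).const_mul ((m : ℝ) + 1)⁻¹)
  refine ⟨fun m y => b (((m : ℝ) + 1)⁻¹ * y), fun m => hb.comp (contDiff_const.mul contDiff_id),
    fun m => ?_, fun m y => ?_, ⟨C, fun m y => ?_⟩, fun y => ?_⟩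
  · exact b.hasCompactSupport.comp_homeomorph (Homeomorph.mulLeft₀ _ (inv_pos.mpr (hpos m)).ne')
  · rw [abs_of_nonneg b.nonneg]
    exact b.le_one
  · rw [(hd m y).deriv, abs_mul, abs_of_pos (inv_pos.mpr (hpos m))]
    have h1 : ((m : ℝ) + 1)⁻¹ ≤ 1 := inv_le_one_of_one_le₀ (by linarith [Nat.cast_nonneg (α := ℝ) m])
    calc _ ≤ |deriv b (((m : ℝ) + 1)⁻¹ * y)| * 1 := by gcongr
      _ ≤ C := by rw [mul_one]; exact hC _
  · obtain ⟨N, hN⟩ := exists_nat_gt |y|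
    filter_upwards [eventually_ge_atTop N] with m hm
    have h1 : (((m : ℝ) + 1)⁻¹ * y) ∈ Metric.ball (0 : ℝ) 1 := by
      rw [mem_ball_zero_iff, Real.norm_eq_abs, abs_mul, abs_of_pos (inv_pos.mpr (hpos m)),
        inv_mul_lt_iff₀ (hpos m)]
      have : (N : ℝ) ≤ m := by exact_mod_cast hm
      linarith
    refine ⟨b.one_of_mem_closedBall (Metric.ball_subset_closedBall h1), ?_⟩
    rw [(hd m y).deriv]
    have h2 : (b : ℝ → ℝ) =ᶠ[𝓝 (((m : ℝ) + 1)⁻¹ * y)] fun _ => 1 := by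
      filter_upwards [Metric.isOpen_ball.mem_nhds h1] with t ht
      exact b.one_of_mem_closedBall (Metric.ball_subset_closedBall ht)
    rw [h2.deriv_eq]
    simp

theorem integral_test_mul_hermiteFun (n : ℕ) {θ : ℝ → ℝ} (h : Continuous θ)
    (hc : HasCompactSupport θ) (Ψ : L2Plane) :
    ∫ p : ℝ × ℝ, (θ p.1 * hermiteFun n p.2) • Ψ p =
      inner ℂ (testLp h hc) (hermiteExpansion Ψ n) := by
  rw [← inner_hermiteTensor_left, inner_L2Plane]
  refine integral_congr_ae ?_
  filter_upwards [coeFn_hermiteTensor n (testLp h hc), ae_fst (conj_testLp h hc)] with p h1 h2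
  rw [h1, hermiteTensorFun, h2, map_mul, Complex.conj_ofReal, Complex.conj_ofReal,
    Complex.real_smul]
  push_cast
  rfl

end ProductTest

/-! ### Weak derivatives on the slit plane read on Hermite coefficients -/

section WeakDerivCoeff

theorem HasWeakDeriv.integral_mul_fst_snd {v : ℝ × ℝ} {f g : ℝ × ℝ → ℂ}
    (h : HasWeakDeriv slitPlane v f g) {θ γ : ℝ → ℝ} (h1 : ContDiff ℝ ∞ θ)
    (h2 : HasCompactSupport θ) (h3 : tsupport θ ⊆ {x | x ≠ 0}) (h4 : ContDiff ℝ ∞ γ)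
    (h5 : HasCompactSupport γ) :
    ∫ p : ℝ × ℝ, (v.1 * (deriv θ p.1 * γ p.2) + v.2 * (θ p.1 * deriv γ p.2)) • f p =
      -∫ p : ℝ × ℝ, (θ p.1 * γ p.2) • g p := by
  rw [← h _ (contDiff_mul_fst_snd h1 h4) (hasCompactSupport_mul_fst_snd h2 h5)
    ((tsupport_mul_fst_snd θ γ).trans fun p hp => h3 hp.1)]
  simp only [hasFDerivAt_mul_fst_snd h1 h4]

theorem HasWeakDeriv.integral_hermite_fst {f g : ℝ × ℝ → ℂ} (hf : MemLp f 2) (hg : MemLp g 2)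
    (h : HasWeakDeriv slitPlane (1, 0) f g) (n : ℕ) {θ : ℝ → ℝ} (h1 : ContDiff ℝ ∞ θ)
    (h2 : HasCompactSupport θ) (h3 : tsupport θ ⊆ {x | x ≠ 0}) :
    ∫ p : ℝ × ℝ, (deriv θ p.1 * hermiteFun n p.2) • f p =
      -∫ p : ℝ × ℝ, (θ p.1 * hermiteFun n p.2) • g p := by
  obtain ⟨η, e1, e2, e3, -, e5⟩ := exists_cutoff
  have hb : ∀ m y, |η m y * hermiteFun n y| ≤ |hermiteFun n y| := fun m y => by
    rw [abs_mul]
    exact mul_le_of_le_one_left (abs_nonneg _) (e3 m y)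
  have hl : ∀ y, ∀ᶠ m in atTop, η m y * hermiteFun n y = hermiteFun n y := fun y => by
    filter_upwards [e5 y] with m hm
    rw [hm.1, one_mul]
  have hcont : ∀ m, Continuous fun y => η m y * hermiteFun n y := fun m =>
    (e1 m).continuous.mul (continuous_hermiteFun n)
  have t1 := tendsto_integral_mul_fst_snd (continuous_deriv_test h1) h2.deriv hcont
    (memLp_hermiteFun n).norm hb hl hf
  have t2 := (tendsto_integral_mul_fst_snd h1.continuous h2 hcont
    (memLp_hermiteFun n).norm hb hl hg).neg
  have hs : ∀ m, ContDiff ℝ ∞ fun y => η m y * hermiteFun n y := fun m =>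
    (e1 m).mul (contDiff_hermiteFun n)
  have hc : ∀ m, HasCompactSupport fun y => η m y * hermiteFun n y := fun m => (e2 m).mul_right
  refine tendsto_nhds_unique t1 (t2.congr fun m => ?_)
  have h4 := h.integral_mul_fst_snd h1 h2 h3 (hs m) (hc m)
  simpa using h4.symm

theorem memLp_deriv_hermiteFun (n : ℕ) : MemLp (deriv (hermiteFun n)) 2 := by
  have : deriv (hermiteFun n) = fun y => Real.sqrt (n / 2) * hermiteFun (n - 1) y -
      Real.sqrt ((n + 1) / 2) * hermiteFun (n + 1) y :=
    funext fun y => (hasDerivAt_hermiteFun n y).deriv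
  rw [this]
  exact ((memLp_hermiteFun _).const_mul _).sub ((memLp_hermiteFun _).const_mul _)

theorem HasWeakDeriv.integral_hermite_snd {f g : ℝ × ℝ → ℂ} (hf : MemLp f 2) (hg : MemLp g 2)
    (h : HasWeakDeriv slitPlane (0, 1) f g) (n : ℕ) {θ : ℝ → ℝ} (h1 : ContDiff ℝ ∞ θ)
    (h2 : HasCompactSupport θ) (h3 : tsupport θ ⊆ {x | x ≠ 0}) :
    ∫ p : ℝ × ℝ, (θ p.1 * deriv (hermiteFun n) p.2) • f p =
      -∫ p : ℝ × ℝ, (θ p.1 * hermiteFun n p.2) • g p := by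
  obtain ⟨η, e1, e2, e3, ⟨C, e4⟩, e5⟩ := exists_cutoff
  have hb : ∀ m y, |η m y * hermiteFun n y| ≤ |hermiteFun n y| := fun m y => by
    rw [abs_mul]
    exact mul_le_of_le_one_left (abs_nonneg _) (e3 m y)
  have hl : ∀ y, ∀ᶠ m in atTop, η m y * hermiteFun n y = hermiteFun n y := fun y => by
    filter_upwards [e5 y] with m hm
    rw [hm.1, one_mul]
  have hcont : ∀ m, Continuous fun y => η m y * hermiteFun n y := fun m =>
    (e1 m).continuous.mul (continuous_hermiteFun n)
  have hs : ∀ m, ContDiff ℝ ∞ fun y => η m y * hermiteFun n y := fun m =>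
    (e1 m).mul (contDiff_hermiteFun n)
  have hd : ∀ m y, deriv (fun y => η m y * hermiteFun n y) y =
      deriv (η m) y * hermiteFun n y + η m y * deriv (hermiteFun n) y := fun m y =>
    ((hasDerivAt_test (e1 m) y).mul (hasDerivAt_test (contDiff_hermiteFun n) y)).deriv
  have hb' : ∀ m y, |deriv (fun y => η m y * hermiteFun n y) y| ≤
      C * |hermiteFun n y| + |deriv (hermiteFun n) y| := fun m y => by
    rw [hd]
    refine (abs_add_le _ _).trans (add_le_add ?_ ?_)
    · rw [abs_mul]
      exact mul_le_mul_of_nonneg_right (e4 m y) (abs_nonneg _)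
    · rw [abs_mul]
      exact mul_le_of_le_one_left (abs_nonneg _) (e3 m y)
  have hl' : ∀ y, ∀ᶠ m in atTop, deriv (fun y => η m y * hermiteFun n y) y =
      deriv (hermiteFun n) y := fun y => by
    filter_upwards [e5 y] with m hm
    rw [hd, hm.1, hm.2, zero_mul, one_mul, zero_add]
  have hg' : MemLp (fun y => C * |hermiteFun n y| + |deriv (hermiteFun n) y|) 2 :=
    ((memLp_hermiteFun n).norm.const_mul C).add (memLp_deriv_hermiteFun n).norm
  have t1 := tendsto_integral_mul_fst_snd h1.continuous h2
    (fun m => continuous_deriv_test (hs m)) hg' hb' hl' hf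
  have t2 := (tendsto_integral_mul_fst_snd h1.continuous h2 hcont
    (memLp_hermiteFun n).norm hb hl hg).neg
  have hc : ∀ m, HasCompactSupport fun y => η m y * hermiteFun n y := fun m => (e2 m).mul_right
  refine tendsto_nhds_unique t1 (t2.congr fun m => ?_)
  have h4 := h.integral_mul_fst_snd h1 h2 h3 (hs m) (hc m)
  simpa using h4.symm

variable {Ψ Φ : L2Plane}

theorem hasWeakDerivLine_coeff (h : HasWeakDeriv slitPlane (1, 0) Ψ Φ) (n : ℕ) :
    HasWeakDerivLine {x | x ≠ 0} (hermiteExpansion Ψ n) (hermiteExpansion Φ n) := by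
  intro θ h1 h2 h3
  have h4 := h.integral_hermite_fst (Lp.memLp Ψ) (Lp.memLp Φ) n h1 h2 h3
  rw [integral_test_mul_hermiteFun n (continuous_deriv_test h1) h2.deriv,
    integral_test_mul_hermiteFun n h1.continuous h2, inner_testLp, inner_testLp] at h4
  exact h4

/-- Tests supported away from 0 suffice, the origin being a null set. -/
theorem L2Line.eq_of_inner_testLp {f g : L2Line} (h : ∀ (θ : ℝ → ℝ) (h1 : ContDiff ℝ ∞ θ)
    (h2 : HasCompactSupport θ), tsupport θ ⊆ {x | x ≠ 0} →
      inner ℂ (testLp h1.continuous h2) f = inner ℂ (testLp h1.continuous h2) g) : f = g := by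
  rw [← sub_eq_zero, Lp.eq_zero_iff_ae_eq_zero]
  have key := (isOpen_ne (x := (0 : ℝ))).ae_eq_zero_of_integral_contDiff_smul_eq_zero
    (f := (f - g : L2Line)) (μ := volume)
    ((memLp_locallyIntegrable (Lp.memLp _)).locallyIntegrableOn _) (fun θ h1 h2 h3 => by
      rw [← inner_testLp h1.continuous h2, inner_sub_right, h θ h1 h2 h3, sub_self])
  filter_upwards [key, ae_ne_zero] with x hx h0 using hx h0

/-- The y-derivative is moved onto χₙ, where it becomes a combination of χₙ₊₁ and χₙ₋₁. -/
theorem coeff_snd_deriv (h : HasWeakDeriv slitPlane (0, 1) Ψ Φ) (n : ℕ) :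
    hermiteExpansion Φ n = ((Real.sqrt ((n + 1) / 2) : ℝ) : ℂ) • hermiteExpansion Ψ (n + 1) -
      ((Real.sqrt (n / 2) : ℝ) : ℂ) • hermiteExpansion Ψ (n - 1) := by
  refine L2Line.eq_of_inner_testLp fun θ h1 h2 h3 => ?_
  have h4 := h.integral_hermite_snd (Lp.memLp Ψ) (Lp.memLp Φ) n h1 h2 h3
  rw [integral_test_mul_hermiteFun n h1.continuous h2] at h4
  rw [inner_sub_right, inner_smul_right, inner_smul_right,
    ← integral_test_mul_hermiteFun (n + 1) h1.continuous h2,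
    ← integral_test_mul_hermiteFun (n - 1) h1.continuous h2, ← neg_eq_iff_eq_neg.mpr h4,
    ← integral_const_mul, ← integral_const_mul]
  have hi : ∀ k, Integrable fun p : ℝ × ℝ => (θ p.1 * hermiteFun k p.2) • Ψ p := fun k => by
    refine ((memLp_prod_mul (memLp_test h1.continuous h2)
      (memLp_hermiteFun_complex k)).integrable_mul (Lp.memLp Ψ)).congr
        (Eventually.of_forall fun p => ?_)
    simp only [Pi.mul_apply, Complex.real_smul, Complex.ofReal_mul]
  rw [← integral_sub ((hi _).const_mul _) ((hi _).const_mul _), ← integral_neg]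
  refine integral_congr_ae (Eventually.of_forall fun p => ?_)
  simp only [(hasDerivAt_hermiteFun n p.2).deriv, Complex.real_smul, Complex.ofReal_mul,
    Complex.ofReal_sub]
  ring

end WeakDerivCoeff

/-! ### Multiplication by y as a sum of ladder operators -/

section Ladder

/-- The matrix elements `√(n/2)` of the ladder operators. -/
noncomputable def ladder (n : ℕ) : ℝ := Real.sqrt (n / 2)

theorem ladder_zero : ladder 0 = 0 := by simp [ladder]

theorem ladder_sq (n : ℕ) : ladder n ^ 2 = n / 2 := Real.sq_sqrt (by positivity)

theorem mul_hermiteFun_ladder (n : ℕ) (y : ℝ) : y * hermiteFun n y =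
    ladder (n + 1) * hermiteFun (n + 1) y + ladder n * hermiteFun (n - 1) y := by
  rw [mul_hermiteFun, ladder, ladder]
  push_cast
  rfl

theorem integral_mul_hermiteFun {f g : ℝ → ℂ} (hf : MemLp f 2)
    (h : ∀ᵐ y : ℝ, g y = (y : ℂ) * f y) (n : ℕ) :
    ∫ y, (hermiteFun n y : ℂ) * g y = (ladder (n + 1) : ℂ) * (∫ y, (hermiteFun (n + 1) y : ℂ) * f y) +
      (ladder n : ℂ) * ∫ y, (hermiteFun (n - 1) y : ℂ) * f y := by
  rw [← integral_const_mul, ← integral_const_mul, ← integral_add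
    ((integrable_hermiteFun_mul_complex hf _).const_mul _)
    ((integrable_hermiteFun_mul_complex hf _).const_mul _)]
  refine integral_congr_ae ?_
  filter_upwards [h] with y hy
  have := congrArg (fun r : ℝ => (r : ℂ)) (mul_hermiteFun_ladder n y)
  simp only [Complex.ofReal_mul, Complex.ofReal_add] at this
  rw [hy]
  linear_combination f y * this

theorem integral_sq_mul_hermiteFun {f g : ℝ → ℂ} (hf : MemLp f 2)
    (h : ∀ᵐ y : ℝ, g y = (y : ℂ) ^ 2 * f y) (n : ℕ) :
    ∫ y, (hermiteFun n y : ℂ) * g y =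
      (ladder (n + 1) : ℂ) * ((ladder (n + 2) : ℂ) * (∫ y, (hermiteFun (n + 2) y : ℂ) * f y) +
        (ladder (n + 1) : ℂ) * ∫ y, (hermiteFun n y : ℂ) * f y) +
      (ladder n : ℂ) * ((ladder (n - 1 + 1) : ℂ) * (∫ y, (hermiteFun (n - 1 + 1) y : ℂ) * f y) +
        (ladder (n - 1) : ℂ) * ∫ y, (hermiteFun (n - 1 - 1) y : ℂ) * f y) := by
  have hy : ∀ k, ∫ y : ℝ, (hermiteFun k y : ℂ) * ((y : ℂ) * f y) = _ := fun k =>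
    integral_mul_hermiteFun hf (g := fun y => (y : ℂ) * f y) (Eventually.of_forall fun y => rfl) k
  have hi : ∀ k, Integrable fun y : ℝ => (hermiteFun k y : ℂ) * ((y : ℂ) * f y) := fun k => by
    refine (((integrable_hermiteFun_mul_complex hf (k + 1)).const_mul (ladder (k + 1) : ℂ)).add
      ((integrable_hermiteFun_mul_complex hf (k - 1)).const_mul (ladder k : ℂ))).congr
        (Eventually.of_forall fun y => ?_)
    have := congrArg (fun r : ℝ => (r : ℂ)) (mul_hermiteFun_ladder k y)
    simp only [Complex.ofReal_mul, Complex.ofReal_add] at this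
    simp only [Pi.add_apply]
    linear_combination -f y * this
  have h1 : ∫ y, (hermiteFun n y : ℂ) * g y =
      (ladder (n + 1) : ℂ) * (∫ y : ℝ, (hermiteFun (n + 1) y : ℂ) * ((y : ℂ) * f y)) +
      (ladder n : ℂ) * ∫ y : ℝ, (hermiteFun (n - 1) y : ℂ) * ((y : ℂ) * f y) := by
    rw [← integral_const_mul, ← integral_const_mul, ← integral_add ((hi _).const_mul _)
      ((hi _).const_mul _)]
    refine integral_congr_ae ?_
    filter_upwards [h] with y hy
    have := congrArg (fun r : ℝ => (r : ℂ)) (mul_hermiteFun_ladder n y)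
    simp only [Complex.ofReal_mul, Complex.ofReal_add] at this
    rw [hy]
    linear_combination (y : ℂ) * f y * this
  rw [h1, hy, hy, Nat.add_sub_cancel]

/-- Nothing says that yΨ is square integrable, so the recurrence is applied twice inside the
integral over almost every slice, where Gaussian decay gives integrability. -/
theorem coeff_sq_mul {Ψ G : L2Plane} (h : ∀ᵐ p : ℝ × ℝ, G p = (p.2 : ℂ) ^ 2 * Ψ p) (n : ℕ) :
    hermiteExpansion G n =
      (ladder (n + 1) : ℂ) • ((ladder (n + 2) : ℂ) • hermiteExpansion Ψ (n + 2) +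
        (ladder (n + 1) : ℂ) • hermiteExpansion Ψ n) +
      (ladder n : ℂ) • ((ladder (n - 1 + 1) : ℂ) • hermiteExpansion Ψ (n - 1 + 1) +
        (ladder (n - 1) : ℂ) • hermiteExpansion Ψ (n - 1 - 1)) := by
  set u := hermiteExpansion Ψ
  refine Lp.ext ?_
  filter_upwards [hermiteExpansion_ae G n, hermiteExpansion_ae Ψ (n + 2), hermiteExpansion_ae Ψ n,
    hermiteExpansion_ae Ψ (n - 1 + 1), hermiteExpansion_ae Ψ (n - 1 - 1),
    Measure.ae_ae_of_ae_prod h, memLp_slice (Lp.memLp Ψ),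
    Lp.coeFn_add ((ladder (n + 1) : ℂ) • ((ladder (n + 2) : ℂ) • u (n + 2) +
        (ladder (n + 1) : ℂ) • u n)) ((ladder n : ℂ) • ((ladder (n - 1 + 1) : ℂ) • u (n - 1 + 1) +
        (ladder (n - 1) : ℂ) • u (n - 1 - 1))),
    Lp.coeFn_smul (ladder (n + 1) : ℂ) ((ladder (n + 2) : ℂ) • u (n + 2) +
        (ladder (n + 1) : ℂ) • u n), Lp.coeFn_smul (ladder n : ℂ)
        ((ladder (n - 1 + 1) : ℂ) • u (n - 1 + 1) + (ladder (n - 1) : ℂ) • u (n - 1 - 1)),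
    Lp.coeFn_add ((ladder (n + 2) : ℂ) • u (n + 2)) ((ladder (n + 1) : ℂ) • u n),
    Lp.coeFn_add ((ladder (n - 1 + 1) : ℂ) • u (n - 1 + 1))
      ((ladder (n - 1) : ℂ) • u (n - 1 - 1)), Lp.coeFn_smul (ladder (n + 2) : ℂ) (u (n + 2)),
    Lp.coeFn_smul (ladder (n + 1) : ℂ) (u n), Lp.coeFn_smul (ladder (n - 1 + 1) : ℂ) (u (n - 1 + 1)),
    Lp.coeFn_smul (ladder (n - 1) : ℂ) (u (n - 1 - 1))] with x h1 h2 h3 h4 h5 h6 h7 h8 h9 h10 h11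
      h12 h13 h14 h15 h16
  rw [h1, h8, Pi.add_apply, h9, h10, Pi.smul_apply, Pi.smul_apply, h11, h12, Pi.add_apply,
    Pi.add_apply, h13, h14, h15, h16, Pi.smul_apply, Pi.smul_apply, Pi.smul_apply, Pi.smul_apply,
    h2, h3, h4, h5]
  exact integral_sq_mul_hermiteFun h7 h6 n

theorem coeff_snd_deriv_ladder {Ψ Φ : L2Plane} (h : HasWeakDeriv slitPlane (0, 1) Ψ Φ) (n : ℕ) :
    hermiteExpansion Φ n = (ladder (n + 1) : ℂ) • hermiteExpansion Ψ (n + 1) -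
      (ladder n : ℂ) • hermiteExpansion Ψ (n - 1) := by
  rw [coeff_snd_deriv h, ladder, ladder]
  push_cast
  rfl

/-- With y = a + a* and ∂ = a - a*, the oscillator (-∂² + y²)/2 equals aa* + a*a, whose n-th
diagonal entry is (n+1)/2 + n/2. -/
theorem ladder_combination {M : Type*} [AddCommGroup M] [Module ℂ M] (u : ℕ → M) (n : ℕ) :
    (1 / 2 : ℂ) • (-((ladder (n + 1) : ℂ) • ((ladder (n + 2) : ℂ) • u (n + 2) -
        (ladder (n + 1) : ℂ) • u n) -
      (ladder n : ℂ) • ((ladder (n - 1 + 1) : ℂ) • u (n - 1 + 1) -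
        (ladder (n - 1) : ℂ) • u (n - 1 - 1))) +
      ((ladder (n + 1) : ℂ) • ((ladder (n + 2) : ℂ) • u (n + 2) + (ladder (n + 1) : ℂ) • u n) +
      (ladder n : ℂ) • ((ladder (n - 1 + 1) : ℂ) • u (n - 1 + 1) +
        (ladder (n - 1) : ℂ) • u (n - 1 - 1)))) = ((n : ℂ) + 1 / 2) • u n := by
  have h : (n : ℂ) + 1 / 2 = (ladder (n + 1) : ℂ) ^ 2 + (ladder n : ℂ) ^ 2 := by
    rw [← Complex.ofReal_pow, ← Complex.ofReal_pow, ladder_sq, ladder_sq]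
    push_cast
    ring
  rw [h]
  -- For n = 0 the index n - 1 + 1 is 1 rather than n, but the weight `ladder 0` kills those terms.
  cases n with
  | zero => rw [ladder_zero]; simp only [Complex.ofReal_zero]; module
  | succ k => rw [Nat.add_sub_cancel]; module

end Ladder

/-! ### Boundary values read on Hermite coefficients -/

section Traces

theorem norm_integral_hermiteFun_mul_le {h : ℝ → ℂ} (hh : MemLp h 2) (n : ℕ) :
    ‖∫ y, (hermiteFun n y : ℂ) * h y‖ ≤ (eLpNorm h 2 volume).toReal := by
  have e : ∫ y, (hermiteFun n y : ℂ) * h y = inner ℂ (hermiteLp n) (hh.toLp h) := by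
    rw [inner_hermiteLp]
    refine integral_congr_ae ?_
    filter_upwards [hh.coeFn_toLp] with y hy
    rw [hy]
  rw [e]
  refine (norm_inner_le_norm _ _).trans ?_
  rw [orthonormal_hermiteLp.1 n, one_mul, Lp.norm_toLp]

/-- Limits along the filter avoiding null sets are unique because one-sided neighbourhoods of 0 have
positive measure. -/
theorem neBot_inf_ae {l : Filter ℝ} (hl : ∀ s ∈ l, volume s ≠ 0) :
    (l ⊓ ae (volume : Measure ℝ)).NeBot := by
  rw [inf_neBot_iff]
  intro s hs t ht
  by_contra hne
  rw [not_nonempty_iff_eq_empty] at hne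
  refine hl s hs (measure_mono_null (fun x hx => ?_) (mem_ae_iff.mp ht))
  intro hxt
  exact notMem_empty x (hne ▸ (⟨hx, hxt⟩ : x ∈ s ∩ t))

theorem volume_ne_zero_of_mem_nhdsGT {s : Set ℝ} (hs : s ∈ 𝓝[>] (0 : ℝ)) : volume s ≠ 0 := by
  obtain ⟨ε, hε, h⟩ := mem_nhdsGT_iff_exists_Ioo_subset.mp hs
  intro h0
  have := measure_mono_null h h0
  rw [Real.volume_Ioo, sub_zero, ENNReal.ofReal_eq_zero] at this
  exact absurd hε (not_lt.mpr this)

theorem volume_ne_zero_of_mem_nhdsLT {s : Set ℝ} (hs : s ∈ 𝓝[<] (0 : ℝ)) : volume s ≠ 0 := by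
  obtain ⟨ε, hε, h⟩ := mem_nhdsLT_iff_exists_Ioo_subset.mp hs
  intro h0
  have := measure_mono_null h h0
  rw [Real.volume_Ioo, zero_sub, ENNReal.ofReal_eq_zero, neg_nonpos] at this
  exact absurd hε (not_lt.mpr this)

/-- The slice coefficient has two limits at 0: the L² trace gives the coefficient of g, and the
continuous primitive gives a. -/
theorem HasTrace.coeff {Ψ : L2Plane} {g : ℝ → ℂ} {l : Filter ℝ} (h : HasTrace l Ψ g)
    (hl : ∀ s ∈ l, volume s ≠ 0) (h0 : l ≤ 𝓝 0) {S : Set ℝ} (hS : S ∈ l) {n : ℕ} {v : ℝ → ℂ}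
    (hv : LocallyIntegrable v) {a : ℂ}
    (hu : ∀ᵐ x, x ∈ S → hermiteExpansion Ψ n x = a + ∫ t in (0 : ℝ)..x, v t) :
    ∫ y, (hermiteFun n y : ℂ) * g y = a := by
  have := neBot_inf_ae hl
  have t1 : Tendsto (fun x => sliceCoeff n Ψ x) (l ⊓ ae volume) (𝓝 a) := by
    have h1 : Tendsto (fun x => a + ∫ t in (0 : ℝ)..x, v t) (l ⊓ ae volume) (𝓝 a) := by
      have h2 := (continuous_primitive hv a).tendsto 0
      rw [intervalIntegral.integral_same, add_zero] at h2
      exact h2.mono_left (inf_le_left.trans h0)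
    refine h1.congr' ?_
    have h3 : ∀ᶠ x in l ⊓ ae volume, x ∈ S := mem_inf_of_left hS
    filter_upwards [h3, mem_inf_of_right hu, mem_inf_of_right (hermiteExpansion_ae Ψ n)]
      with x hx hx' hx''
    rw [← hx' hx, hx'']
  have t2 : Tendsto (fun x => sliceCoeff n Ψ x) (l ⊓ ae volume)
      (𝓝 (∫ y, (hermiteFun n y : ℂ) * g y)) := by
    rw [tendsto_iff_norm_sub_tendsto_zero]
    have h1 := (ENNReal.tendsto_toReal ENNReal.zero_ne_top).comp h.2
    rw [ENNReal.toReal_zero] at h1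
    refine squeeze_zero' (Eventually.of_forall fun x => norm_nonneg _) ?_ h1
    filter_upwards [mem_inf_of_right (memLp_slice (Lp.memLp Ψ))] with x hx
    refine le_trans (le_of_eq ?_) (norm_integral_hermiteFun_mul_le (hx.sub h.1) n)
    rw [sliceCoeff, ← integral_sub (integrable_hermiteFun_mul_complex hx n)
      (integrable_hermiteFun_mul_complex h.1 n)]
    simp only [Pi.sub_apply, mul_sub]
  exact tendsto_nhds_unique t2 t1

theorem HasTrace.coeff_right {Ψ u' : L2Plane} {g : ℝ → ℂ} (h : HasTrace (𝓝[>] 0) Ψ g) {n : ℕ}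
    {a b : ℂ} (hu : HalfDeriv (hermiteExpansion Ψ n) (hermiteExpansion u' n) a b) :
    ∫ y, (hermiteFun n y : ℂ) * g y = a :=
  h.coeff (fun _ => volume_ne_zero_of_mem_nhdsGT) nhdsWithin_le_nhds self_mem_nhdsWithin
    (memLp_locallyIntegrable (Lp.memLp _)) hu.1

theorem HasTrace.coeff_left {Ψ u' : L2Plane} {g : ℝ → ℂ} (h : HasTrace (𝓝[<] 0) Ψ g) {n : ℕ}
    {a b : ℂ} (hu : HalfDeriv (hermiteExpansion Ψ n) (hermiteExpansion u' n) a b) :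
    ∫ y, (hermiteFun n y : ℂ) * g y = b :=
  h.coeff (fun _ => volume_ne_zero_of_mem_nhdsLT) nhdsWithin_le_nhds self_mem_nhdsWithin
    (memLp_locallyIntegrable (Lp.memLp _)) hu.2

end Traces

/-! ### From the domain of H_β to the coefficient system -/

section Analysis

/-- The Hamiltonian in terms of Hermite coefficients: `u` are the coefficients of a function in
the domain, `f` the coefficients of its image, `u'`, `u''` the derivatives and `a`, `b`, `d` the
boundary values. -/
structure CoeffPair (β : ℝ) (u f u' u'' : CoeffSpace) (a b d : ℕ → ℂ) : Prop where
  halfDeriv : ∀ n, HalfDeriv (u n) (u' n) (a n) (b n)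
  halfDeriv' : ∀ n, HalfDeriv (u' n) (u'' n) (d n) (d n)
  jump : ∀ n, (β : ℂ) * d n = (ladder (n + 1) : ℂ) * (a (n + 1) - b (n + 1)) +
    (ladder n : ℂ) * (a (n - 1) - b (n - 1))
  eq : ∀ n, f n = -u'' n + ((n : ℂ) + 1 / 2) • u n

/-- Each ingredient is read coefficientwise: weak derivatives become `HalfDeriv`, traces become the
numbers a, b, d, and the oscillator becomes n + 1/2. -/
theorem IsHamiltonianPair.exists_coeffPair {β : ℝ} {Ψ F : L2Plane} (h : IsHamiltonianPair β Ψ F) :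
    ∃ u' u'' a b d, CoeffPair β (hermiteExpansion Ψ) (hermiteExpansion F) u' u'' a b d := by
  obtain ⟨-, fx, fy, fxx, fyy, A, B, D, ⟨m1, m2, m3, m4⟩, ⟨w1, w2, w3, w4⟩, ⟨t1, t2, t3, t4⟩,
    hj, hF⟩ := h
  obtain ⟨Ψx, ex⟩ : ∃ Φ : L2Plane, fx =ᵐ[volume] Φ := ⟨m1.toLp fx, m1.coeFn_toLp.symm⟩
  obtain ⟨Ψy, ey⟩ : ∃ Φ : L2Plane, fy =ᵐ[volume] Φ := ⟨m2.toLp fy, m2.coeFn_toLp.symm⟩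
  obtain ⟨Ψxx, exx⟩ : ∃ Φ : L2Plane, fxx =ᵐ[volume] Φ := ⟨m3.toLp fxx, m3.coeFn_toLp.symm⟩
  obtain ⟨Ψyy, eyy⟩ : ∃ Φ : L2Plane, fyy =ᵐ[volume] Φ := ⟨m4.toLp fyy, m4.coeFn_toLp.symm⟩
  have hcr : ∀ {v : ℝ × ℝ} {f g g' : ℝ × ℝ → ℂ}, g =ᵐ[volume] g' → HasWeakDeriv slitPlane v f g →
      HasWeakDeriv slitPlane v f g' := by
    intro v f g g' e h φ h1 h2 h3
    rw [h φ h1 h2 h3]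
    congr 1
    refine integral_congr_ae ?_
    filter_upwards [e] with p hp
    rw [hp]
  replace w1 := hcr ex w1
  replace w2 := hcr ey w2
  replace w3 := hcr exx (w3.congr_left ex)
  replace w4 := hcr eyy (w4.congr_left ey)
  replace t3 := t3.congr ex
  replace t4 := t4.congr ex
  have hd : ∀ n, ∃ a b, HalfDeriv (hermiteExpansion Ψ n) (hermiteExpansion Ψx n) a b := fun n =>
    (hasWeakDerivLine_coeff w1 n).exists_halfDeriv (Lp.memLp _) (Lp.memLp _)
  have hd' : ∀ n, ∃ a b, HalfDeriv (hermiteExpansion Ψx n) (hermiteExpansion Ψxx n) a b := fun n =>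
    (hasWeakDerivLine_coeff w3 n).exists_halfDeriv (Lp.memLp _) (Lp.memLp _)
  choose a b hab using hd
  choose d d' hdd using hd'
  have ea : ∀ n, ∫ y, (hermiteFun n y : ℂ) * A y = a n := fun n => t1.coeff_right (hab n)
  have eb : ∀ n, ∫ y, (hermiteFun n y : ℂ) * B y = b n := fun n => t2.coeff_left (hab n)
  have ed : ∀ n, ∫ y, (hermiteFun n y : ℂ) * D y = d n := fun n => t3.coeff_right (hdd n)
  have ed' : ∀ n, d' n = d n := fun n => (t4.coeff_left (hdd n)).symm.trans (ed n)
  refine ⟨hermiteExpansion Ψx, hermiteExpansion Ψxx, a, b, d, hab, fun n => ?_, fun n => ?_,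
    fun n => ?_⟩
  · have := hdd n
    rwa [ed'] at this
  · have h1 : ∀ᵐ y : ℝ, (β : ℂ) * D y = (y : ℂ) * (A - B) y := by
      filter_upwards [hj, ae_ne_zero] with y hy h0
      rw [Pi.sub_apply, hy]
      have : (y : ℂ) ≠ 0 := by exact_mod_cast h0
      push_cast
      field_simp
    have h2 := integral_mul_hermiteFun (t1.1.sub t2.1) h1 n
    have h3 : ∀ k, ∫ y, (hermiteFun k y : ℂ) * (A - B) y = a k - b k := fun k => by
      rw [← ea, ← eb, ← integral_sub (integrable_hermiteFun_mul_complex t1.1 k)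
        (integrable_hermiteFun_mul_complex t2.1 k)]
      simp only [Pi.sub_apply, mul_sub]
    rw [h3, h3] at h2
    rw [← h2, ← ed, ← integral_const_mul]
    refine integral_congr_ae (Eventually.of_forall fun y => ?_)
    simp only
    ring
  · let G : L2Plane := (2 : ℂ) • F + (2 : ℂ) • Ψxx + Ψyy
    have hG : ∀ᵐ p : ℝ × ℝ, G p = (p.2 : ℂ) ^ 2 * Ψ p := by
      filter_upwards [hF, exx, eyy, Lp.coeFn_add ((2 : ℂ) • F + (2 : ℂ) • Ψxx) Ψyy,
        Lp.coeFn_add ((2 : ℂ) • F) ((2 : ℂ) • Ψxx), Lp.coeFn_smul (2 : ℂ) F,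
        Lp.coeFn_smul (2 : ℂ) Ψxx] with p h1 h2 h3 h4 h5 h6 h7
      rw [h4, Pi.add_apply, h5, Pi.add_apply, h6, h7, Pi.smul_apply, Pi.smul_apply, h1, ← h2, ← h3]
      simp only [smul_eq_mul]
      ring
    have hF' : F = -Ψxx + (1 / 2 : ℂ) • (-Ψyy + G) := by
      simp only [G]
      module
    have h1 : hermiteExpansion F n = -hermiteExpansion Ψxx n +
        (1 / 2 : ℂ) • (-hermiteExpansion Ψyy n + hermiteExpansion G n) := by
      conv_lhs => rw [hF']
      rw [map_add, map_neg, map_smul, map_add, map_neg]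
      rfl
    rw [h1, coeff_sq_mul hG, coeff_snd_deriv_ladder w4, coeff_snd_deriv_ladder w2,
      coeff_snd_deriv_ladder w2, Nat.add_sub_cancel, ladder_combination]

end Analysis

/-! ### Weighted square-summable sequences and the ladder operators on them -/

section Sequences

theorem memlp_two_iff {E : Type*} [NormedAddCommGroup E] {v : ℕ → E} :
    Memℓp v 2 ↔ Summable fun n => ‖v n‖ ^ 2 := by
  rw [memℓp_gen_iff (by norm_num)]
  simp

theorem summable_sq_norm {E : Type*} [NormedAddCommGroup E] (v : lp (fun _ : ℕ => E) 2) :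
    Summable fun n => ‖v n‖ ^ 2 :=
  memlp_two_iff.mp (lp.memℓp v)

theorem hasSum_sq_norm {E : Type*} [NormedAddCommGroup E] (v : lp (fun _ : ℕ => E) 2) :
    HasSum (fun n => ‖v n‖ ^ 2) (‖v‖ ^ 2) := by
  have := lp.hasSum_norm (p := 2) (by norm_num) v
  simpa using this

variable {E : Type*} [NormedAddCommGroup E] [InnerProductSpace ℂ E]

/-- The annihilation operator on sequences of coefficients. -/
noncomputable def lower (v : ℕ → E) (n : ℕ) : E := (ladder (n + 1) : ℂ) • v (n + 1)

/-- The creation operator on sequences of coefficients. -/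
noncomputable def raise (v : ℕ → E) (n : ℕ) : E := (ladder n : ℂ) • v (n - 1)

theorem norm_ladder_smul_sq (n : ℕ) (x : E) : ‖(ladder n : ℂ) • x‖ ^ 2 = n / 2 * ‖x‖ ^ 2 := by
  rw [norm_smul, mul_pow, Complex.norm_real, Real.norm_eq_abs, sq_abs, ladder_sq]

/-- A ladder weight is √(n/2), so each ladder step costs one power of n + 1/2 in the weight of the
squared norms. -/
theorem summable_lower {v : ℕ → E} {s : ℕ}
    (h : Summable fun n : ℕ => ((n : ℝ) + 1 / 2) ^ (s + 1) * ‖v n‖ ^ 2) :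
    Summable fun n : ℕ => ((n : ℝ) + 1 / 2) ^ s * ‖lower v n‖ ^ 2 := by
  refine Summable.of_nonneg_of_le (fun n => by positivity) (fun n => ?_)
    ((summable_nat_add_iff 1).mpr h)
  rw [lower, norm_ladder_smul_sq, ← mul_assoc]
  refine mul_le_mul_of_nonneg_right ?_ (sq_nonneg _)
  rw [pow_succ]
  push_cast
  have hn := Nat.cast_nonneg (α := ℝ) n
  gcongr ?_ ^ s * ?_
  · linarith
  · linarith

theorem summable_raise {v : ℕ → E} {s : ℕ}
    (h : Summable fun n : ℕ => ((n : ℝ) + 1 / 2) ^ (s + 1) * ‖v n‖ ^ 2) :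
    Summable fun n : ℕ => ((n : ℝ) + 1 / 2) ^ s * ‖raise v n‖ ^ 2 := by
  rw [← summable_nat_add_iff 1]
  -- The factor 3ˢ comes from n + 3/2 ≤ 3(n + 1/2) after the shift of index.
  refine Summable.of_nonneg_of_le (fun n => by positivity) (fun n => ?_) (h.mul_left (3 ^ s))
  rw [raise, norm_ladder_smul_sq, ← mul_assoc, Nat.add_sub_cancel, ← mul_assoc]
  refine mul_le_mul_of_nonneg_right ?_ (sq_nonneg _)
  rw [pow_succ, ← mul_assoc, ← mul_pow]
  push_cast
  have hn := Nat.cast_nonneg (α := ℝ) n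
  gcongr ?_ ^ s * ?_
  · linarith
  · linarith

theorem summable_weight_add {v w : ℕ → E} {s : ℕ}
    (hv : Summable fun n : ℕ => ((n : ℝ) + 1 / 2) ^ s * ‖v n‖ ^ 2)
    (hw : Summable fun n : ℕ => ((n : ℝ) + 1 / 2) ^ s * ‖w n‖ ^ 2) (σ : ℂ) (hσ : ‖σ‖ ≤ 1) :
    Summable fun n : ℕ => ((n : ℝ) + 1 / 2) ^ s * ‖v n + σ • w n‖ ^ 2 := by
  refine Summable.of_nonneg_of_le (fun n => by positivity) (fun n => ?_)
    ((hv.add hw).mul_left 2)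
  have h1 : ‖v n + σ • w n‖ ≤ ‖v n‖ + ‖w n‖ := by
    refine (norm_add_le _ _).trans (add_le_add_right ?_ _)
    rw [norm_smul]
    exact mul_le_of_le_one_left (norm_nonneg _) hσ
  have h2 : ‖v n + σ • w n‖ ^ 2 ≤ 2 * (‖v n‖ ^ 2 + ‖w n‖ ^ 2) := by
    nlinarith [norm_nonneg (v n + σ • w n), sq_nonneg (‖v n‖ - ‖w n‖), norm_nonneg (v n),
      norm_nonneg (w n)]
  calc _ ≤ ((n : ℝ) + 1 / 2) ^ s * (2 * (‖v n‖ ^ 2 + ‖w n‖ ^ 2)) := by gcongr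
    _ = _ := by ring

theorem hasSum_shift_iff {x y : ℕ → ℂ} {z : ℂ} (h0 : y 0 = 0) (h : ∀ n, y (n + 1) = x n) :
    HasSum x z ↔ HasSum y z := by
  have := hasSum_nat_add_iff (f := y) (g := z) 1
  simpa [h0, h] using this

/-- `raise` and `lower` are formally adjoint to each other. -/
theorem hasSum_inner_raise (t : ℕ → E) (u : ℕ → E) (z : ℂ) :
    HasSum (fun n => inner ℂ (raise t n) (u n)) z ↔ HasSum (fun n => inner ℂ (t n) (lower u n)) z := by
  refine (hasSum_shift_iff ?_ fun n => ?_).symm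
  · rw [raise, ladder_zero]
    simp
  · rw [raise, lower, Nat.add_sub_cancel, inner_smul_left, inner_smul_right, Complex.conj_ofReal]

theorem hasSum_inner_lower (t : ℕ → E) (u : ℕ → E) (z : ℂ) :
    HasSum (fun n => inner ℂ (lower t n) (u n)) z ↔ HasSum (fun n => inner ℂ (t n) (raise u n)) z := by
  refine hasSum_shift_iff ?_ fun n => ?_
  · rw [raise, ladder_zero]
    simp
  · rw [raise, lower, Nat.add_sub_cancel, inner_smul_left, inner_smul_right, Complex.conj_ofReal]

end Sequences

/-! ### Recovering multiplication by y from Hermite coefficients -/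

section Multiplication

theorem norm_mul_exp_le (y : ℝ) : ‖(y : ℂ) * ((Real.exp (-(1 / 8) * y ^ 2) : ℝ) : ℂ)‖ ≤ 2 := by
  rw [norm_mul, Complex.norm_real, Complex.norm_real, Real.norm_eq_abs, Real.norm_eq_abs,
    Real.abs_exp, neg_mul, Real.exp_neg, ← div_eq_mul_inv, div_le_iff₀ (Real.exp_pos _)]
  have := Real.add_one_le_exp (1 / 8 * y ^ 2)
  nlinarith [sq_abs y, sq_nonneg (|y| - 2)]

theorem norm_exp_le_one (y : ℝ) : ‖((Real.exp (-(1 / 8) * y ^ 2) : ℝ) : ℂ)‖ ≤ 1 := by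
  rw [Complex.norm_real, Real.norm_eq_abs, Real.abs_exp]
  exact Real.exp_le_one_iff.mpr (by nlinarith [sq_nonneg y])

theorem memLp_bounded_mul {α : Type*} [MeasurableSpace α] {μ : Measure α} {f c : α → ℂ}
    (hf : MemLp f 2 μ) (hc : AEStronglyMeasurable c μ) {C : ℝ} (h : ∀ x, ‖c x‖ ≤ C) :
    MemLp (fun x => c x * f x) 2 μ := by
  refine (hf.norm.const_mul C).mono' (hc.mul hf.1) (Eventually.of_forall fun x => ?_)
  rw [norm_mul]
  exact mul_le_mul_of_nonneg_right (h x) (norm_nonneg _)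

/-- It is not known beforehand that y f is square integrable; the weight exp(-y²/8) bounds y and
brings the difference within reach of the weighted completeness statement. -/
theorem memLp_weighted_sub_mul {f g : ℝ → ℂ} (hf : MemLp f 2) (hg : MemLp g 2) :
    MemLp (fun y : ℝ => ((Real.exp (-(1 / 8) * y ^ 2) : ℝ) : ℂ) * (g y - (y : ℂ) * f y)) 2 := by
  have h1 := memLp_bounded_mul hg (c := fun y : ℝ => ((Real.exp (-(1 / 8) * y ^ 2) : ℝ) : ℂ))
    (by fun_prop : Continuous _).aestronglyMeasurable norm_exp_le_one
  have h2 := memLp_bounded_mul hf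
    (c := fun y : ℝ => (y : ℂ) * ((Real.exp (-(1 / 8) * y ^ 2) : ℝ) : ℂ))
    (by fun_prop : Continuous _).aestronglyMeasurable norm_mul_exp_le
  refine (h1.sub h2).congr_norm ?_ (Eventually.of_forall fun y => ?_)
  · exact (by fun_prop : Continuous fun y : ℝ =>
      ((Real.exp (-(1 / 8) * y ^ 2) : ℝ) : ℂ)).aestronglyMeasurable.mul
        (hg.1.sub ((by fun_prop : Continuous fun y : ℝ => (y : ℂ)).aestronglyMeasurable.mul hf.1))
  · congr 1
    simp only [Pi.sub_apply]
    ring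

/-- Multiplication by `y` is determined by Hermite coefficients. -/
theorem ae_eq_mul_of_hermite {f g : ℝ → ℂ} (hf : MemLp f 2) (hg : MemLp g 2)
    (h : ∀ n, ∫ y, (hermiteFun n y : ℂ) * g y =
      (ladder (n + 1) : ℂ) * (∫ y, (hermiteFun (n + 1) y : ℂ) * f y) +
      (ladder n : ℂ) * ∫ y, (hermiteFun (n - 1) y : ℂ) * f y) :
    ∀ᵐ y : ℝ, g y = (y : ℂ) * f y := by
  have h1 := ae_eq_zero_of_hermite_of_weighted (f := fun y => g y - (y : ℂ) * f y)
    (hg.1.sub ((by fun_prop : Continuous fun y : ℝ => (y : ℂ)).aestronglyMeasurable.mul hf.1))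
    (memLp_weighted_sub_mul hf hg) fun n => by
      have hi : Integrable fun y : ℝ => (hermiteFun n y : ℂ) * ((y : ℂ) * f y) := by
        refine (((integrable_hermiteFun_mul_complex hf (n + 1)).const_mul
          (ladder (n + 1) : ℂ)).add ((integrable_hermiteFun_mul_complex hf (n - 1)).const_mul
            (ladder n : ℂ))).congr (Eventually.of_forall fun y => ?_)
        have := congrArg (fun r : ℝ => (r : ℂ)) (mul_hermiteFun_ladder n y)
        simp only [Complex.ofReal_mul, Complex.ofReal_add] at this
        simp only [Pi.add_apply]
        linear_combination -f y * this
      simp only [mul_sub]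
      rw [integral_sub (integrable_hermiteFun_mul_complex hg n) hi, h n,
        integral_mul_hermiteFun hf (Eventually.of_forall fun y => rfl) n, sub_self]
  filter_upwards [h1] with y hy
  exact sub_eq_zero.mp hy

/-- The one-variable statement applies on almost every slice, for all n at once. -/
theorem ae_eq_snd_mul {Ψ Φ : L2Plane} (h : ∀ n, hermiteExpansion Φ n =
    lower (hermiteExpansion Ψ) n + raise (hermiteExpansion Ψ) n) :
    ∀ᵐ p : ℝ × ℝ, Φ p = (p.2 : ℂ) * Ψ p := by
  have hs : ∀ᵐ x : ℝ, ∀ᵐ y : ℝ, Φ (x, y) = (y : ℂ) * Ψ (x, y) := by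
    have hc : ∀ᵐ x, ∀ n, sliceCoeff n Φ x = (ladder (n + 1) : ℂ) * sliceCoeff (n + 1) Ψ x +
        (ladder n : ℂ) * sliceCoeff (n - 1) Ψ x := by
      refine ae_all_iff.mpr fun n => ?_
      filter_upwards [hermiteExpansion_ae Φ n, hermiteExpansion_ae Ψ (n + 1),
        hermiteExpansion_ae Ψ (n - 1), Lp.coeFn_add (lower (hermiteExpansion Ψ) n)
          (raise (hermiteExpansion Ψ) n), Lp.coeFn_smul (ladder (n + 1) : ℂ)
          (hermiteExpansion Ψ (n + 1)), Lp.coeFn_smul (ladder n : ℂ) (hermiteExpansion Ψ (n - 1))]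
        with x h1 h2 h3 h4 h5 h6
      rw [← h1, ← h2, ← h3, h n, h4, Pi.add_apply, lower, raise, h5, h6]
      rfl
    filter_upwards [hc, memLp_slice (Lp.memLp Ψ), memLp_slice (Lp.memLp Φ)] with x h1 h2 h3
    exact ae_eq_mul_of_hermite h2 h3 h1
  -- The weight makes the difference square integrable on the plane, so its vanishing on almost
  -- every slice implies vanishing almost everywhere.
  have hm : MemLp (fun p : ℝ × ℝ => ((Real.exp (-(1 / 8) * p.2 ^ 2) : ℝ) : ℂ) *
      (Φ p - (p.2 : ℂ) * Ψ p)) 2 := by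
    have h1 := memLp_bounded_mul (Lp.memLp Φ)
      (c := fun p : ℝ × ℝ => ((Real.exp (-(1 / 8) * p.2 ^ 2) : ℝ) : ℂ))
      (by fun_prop : Continuous _).aestronglyMeasurable (fun p => norm_exp_le_one p.2)
    have h2 := memLp_bounded_mul (Lp.memLp Ψ)
      (c := fun p : ℝ × ℝ => (p.2 : ℂ) * ((Real.exp (-(1 / 8) * p.2 ^ 2) : ℝ) : ℂ))
      (by fun_prop : Continuous _).aestronglyMeasurable (fun p => norm_mul_exp_le p.2)
    refine (h1.sub h2).congr_norm ?_ (Eventually.of_forall fun p => ?_)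
    · exact (by fun_prop : Continuous fun p : ℝ × ℝ =>
        ((Real.exp (-(1 / 8) * p.2 ^ 2) : ℝ) : ℂ)).aestronglyMeasurable.mul
          ((Lp.memLp Φ).1.sub ((by fun_prop : Continuous fun p : ℝ × ℝ =>
            (p.2 : ℂ)).aestronglyMeasurable.mul (Lp.memLp Ψ).1))
    · congr 1
      simp only [Pi.sub_apply]
      ring
  have h0 := eq_zero_of_sliceCoeff hm fun n => by
    filter_upwards [hs] with x hx
    refine integral_eq_zero_of_ae ?_
    filter_upwards [hx] with y hy
    rw [hy]
    simp
  filter_upwards [h0] with p hp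
  have := (mul_eq_zero.mp hp).resolve_left (by
    exact Complex.ofReal_ne_zero.mpr (Real.exp_pos _).ne')
  exact sub_eq_zero.mp this

end Multiplication

/-! ### Weak derivatives on the slit plane built from coefficients -/

section PlaneTest

theorem memLp_planeTest {φ : ℝ × ℝ → ℝ} (h : Continuous φ) (hc : HasCompactSupport φ) :
    MemLp (fun p => (φ p : ℂ)) 2 :=
  (h.memLp_of_hasCompactSupport hc).ofReal

/-- A test function as an element of `L²(ℝ²)`. -/
noncomputable def planeTest {φ : ℝ × ℝ → ℝ} (h : Continuous φ) (hc : HasCompactSupport φ) :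
    L2Plane :=
  (memLp_planeTest h hc).toLp _

theorem coeFn_planeTest {φ : ℝ × ℝ → ℝ} (h : Continuous φ) (hc : HasCompactSupport φ) :
    planeTest h hc =ᵐ[volume] fun p => (φ p : ℂ) := MemLp.coeFn_toLp _

theorem inner_planeTest {φ : ℝ × ℝ → ℝ} (h : Continuous φ) (hc : HasCompactSupport φ)
    (Ψ : L2Plane) : inner ℂ (planeTest h hc) Ψ = ∫ p, φ p • Ψ p := by
  rw [inner_L2Plane]
  refine integral_congr_ae ?_
  filter_upwards [coeFn_planeTest h hc] with p hp
  rw [hp, Complex.conj_ofReal, Complex.real_smul]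

theorem hasWeakDeriv_planeTest (Ω : Set (ℝ × ℝ)) (v : ℝ × ℝ) {φ : ℝ × ℝ → ℝ} (h : ContDiff ℝ ∞ φ)
    (hc : HasCompactSupport φ) : HasWeakDeriv Ω v (planeTest h.continuous hc)
      (planeTest (continuous_fderiv_test h v) (hasCompactSupport_fderiv_test hc v)) := by
  intro ψ h1 h2 _
  have e1 : ∫ p, (fderiv ℝ ψ p v) • planeTest h.continuous hc p =
      ∫ p, ((φ p * fderiv ℝ ψ p v : ℝ) : ℂ) := by
    refine integral_congr_ae ?_
    filter_upwards [coeFn_planeTest h.continuous hc] with p hp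
    rw [hp, Complex.real_smul, Complex.ofReal_mul, mul_comm]
  have e2 : ∫ p, ψ p • planeTest (continuous_fderiv_test h v)
      (hasCompactSupport_fderiv_test hc v) p = ∫ p, ((fderiv ℝ φ p v * ψ p : ℝ) : ℂ) := by
    refine integral_congr_ae ?_
    filter_upwards [coeFn_planeTest (continuous_fderiv_test h v)
      (hasCompactSupport_fderiv_test hc v)] with p hp
    rw [hp, Complex.real_smul, Complex.ofReal_mul, mul_comm]
  rw [e1, e2, integral_complex_ofReal, integral_complex_ofReal, ← Complex.ofReal_neg]
  congr 1
  refine integral_mul_fderiv_eq_neg_fderiv_mul_of_integrable ?_ ?_ ?_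
    (fun p _ => h.differentiable (by simp) p) (fun p _ => h1.differentiable (by simp) p)
  · exact ((continuous_fderiv_test h v).mul h1.continuous).integrable_of_hasCompactSupport
      h2.mul_left
  · exact (h.continuous.mul (continuous_fderiv_test h1 v)).integrable_of_hasCompactSupport
      hc.mul_right
  · exact (h.continuous.mul h1.continuous).integrable_of_hasCompactSupport hc.mul_right

theorem hasTrace_planeTest {φ : ℝ × ℝ → ℝ} (h : Continuous φ) (hc : HasCompactSupport φ)
    (hs : tsupport φ ⊆ slitPlane) {l : Filter ℝ} (hl : l ≤ 𝓝 0) :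
    HasTrace l (planeTest h hc) (0 : ℝ → ℂ) := by
  refine HasTrace.congr (coeFn_planeTest h hc).symm ⟨MemLp.zero, ?_⟩
  refine tendsto_const_nhds.congr' ?_
  have hK : IsClosed (Prod.fst '' tsupport φ) := (hc.isCompact.image continuous_fst).isClosed
  have h0 : (0 : ℝ) ∈ (Prod.fst '' tsupport φ)ᶜ := by
    rintro ⟨p, hp, hp0⟩
    exact hs hp hp0
  have h1 : ∀ᶠ x in l, x ∈ (Prod.fst '' tsupport φ)ᶜ := hl (hK.isOpen_compl.mem_nhds h0)
  filter_upwards [mem_inf_of_left h1] with x hx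
  have h2 : (fun y => (φ (x, y) : ℂ) - (0 : ℝ → ℂ) y) = 0 := by
    ext y
    have : φ (x, y) = 0 := image_eq_zero_of_notMem_tsupport fun hm => hx ⟨_, hm, rfl⟩
    simp [this]
  rw [h2]
  exact eLpNorm_zero.symm

/-- A test function supported off x = 0 has zero traces, so Green's formula has no boundary terms
even if u jumps. -/
theorem inner_coeff_planeTest {u v : L2Line} {a b : ℂ} (h : HalfDeriv u v a b) {φ : ℝ × ℝ → ℝ}
    (h1 : ContDiff ℝ ∞ φ) (h2 : HasCompactSupport φ) (h3 : tsupport φ ⊆ slitPlane) (n : ℕ) :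
    inner ℂ (hermiteExpansion (planeTest (continuous_fderiv_test h1 (1, 0))
      (hasCompactSupport_fderiv_test h2 (1, 0))) n) u =
      -inner ℂ (hermiteExpansion (planeTest h1.continuous h2) n) v := by
  obtain ⟨r, s, hrs⟩ := (hasWeakDerivLine_coeff
    (hasWeakDeriv_planeTest slitPlane (1, 0) h1 h2) n).exists_halfDeriv (Lp.memLp _) (Lp.memLp _)
  have hr := (hasTrace_planeTest h1.continuous h2 h3 nhdsWithin_le_nhds).coeff_right hrs
  have hs := (hasTrace_planeTest h1.continuous h2 h3 nhdsWithin_le_nhds).coeff_left hrs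
  simp only [Pi.zero_apply, mul_zero, integral_zero] at hr hs
  have h4 := hrs.green h
  rw [← hr, ← hs, map_zero, zero_mul, zero_mul, sub_zero] at h4
  exact eq_neg_of_add_eq_zero_left h4

theorem integral_test_eq_inner {φ : ℝ × ℝ → ℝ} (h1 : Continuous φ) (h2 : HasCompactSupport φ)
    (Ψ : L2Plane) : ∫ p, φ p • Ψ p =
      inner ℂ (hermiteExpansion (planeTest h1 h2)) (hermiteExpansion Ψ) := by
  rw [hermiteExpansion.inner_map_map, inner_planeTest]

theorem hasWeakDeriv_fst_of_coeff {Ψ Φ : L2Plane} {a b : ℕ → ℂ}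
    (h : ∀ n, HalfDeriv (hermiteExpansion Ψ n) (hermiteExpansion Φ n) (a n) (b n)) :
    HasWeakDeriv slitPlane (1, 0) Ψ Φ := by
  intro φ h1 h2 h3
  rw [integral_test_eq_inner (continuous_fderiv_test h1 _) (hasCompactSupport_fderiv_test h2 _),
    integral_test_eq_inner h1.continuous h2]
  have t1 := lp.hasSum_inner (𝕜 := ℂ) (hermiteExpansion (planeTest (continuous_fderiv_test h1 (1, 0))
    (hasCompactSupport_fderiv_test h2 (1, 0)))) (hermiteExpansion Ψ)
  have t2 := (lp.hasSum_inner (𝕜 := ℂ) (hermiteExpansion (planeTest h1.continuous h2))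
    (hermiteExpansion Φ)).neg
  simp only [inner_coeff_planeTest (h _) h1 h2 h3] at t1
  exact t1.unique t2

/-- The coefficients of the y-derivative of a test function are ladder combinations of its own, and
the ladders are moved over by adjointness. Square summability of both ladder images separately makes
the two series converge. -/
theorem hasWeakDeriv_snd_of_coeff {Ψ Φ : L2Plane} {ur ul : CoeffSpace}
    (hr : ∀ n, ur n = raise (hermiteExpansion Ψ) n) (hl : ∀ n, ul n = lower (hermiteExpansion Ψ) n)
    (h : hermiteExpansion Φ = ul - ur) : HasWeakDeriv slitPlane (0, 1) Ψ Φ := by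
  intro φ h1 h2 h3
  rw [integral_test_eq_inner (continuous_fderiv_test h1 _) (hasCompactSupport_fderiv_test h2 _),
    integral_test_eq_inner h1.continuous h2, h, inner_sub_right]
  set t := hermiteExpansion (planeTest h1.continuous h2)
  have t1 := lp.hasSum_inner (𝕜 := ℂ) (hermiteExpansion (planeTest (continuous_fderiv_test h1 (0, 1))
    (hasCompactSupport_fderiv_test h2 (0, 1)))) (hermiteExpansion Ψ)
  have t2 := lp.hasSum_inner (𝕜 := ℂ) t ul
  have t3 := lp.hasSum_inner (𝕜 := ℂ) t ur
  simp only [hl] at t2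
  simp only [hr] at t3
  have t4 := ((hasSum_inner_lower t (hermiteExpansion Ψ) _).mpr t3).sub
    ((hasSum_inner_raise t (hermiteExpansion Ψ) _).mpr t2)
  simp only [coeff_snd_deriv_ladder (hasWeakDeriv_planeTest slitPlane (0, 1) h1 h2),
    inner_sub_left] at t1
  rw [neg_sub]
  exact t1.unique t4

end PlaneTest

/-! ### Traces built from coefficients -/

section TraceSynthesis

theorem norm_primitive_sq_le (v : L2Line) (x : ℝ) :
    ‖∫ t in (0 : ℝ)..x, v t‖ ^ 2 ≤ |x| * ‖v‖ ^ 2 := by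
  have hv : volume (uIoc 0 x) ≠ ⊤ := by
    rw [Real.volume_uIoc]
    exact ENNReal.ofReal_ne_top
  have h1 : ‖∫ t in (0 : ℝ)..x, v t‖ ≤ ‖indicatorConstLp 2 measurableSet_uIoc hv (1 : ℂ)‖ * ‖v‖ := by
    rw [intervalIntegral.norm_intervalIntegral_eq,
      ← L2.inner_indicatorConstLp_one (𝕜 := ℂ) measurableSet_uIoc hv v]
    exact norm_inner_le_norm _ _
  have h2 : ‖indicatorConstLp 2 (measurableSet_uIoc (a := 0) (b := x)) hv (1 : ℂ)‖ ^ 2 = |x| := by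
    rw [norm_indicatorConstLp (by norm_num) (by norm_num), norm_one, one_mul, measureReal_def,
      Real.volume_uIoc, sub_zero, ENNReal.toReal_ofReal (abs_nonneg x), ENNReal.toReal_ofNat,
      ← Real.sqrt_eq_rpow, Real.sq_sqrt (abs_nonneg x)]
  calc _ ≤ (‖indicatorConstLp 2 measurableSet_uIoc hv (1 : ℂ)‖ * ‖v‖) ^ 2 := by gcongr
    _ = _ := by rw [mul_pow, h2]

/-- By Cauchy–Schwarz each coefficient moves by at most √|x| times the norm of its derivative.
Parseval sums this to ‖Ψ(x,·) - A‖² ≤ |x| ‖V‖². -/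
theorem hasTrace_of_coeff {Ψ V : L2Plane} {a : ℕ → ℂ} {A : L2Line}
    (hA : ∀ n, inner ℂ (hermiteLp n) A = a n) {l : Filter ℝ} (h0 : l ≤ 𝓝 0) {S : Set ℝ}
    (hS : S ∈ l) (hu : ∀ n, ∀ᵐ x, x ∈ S →
      hermiteExpansion Ψ n x = a n + ∫ t in (0 : ℝ)..x, hermiteExpansion V n t) :
    HasTrace l Ψ A := by
  refine ⟨Lp.memLp A, ?_⟩
  have hb : ∀ᵐ x, x ∈ S → eLpNorm (fun y => Ψ (x, y) - A y) 2 volume ≤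
      ENNReal.ofReal (Real.sqrt (|x| * ‖hermiteExpansion V‖ ^ 2)) := by
    filter_upwards [ae_all_iff.mpr hu, ae_all_iff.mpr (hermiteExpansion_ae Ψ),
      memLp_slice (Lp.memLp Ψ)] with x h1 h2 h3 hx
    have hm : MemLp (fun y => Ψ (x, y) - A y) 2 := h3.sub (Lp.memLp A)
    have h4 : ∀ n, inner ℂ (hermiteLp n) (hm.toLp _) =
        ∫ t in (0 : ℝ)..x, hermiteExpansion V n t := by
      intro n
      have h5 : inner ℂ (hermiteLp n) (hm.toLp _) = sliceCoeff n Ψ x - a n := by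
        rw [inner_hermiteLp, ← hA, inner_hermiteLp, sliceCoeff,
          ← integral_sub (integrable_hermiteFun_mul_complex h3 n)
            (integrable_hermiteFun_mul_complex (Lp.memLp A) n)]
        refine integral_congr_ae ?_
        filter_upwards [hm.coeFn_toLp] with y hy
        rw [hy, mul_sub]
      rw [h5, ← h2, h1 n hx, add_sub_cancel_left]
    have h6 : ‖hm.toLp _‖ ^ 2 ≤ |x| * ‖hermiteExpansion V‖ ^ 2 := by
      refine hasSum_le (fun n => ?_) (hasSum_norm_inner_hermiteLp (hm.toLp _))
        ((hasSum_sq_norm (hermiteExpansion V)).mul_left |x|)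
      rw [h4]
      exact norm_primitive_sq_le _ x
    have h7 := Real.le_sqrt_of_sq_le h6
    rw [Lp.norm_toLp] at h7
    exact (ENNReal.le_ofReal_iff_toReal_le hm.2.ne (Real.sqrt_nonneg _)).mpr h7
  have ht : Tendsto (fun x : ℝ => ENNReal.ofReal (Real.sqrt (|x| * ‖hermiteExpansion V‖ ^ 2)))
      (l ⊓ ae volume) (𝓝 0) := by
    have hc : Continuous fun x : ℝ =>
        ENNReal.ofReal (Real.sqrt (|x| * ‖hermiteExpansion V‖ ^ 2)) := by
      exact ENNReal.continuous_ofReal.comp (Real.continuous_sqrt.comp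
        (continuous_abs.mul continuous_const))
    have := hc.tendsto 0
    simp only [abs_zero, zero_mul, Real.sqrt_zero, ENNReal.ofReal_zero] at this
    exact this.mono_left (inf_le_left.trans h0)
  refine tendsto_of_tendsto_of_tendsto_of_le_of_le' tendsto_const_nhds ht
    (Eventually.of_forall fun _ => bot_le) ?_
  filter_upwards [mem_inf_of_right hb, mem_inf_of_left hS] with x h1 h2 using h1 h2

theorem exists_hermite_coeff {a : ℕ → ℂ} (h : Summable fun n => ‖a n‖ ^ 2) :
    ∃ A : L2Line, ∀ n, inner ℂ (hermiteLp n) A = a n := by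
  refine ⟨hermiteBasis.repr.symm ⟨a, memlp_two_iff.mpr h⟩, fun n => ?_⟩
  rw [← hermiteBasis_apply, ← HilbertBasis.repr_apply_apply, LinearIsometryEquiv.apply_symm_apply]

end TraceSynthesis

/-! ### Sobolev regularity from the two partial derivatives -/

section SobolevSynthesis

theorem HasWeakDeriv.direction {Ω : Set (ℝ × ℝ)} {f fx fy : ℝ × ℝ → ℂ}
    (hf : MemLp f 2 (volume.restrict Ω)) (hx : MemLp fx 2 (volume.restrict Ω))
    (hy : MemLp fy 2 (volume.restrict Ω)) (h : HasWeakDeriv Ω (1, 0) f fx)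
    (h' : HasWeakDeriv Ω (0, 1) f fy) (v : ℝ × ℝ) :
    HasWeakDeriv Ω v f ((v.1 : ℂ) • fx + (v.2 : ℂ) • fy) := by
  intro φ h1 h2 h3
  have t : ∀ w, tsupport (fun p => fderiv ℝ φ p w) ⊆ Ω := fun w =>
    (tsupport_fderiv_test (φ := φ) w).trans h3
  have i1 := integrable_test_smul hf (continuous_fderiv_test h1 (1, 0))
    (hasCompactSupport_fderiv_test h2 (1, 0)) (t _)
  have i2 := integrable_test_smul hf (continuous_fderiv_test h1 (0, 1))
    (hasCompactSupport_fderiv_test h2 (0, 1)) (t _)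
  have j1 := integrable_test_smul hx h1.continuous h2 h3
  have j2 := integrable_test_smul hy h1.continuous h2 h3
  have e1 : ∀ p, (fderiv ℝ φ p v) • f p = (v.1 : ℂ) * ((fderiv ℝ φ p (1, 0)) • f p) +
      (v.2 : ℂ) * ((fderiv ℝ φ p (0, 1)) • f p) := by
    intro p
    have hv : v = v.1 • ((1 : ℝ), (0 : ℝ)) + v.2 • ((0 : ℝ), (1 : ℝ)) := by
      ext <;> simp
    have h4 : fderiv ℝ φ p v = v.1 * fderiv ℝ φ p (1, 0) + v.2 * fderiv ℝ φ p (0, 1) := by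
      conv_lhs => rw [hv, map_add, map_smul, map_smul]
      rfl
    simp only [h4, Complex.real_smul]
    push_cast
    ring
  have e2 : ∀ p, φ p • ((v.1 : ℂ) • fx + (v.2 : ℂ) • fy) p =
      (v.1 : ℂ) * (φ p • fx p) + (v.2 : ℂ) * (φ p • fy p) := by
    intro p
    simp only [Pi.add_apply, Pi.smul_apply, Complex.real_smul, smul_eq_mul]
    ring
  simp only [e1, e2]
  rw [integral_add (i1.const_mul _) (i2.const_mul _), integral_add (j1.const_mul _)
    (j2.const_mul _), integral_const_mul, integral_const_mul, integral_const_mul,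
    integral_const_mul, h φ h1 h2 h3, h' φ h1 h2 h3]
  ring

theorem MemSobolev.succ_of_partial {Ω : Set (ℝ × ℝ)} {k : ℕ} {f fx fy : ℝ × ℝ → ℂ}
    (hf : MemLp f 2 (volume.restrict Ω)) (hx : MemSobolev Ω k fx) (hy : MemSobolev Ω k fy)
    (h : HasWeakDeriv Ω (1, 0) f fx) (h' : HasWeakDeriv Ω (0, 1) f fy) :
    MemSobolev Ω (k + 1) f :=
  ⟨hf, fun v => ⟨_, h.direction hf hx.memLp hy.memLp h' v,
    (hx.const_smul _).add (hy.const_smul _)⟩⟩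

end SobolevSynthesis

/-! ### From the coefficient system back to the domain of H_β -/

section Synthesis

theorem exists_raise_lower (v : CoeffSpace)
    (h : Summable fun n : ℕ => ((n : ℝ) + 1 / 2) ^ 1 * ‖v n‖ ^ 2) :
    ∃ vr vl : CoeffSpace, (∀ n, vr n = raise v n) ∧ ∀ n, vl n = lower v n := by
  have h1 := summable_raise (s := 0) h
  have h2 := summable_lower (s := 0) h
  simp only [pow_zero, one_mul] at h1 h2
  exact ⟨⟨raise v, memlp_two_iff.mpr h1⟩, ⟨lower v, memlp_two_iff.mpr h2⟩, fun _ => rfl,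
    fun _ => rfl⟩

theorem HalfDeriv.sub_Lp {u u' v v' : L2Line} {a b c d : ℂ} (h : HalfDeriv u u' a b)
    (h' : HalfDeriv v v' c d) :
    HalfDeriv (u - v : L2Line) (u' - v' : L2Line) (a - c) (b - d) := by
  have := h.add_Lp (h'.smul_Lp (-1))
  simpa only [neg_one_smul, neg_one_mul, ← sub_eq_add_neg] using this

variable {β : ℝ} {u f u' u'' : CoeffSpace} {a b d : ℕ → ℂ}

/-- The equation gives (n + 1/2) uₙ = fₙ + uₙ'', with a square-summable right side. -/
theorem CoeffPair.summable_sq (h : CoeffPair β u f u' u'' a b d) :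
    Summable fun n : ℕ => ((n : ℝ) + 1 / 2) ^ 2 * ‖u n‖ ^ 2 := by
  refine (summable_sq_norm (f + u'')).congr fun n => ?_
  rw [lp.coeFn_add, Pi.add_apply, h.eq, neg_add_eq_sub, sub_add_cancel, norm_smul, mul_pow]
  congr 2
  rw [show (n : ℂ) + 1 / 2 = (((n : ℝ) + 1 / 2 : ℝ) : ℂ) by push_cast; rfl, Complex.norm_real,
    Real.norm_of_nonneg (by positivity)]

theorem CoeffPair.summable (h : CoeffPair β u f u' u'' a b d) :
    Summable fun n : ℕ => ((n : ℝ) + 1 / 2) ^ 1 * ‖u n‖ ^ 2 := by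
  refine Summable.of_nonneg_of_le (fun n => by positivity) (fun n => ?_) (h.summable_sq.mul_left 2)
  have hn := Nat.cast_nonneg (α := ℝ) n
  rw [← mul_assoc]
  gcongr
  nlinarith

/-- Landau's inequality with ζ² = n + 1/2, uniform in n, bounds the weighted u' by u'' and (n + 1/2)
u. This is what controls the mixed derivative. -/
theorem CoeffPair.summable_deriv (h : CoeffPair β u f u' u'' a b d) :
    Summable fun n : ℕ => ((n : ℝ) + 1 / 2) ^ 1 * ‖u' n‖ ^ 2 := by
  refine Summable.of_nonneg_of_le (fun n => by positivity) (fun n => ?_)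
    ((summable_sq_norm u'').add h.summable_sq)
  have := (h.halfDeriv n).landau (h.halfDeriv' n) (Real.sqrt ((n : ℝ) + 1 / 2))
  rw [Real.sq_sqrt (by positivity), mul_pow] at this
  rwa [pow_one]

/-- The trace inequality with ζ = 1, applied to u and to u'. -/
theorem CoeffPair.summable_trace (h : CoeffPair β u f u' u'' a b d) :
    (Summable fun n => ‖a n‖ ^ 2) ∧ (Summable fun n => ‖b n‖ ^ 2) ∧
      Summable fun n => ‖d n‖ ^ 2 := by
  have h1 : ∀ n, ‖a n‖ ^ 2 + ‖b n‖ ^ 2 ≤ ‖u' n‖ ^ 2 + ‖u n‖ ^ 2 := fun n => by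
    have := (h.halfDeriv n).trace_le zero_le_one
    simpa using this
  have h2 : ∀ n, ‖d n‖ ^ 2 + ‖d n‖ ^ 2 ≤ ‖u'' n‖ ^ 2 + ‖u' n‖ ^ 2 := fun n => by
    have := (h.halfDeriv' n).trace_le zero_le_one
    simpa using this
  have s1 := (summable_sq_norm u').add (summable_sq_norm u)
  have s2 := (summable_sq_norm u'').add (summable_sq_norm u')
  refine ⟨Summable.of_nonneg_of_le (fun n => sq_nonneg _) (fun n => ?_) s1,
    Summable.of_nonneg_of_le (fun n => sq_nonneg _) (fun n => ?_) s1,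
    Summable.of_nonneg_of_le (fun n => sq_nonneg _) (fun n => ?_) s2⟩
  · linarith [h1 n, sq_nonneg ‖b n‖]
  · linarith [h1 n, sq_nonneg ‖a n‖]
  · linarith [h2 n, sq_nonneg ‖d n‖]

/-- All derivatives up to order two have ladder expressions in the coefficients, and the summability
statements place them in ℓ². Hence the system alone forces H² regularity, square-integrable y²Ψ and
the traces. -/
theorem CoeffPair.isHamiltonianPair (h : CoeffPair β u f u' u'' a b d) :
    IsHamiltonianPair β (hermiteExpansion.symm u) (hermiteExpansion.symm f) := by
  obtain ⟨ur, ul, hur, hul⟩ := exists_raise_lower u h.summable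
  obtain ⟨vr, vl, hvr, hvl⟩ := exists_raise_lower u' h.summable_deriv
  have s1 := summable_lower (s := 1) h.summable_sq
  have s2 := summable_raise (s := 1) h.summable_sq
  obtain ⟨yr, yl, hyr, hyl⟩ := exists_raise_lower (ul - ur) (by
    refine (summable_weight_add s1 s2 (-1) (by simp)).congr fun n => ?_
    rw [lp.coeFn_sub, Pi.sub_apply, hul, hur, neg_one_smul, sub_eq_add_neg])
  obtain ⟨mr, ml, hmr, hml⟩ := exists_raise_lower (ul + ur) (by
    refine (summable_weight_add s1 s2 1 (by simp)).congr fun n => ?_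
    rw [lp.coeFn_add, Pi.add_apply, hul, hur, one_smul])
  set Ψ := hermiteExpansion.symm u with hΨ
  set Ψx := hermiteExpansion.symm u' with hΨx
  set Ψxx := hermiteExpansion.symm u'' with hΨxx
  set Ψy := hermiteExpansion.symm (ul - ur) with hΨy
  set Ψyy := hermiteExpansion.symm (yl - yr) with hΨyy
  set Ψxy := hermiteExpansion.symm (vl - vr) with hΨxy
  set M := hermiteExpansion.symm (ul + ur) with hM
  set G := hermiteExpansion.symm (ml + mr) with hG
  have eΨ : hermiteExpansion Ψ = u := hermiteExpansion.apply_symm_apply u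
  have eΨx : hermiteExpansion Ψx = u' := hermiteExpansion.apply_symm_apply u'
  have eΨxx : hermiteExpansion Ψxx = u'' := hermiteExpansion.apply_symm_apply u''
  have eΨy : hermiteExpansion Ψy = ul - ur := hermiteExpansion.apply_symm_apply _
  have eΨyy : hermiteExpansion Ψyy = yl - yr := hermiteExpansion.apply_symm_apply _
  have eΨxy : hermiteExpansion Ψxy = vl - vr := hermiteExpansion.apply_symm_apply _
  have eM : hermiteExpansion M = ul + ur := hermiteExpansion.apply_symm_apply _
  have eG : hermiteExpansion G = ml + mr := hermiteExpansion.apply_symm_apply _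
  have w1 : HasWeakDeriv slitPlane (1, 0) Ψ Ψx :=
    hasWeakDeriv_fst_of_coeff (by rw [eΨ, eΨx]; exact h.halfDeriv)
  have w2 : HasWeakDeriv slitPlane (0, 1) Ψ Ψy :=
    hasWeakDeriv_snd_of_coeff (ur := ur) (ul := ul) (by rw [eΨ]; exact hur)
      (by rw [eΨ]; exact hul) eΨy
  have w3 : HasWeakDeriv slitPlane (1, 0) Ψx Ψxx :=
    hasWeakDeriv_fst_of_coeff (by rw [eΨx, eΨxx]; exact h.halfDeriv')
  have w4 : HasWeakDeriv slitPlane (0, 1) Ψy Ψyy :=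
    hasWeakDeriv_snd_of_coeff (ur := yr) (ul := yl) (by rw [eΨy]; exact hyr)
      (by rw [eΨy]; exact hyl) eΨyy
  have w5 : HasWeakDeriv slitPlane (0, 1) Ψx Ψxy :=
    hasWeakDeriv_snd_of_coeff (ur := vr) (ul := vl) (by rw [eΨx]; exact hvr)
      (by rw [eΨx]; exact hvl) eΨxy
  -- The mixed derivative is reached in both orders, as H² demands of Ψx and of Ψy.
  have w6 : HasWeakDeriv slitPlane (1, 0) Ψy Ψxy := by
    refine hasWeakDeriv_fst_of_coeff (a := fun n => (ladder (n + 1) : ℂ) * a (n + 1) -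
      (ladder n : ℂ) * a (n - 1)) (b := fun n => (ladder (n + 1) : ℂ) * b (n + 1) -
      (ladder n : ℂ) * b (n - 1)) fun n => ?_
    rw [eΨy, eΨxy, lp.coeFn_sub, lp.coeFn_sub, Pi.sub_apply, Pi.sub_apply, hul, hur, hvl, hvr]
    exact ((h.halfDeriv (n + 1)).smul_Lp _).sub_Lp ((h.halfDeriv (n - 1)).smul_Lp _)
  obtain ⟨sa, sb, sd⟩ := h.summable_trace
  obtain ⟨A, hA⟩ := exists_hermite_coeff sa
  obtain ⟨B, hB⟩ := exists_hermite_coeff sb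
  obtain ⟨D, hD⟩ := exists_hermite_coeff sd
  have hm : ∀ Φ : L2Plane, MemLp Φ 2 (volume.restrict slitPlane) := fun Φ => (Lp.memLp Φ).restrict _
  have hm0 : ∀ Φ : L2Plane, MemSobolev slitPlane 0 Φ := hm
  refine ⟨MemSobolev.succ_of_partial (hm Ψ)
    (MemSobolev.succ_of_partial (hm Ψx) (hm0 Ψxx) (hm0 Ψxy) w3 w5)
    (MemSobolev.succ_of_partial (hm Ψy) (hm0 Ψxy) (hm0 Ψyy) w6 w4) w1 w2,
    Ψx, Ψy, Ψxx, Ψyy, A, B, D, ⟨Lp.memLp _, Lp.memLp _, Lp.memLp _, Lp.memLp _⟩,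
    ⟨w1, w2, w3, w4⟩, ⟨?_, ?_, ?_, ?_⟩, ?_, ?_⟩
  · exact hasTrace_of_coeff (V := Ψx) hA nhdsWithin_le_nhds self_mem_nhdsWithin
      (by rw [eΨ, eΨx]; exact fun n => (h.halfDeriv n).1)
  · exact hasTrace_of_coeff (V := Ψx) hB nhdsWithin_le_nhds self_mem_nhdsWithin
      (by rw [eΨ, eΨx]; exact fun n => (h.halfDeriv n).2)
  · exact hasTrace_of_coeff (V := Ψxx) hD nhdsWithin_le_nhds self_mem_nhdsWithin
      (by rw [eΨxx, eΨx]; exact fun n => (h.halfDeriv' n).1)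
  · exact hasTrace_of_coeff (V := Ψxx) hD nhdsWithin_le_nhds self_mem_nhdsWithin
      (by rw [eΨxx, eΨx]; exact fun n => (h.halfDeriv' n).2)
  · have hj := ae_eq_mul_of_hermite (f := (A - B : L2Line)) (g := ((β : ℂ) • D : L2Line))
      (Lp.memLp _) (Lp.memLp _) (fun n => by
        simp only [← inner_hermiteLp, inner_sub_right, inner_smul_right, hA, hB, hD]
        exact h.jump n)
    filter_upwards [hj, ae_ne_zero, Lp.coeFn_sub A B, Lp.coeFn_smul (β : ℂ) D] with y h1 h2 h3 h4
    rw [h3, h4, Pi.sub_apply, Pi.smul_apply, smul_eq_mul] at h1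
    have : (y : ℂ) ≠ 0 := by exact_mod_cast h2
    push_cast
    field_simp
    linear_combination -h1
  · have hF : hermiteExpansion.symm f = -Ψxx + (1 / 2 : ℂ) • (-Ψyy + G) := by
      apply hermiteExpansion.injective
      rw [hermiteExpansion.apply_symm_apply, map_add, map_neg, map_smul, map_add, map_neg, eΨxx,
        eΨyy, eG]
      refine lp.ext (funext fun n => ?_)
      rw [h.eq n, ← ladder_combination (fun n => u n) n]
      simp only [lp.coeFn_add, lp.coeFn_neg, lp.coeFn_smul, lp.coeFn_sub, Pi.add_apply,
        Pi.neg_apply, Pi.smul_apply, Pi.sub_apply, hyl, hyr, hml, hmr, lower, raise, hul, hur,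
        Nat.add_sub_cancel]
    have hM' := ae_eq_snd_mul (Ψ := Ψ) (Φ := M) fun n => by
      rw [eM, eΨ, lp.coeFn_add, Pi.add_apply, hul, hur]
    have hG' := ae_eq_snd_mul (Ψ := M) (Φ := G) fun n => by
      rw [eG, eM, lp.coeFn_add, Pi.add_apply, hml, hmr]
    rw [hF]
    filter_upwards [hM', hG', Lp.coeFn_add (-Ψxx) ((1 / 2 : ℂ) • (-Ψyy + G)), Lp.coeFn_neg Ψxx,
      Lp.coeFn_smul (1 / 2 : ℂ) (-Ψyy + G), Lp.coeFn_add (-Ψyy) G, Lp.coeFn_neg Ψyy]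
      with p h1 h2 h3 h4 h5 h6 h7
    rw [h3, Pi.add_apply, h4, h5, Pi.smul_apply, h6, Pi.add_apply, h7, h2, h1, Pi.neg_apply,
      Pi.neg_apply, smul_eq_mul]
    ring

/-- The graph of `H_β` in terms of Hermite coefficients. -/
theorem mem_graph_hamiltonian_iff (β : ℝ) (Ψ F : L2Plane) : (Ψ, F) ∈ (hamiltonian β).graph ↔
    ∃ u' u'' a b d, CoeffPair β (hermiteExpansion Ψ) (hermiteExpansion F) u' u'' a b d := by
  rw [mem_graph_hamiltonian]
  refine ⟨fun h => h.exists_coeffPair, ?_⟩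
  rintro ⟨u', u'', a, b, d, h⟩
  simpa only [hermiteExpansion.symm_apply_apply] using h.isHamiltonianPair

end Synthesis

/-! ### Weighted shifts on ℓ² and a Neumann series -/

section Band

/-- The Hilbert space `ℓ²(ℕ₀)`. -/
abbrev L2Seq : Type := lp (fun _ : ℕ => ℂ) 2

theorem norm_le_of_hasSum_sq {E : Type*} [NormedAddCommGroup E] {v : lp (fun _ : ℕ => E) 2} {C : ℝ}
    (hC : 0 ≤ C) (h : ∀ s : ℝ, HasSum (fun n => ‖v n‖ ^ 2) s → s ≤ C ^ 2) : ‖v‖ ≤ C :=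
  le_of_sq_le_sq (h _ (hasSum_sq_norm v)) hC

theorem exists_shift_down {p : ℕ → ℂ} {C : ℝ} (hp : ∀ n, ‖p n‖ ≤ C) :
    ∃ T : L2Seq →L[ℂ] L2Seq, (∀ g n, T g n = p n * g (n + 1)) ∧ ‖T‖ ≤ C := by
  have hC : 0 ≤ C := (norm_nonneg _).trans (hp 0)
  have hle : ∀ (g : L2Seq) n, ‖p n * g (n + 1)‖ ^ 2 ≤ C ^ 2 * ‖g (n + 1)‖ ^ 2 := fun g n => by
    rw [norm_mul, mul_pow]
    gcongr
    exact hp n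
  have hs : ∀ g : L2Seq, Summable fun n => C ^ 2 * ‖g (n + 1)‖ ^ 2 := fun g =>
    ((summable_nat_add_iff 1).mpr (summable_sq_norm g)).mul_left _
  have hm : ∀ g : L2Seq, Memℓp (fun n => p n * g (n + 1)) 2 := fun g =>
    memlp_two_iff.mpr (Summable.of_nonneg_of_le (fun n => sq_nonneg _) (hle g) (hs g))
  let L : L2Seq →ₗ[ℂ] L2Seq :=
    { toFun := fun g => ⟨fun n => p n * g (n + 1), hm g⟩
      map_add' := fun g h => lp.ext (funext fun n => mul_add _ _ _)
      map_smul' := fun c g => lp.ext (funext fun n => mul_left_comm _ _ _) }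
  refine ⟨L.mkContinuous C fun g => ?_, fun g n => rfl, L.mkContinuous_norm_le hC _⟩
  refine norm_le_of_hasSum_sq (by positivity) fun s hsum => ?_
  refine (hasSum_le (hle g) hsum (hs g).hasSum).trans ?_
  rw [tsum_mul_left, mul_pow, ← (hasSum_sq_norm g).tsum_eq]
  refine mul_le_mul_of_nonneg_left ?_ (sq_nonneg _)
  rw [(summable_sq_norm g).tsum_eq_zero_add]
  linarith [sq_nonneg ‖g 0‖]

theorem exists_shift_up {q : ℕ → ℂ} {C : ℝ} (hq : ∀ n, ‖q n‖ ≤ C) (h0 : q 0 = 0) :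
    ∃ T : L2Seq →L[ℂ] L2Seq, (∀ g n, T g n = q n * g (n - 1)) ∧ ‖T‖ ≤ C := by
  have hC : 0 ≤ C := (norm_nonneg _).trans (hq 0)
  have hle : ∀ (g : L2Seq) n, ‖q (n + 1) * g n‖ ^ 2 ≤ C ^ 2 * ‖g n‖ ^ 2 := fun g n => by
    rw [norm_mul, mul_pow]
    gcongr
    exact hq _
  have hs : ∀ g : L2Seq, Summable fun n => C ^ 2 * ‖g n‖ ^ 2 := fun g =>
    (summable_sq_norm g).mul_left _
  have hs' : ∀ g : L2Seq, Summable fun n => ‖q n * g (n - 1)‖ ^ 2 := fun g => by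
    rw [← summable_nat_add_iff 1]
    exact Summable.of_nonneg_of_le (fun n => sq_nonneg _) (hle g) (hs g)
  have hm : ∀ g : L2Seq, Memℓp (fun n => q n * g (n - 1)) 2 := fun g => memlp_two_iff.mpr (hs' g)
  let L : L2Seq →ₗ[ℂ] L2Seq :=
    { toFun := fun g => ⟨fun n => q n * g (n - 1), hm g⟩
      map_add' := fun g h => lp.ext (funext fun n => mul_add _ _ _)
      map_smul' := fun c g => lp.ext (funext fun n => mul_left_comm _ _ _) }
  refine ⟨L.mkContinuous C fun g => ?_, fun g n => rfl, L.mkContinuous_norm_le hC _⟩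
  refine norm_le_of_hasSum_sq (by positivity) fun s hsum => ?_
  have h1 : s = ∑' n, ‖q (n + 1) * g n‖ ^ 2 := by
    rw [← hsum.tsum_eq]
    refine ((hs' g).tsum_eq_zero_add).trans ?_
    rw [h0, zero_mul, norm_zero, zero_pow two_ne_zero, zero_add]
    rfl
  rw [h1, mul_pow, ← (hasSum_sq_norm g).tsum_eq, ← tsum_mul_left]
  exact Summable.tsum_le_tsum (hle g)
    (Summable.of_nonneg_of_le (fun n => sq_nonneg _) (hle g) (hs g)) (hs g)

/-- Neumann series for 1 + c⁻¹T. -/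
theorem exists_add_smul_eq {H : Type*} [NormedAddCommGroup H] [NormedSpace ℂ H] [CompleteSpace H]
    (T : H →L[ℂ] H) {c : ℂ} (h : ‖T‖ < ‖c‖) (r : H) : ∃ g, T g + c • g = r := by
  have hc : c ≠ 0 := norm_pos_iff.mp ((norm_nonneg T).trans_lt h)
  have ht : ‖-(c⁻¹ • T)‖ < 1 := by
    rw [norm_neg, norm_smul, norm_inv, inv_mul_lt_iff₀ (norm_pos_iff.mpr hc), mul_one]
    exact h
  have hu := (Units.oneSub _ ht).mul_inv
  rw [Units.val_oneSub] at hu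
  refine ⟨(((Units.oneSub _ ht)⁻¹ : (H →L[ℂ] H)ˣ) : H →L[ℂ] H) (c⁻¹ • r), ?_⟩
  have h2 := congrArg (fun S : H →L[ℂ] H => c • S (c⁻¹ • r)) hu
  simp only [sub_neg_eq_add] at h2
  set g := (((Units.oneSub _ ht)⁻¹ : (H →L[ℂ] H)ˣ) : H →L[ℂ] H) (c⁻¹ • r)
  have h3 : c • (g + c⁻¹ • T g) = c • (c⁻¹ • r) := h2
  rw [smul_add, smul_smul, smul_smul, mul_inv_cancel₀ hc, one_smul, one_smul] at h3
  rw [← h3, add_comm]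

end Band

/-! ### J(ε) as a bounded symmetric operator -/

section Jacobi

theorem jacobiEntry_succ (ε : ℝ) (n : ℕ) : jacobiEntry ε (n + 1) =
    Real.sqrt (n + 1) / (2 * ((n : ℝ) + 1 + ε) ^ (1 / 4 : ℝ) * ((n : ℝ) + ε) ^ (1 / 4 : ℝ)) := by
  rw [jacobiEntry, Real.sqrt_eq_rpow]
  push_cast
  rw [add_sub_cancel_right]

theorem rpow_quarter_pow (x : ℝ) (hx : 0 ≤ x) : (x ^ (1 / 4 : ℝ)) ^ 4 = x := by
  rw [← Real.rpow_natCast, ← Real.rpow_mul hx]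
  norm_num

variable {ε : ℝ}

theorem jacobiEntry_succ_nonneg (hε : 0 < ε) (n : ℕ) : 0 ≤ jacobiEntry ε (n + 1) := by
  rw [jacobiEntry_succ]
  positivity

theorem jacobiEntry_succ_le (hε : 0 < ε) (n : ℕ) : jacobiEntry ε (n + 1) ≤ 1 + ε⁻¹ := by
  rw [jacobiEntry_succ]
  set x := ((n : ℝ) + ε) ^ (1 / 4 : ℝ) with hx
  set y := ((n : ℝ) + 1 + ε) ^ (1 / 4 : ℝ) with hy
  have hx0 : 0 < x := Real.rpow_pos_of_pos (by positivity) _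
  have hxy : x ≤ y := Real.rpow_le_rpow (by positivity) (by linarith) (by norm_num)
  have hx4 : x ^ 4 = n + ε := rpow_quarter_pow _ (by positivity)
  rw [div_le_iff₀ (by positivity)]
  have hxx : x * x ≤ y * x := mul_le_mul_of_nonneg_right hxy hx0.le
  have hi : 0 < ε⁻¹ := inv_pos.mpr hε
  have hn : (0 : ℝ) ≤ n := Nat.cast_nonneg n
  have h1 : (n : ℝ) + 1 ≤ (1 + ε⁻¹) * (n + ε) := by
    have : ε⁻¹ * ε = 1 := inv_mul_cancel₀ hε.ne'
    nlinarith [mul_nonneg hi.le hn]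
  calc Real.sqrt (n + 1) ≤ Real.sqrt ((1 + ε⁻¹) * (n + ε)) := Real.sqrt_le_sqrt h1
    _ ≤ (1 + ε⁻¹) * (x * x) := by
        refine Real.sqrt_le_iff.mpr ⟨by positivity, ?_⟩
        rw [← hx4]
        nlinarith [pow_pos hx0 4, mul_pos hi (pow_pos hx0 4)]
    _ ≤ (1 + ε⁻¹) * (2 * y * x) := by
        refine mul_le_mul_of_nonneg_left ?_ (by positivity)
        nlinarith [mul_pos hx0 hx0]

/-- J(ε) is the sum of two bounded weighted shifts which are adjoint to each other. -/
theorem exists_jacobi (hε : 0 < ε) : ∃ T : L2Seq →L[ℂ] L2Seq,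
    (∀ g n, T g n = jacobiAction ε g n) ∧ ∀ x y, inner ℂ (T x) y = inner ℂ x (T y) := by
  have hb : ∀ n : ℕ, ‖(jacobiEntry ε (n + 1) : ℂ)‖ ≤ 1 + ε⁻¹ := fun n => by
    rw [Complex.norm_real, Real.norm_of_nonneg (jacobiEntry_succ_nonneg hε n)]
    exact jacobiEntry_succ_le hε n
  have hb' : ∀ n : ℕ, ‖if n = 0 then 0 else (jacobiEntry ε n : ℂ)‖ ≤ 1 + ε⁻¹ := fun n => by
    cases n with
    | zero => simpa using (norm_nonneg _).trans (hb 0)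
    | succ n => simpa using hb n
  obtain ⟨S, hS, -⟩ := exists_shift_down hb
  obtain ⟨R, hR, -⟩ := exists_shift_up hb' (if_pos rfl)
  have hSR : ∀ x y, inner ℂ (R x) y = inner ℂ x (S y) := by
    intro x y
    refine (lp.hasSum_inner (R x) y).unique
      ((hasSum_shift_iff ?_ fun n => ?_).mp (lp.hasSum_inner x (S y)))
    · rw [hR, if_pos rfl, zero_mul, inner_zero_left]
    · rw [hR, hS, if_neg n.succ_ne_zero, Nat.add_sub_cancel, RCLike.inner_apply,
        RCLike.inner_apply, map_mul]
      have h := Complex.conj_ofReal (jacobiEntry ε (n + 1))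
      linear_combination (y (n + 1) * starRingEnd ℂ (x n)) * h
  refine ⟨S + R, fun g n => ?_, fun x y => ?_⟩
  · cases n with
    | zero => simp [jacobiAction, hS, hR]
    | succ n =>
      simp only [jacobiAction, lp.coeFn_add, Pi.add_apply, add_apply, hS, hR, if_neg n.succ_ne_zero,
        Nat.add_sub_cancel]
      exact add_comm _ _
  · rw [add_apply, add_apply, inner_add_left, inner_add_right, hSR, ← inner_conj_symm (S x), ← hSR,
      inner_conj_symm, add_comm]

/-- `J(ε)` as a bounded operator. -/
noncomputable def jacobiCLM (hε : 0 < ε) : L2Seq →L[ℂ] L2Seq := (exists_jacobi hε).choose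

theorem jacobiCLM_apply (hε : 0 < ε) (g : L2Seq) (n : ℕ) :
    jacobiCLM hε g n = jacobiAction ε g n := (exists_jacobi hε).choose_spec.1 g n

theorem jacobiCLM_symm (hε : 0 < ε) (x y : L2Seq) :
    inner ℂ (jacobiCLM hε x) y = inner ℂ x (jacobiCLM hε y) := (exists_jacobi hε).choose_spec.2 x y

theorem mem_domain_jacobiOperator (hε : 0 < ε) (g : L2Seq) : g ∈ (jacobiOperator ε).domain := by
  have h : Memℓp (jacobiAction ε g) 2 := by
    have := lp.memℓp (jacobiCLM hε g)
    rwa [show ((jacobiCLM hε g : L2Seq) : ∀ _ : ℕ, ℂ) = jacobiAction ε g from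
      funext (jacobiCLM_apply hε g)] at this
  exact h

theorem jacobiOperator_apply (hε : 0 < ε) (g : (jacobiOperator ε).domain) :
    jacobiOperator ε g = jacobiCLM hε g :=
  lp.ext (funext fun n => (jacobiCLM_apply hε g n).symm)

theorem jacobiOperator_symm (hε : 0 < ε) (x y : (jacobiOperator ε).domain) :
    inner ℂ (jacobiOperator ε x) (y : L2Seq) = inner ℂ (x : L2Seq) (jacobiOperator ε y) := by
  rw [jacobiOperator_apply hε, jacobiOperator_apply hε, jacobiCLM_symm]

/-- The point z = -(‖J‖ + 1) lies below the spectrum, where a Neumann series inverts J - z. -/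
theorem jacobiOperator_surjective (hε : 0 < ε) (f : L2Seq) : ∃ x : (jacobiOperator ε).domain,
    jacobiOperator ε x - ((-(‖jacobiCLM hε‖ + 1) : ℝ) : ℂ) • (x : L2Seq) = f := by
  obtain ⟨g, hg⟩ := exists_add_smul_eq (jacobiCLM hε) (c := ((‖jacobiCLM hε‖ + 1 : ℝ) : ℂ)) (by
    rw [Complex.norm_real, Real.norm_of_nonneg (by positivity)]
    linarith) f
  refine ⟨⟨g, mem_domain_jacobiOperator hε g⟩, ?_⟩
  rw [jacobiOperator_apply hε, Complex.ofReal_neg, neg_smul, sub_neg_eq_add]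
  exact hg

end Jacobi

/-! ### The quadratic form of H_β at level 1/2 - ε -/

section Form

/-- `(n + ε)^(1/4)`. -/
noncomputable def quarter (ε : ℝ) (n : ℕ) : ℝ := ((n : ℝ) + ε) ^ (1 / 4 : ℝ)

variable {ε : ℝ}

theorem quarter_pos (hε : 0 < ε) (n : ℕ) : 0 < quarter ε n :=
  Real.rpow_pos_of_pos (by positivity) _

theorem quarter_pow (hε : 0 < ε) (n : ℕ) : quarter ε n ^ 4 = n + ε :=
  rpow_quarter_pow _ (by positivity)

/-- J(ε) is, up to √2, the ladder matrix of y conjugated by (n+ε)^(-1/4). This is where the Jacobi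
matrix enters. -/
theorem jacobiEntry_quarter (hε : 0 < ε) (n : ℕ) :
    Real.sqrt 2 * jacobiEntry ε (n + 1) = ladder (n + 1) / (quarter ε n * quarter ε (n + 1)) := by
  have h1 := quarter_pos hε n
  have h2 := quarter_pos hε (n + 1)
  have h3 : Real.sqrt 2 * Real.sqrt 2 = 2 := Real.mul_self_sqrt zero_le_two
  rw [jacobiEntry_succ, ladder, Real.sqrt_div (by positivity)]
  have h4 : ((n : ℝ) + 1 + ε) ^ (1 / 4 : ℝ) = quarter ε (n + 1) := by
    rw [quarter]
    push_cast
    rfl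
  rw [h4, ← quarter]
  push_cast
  field_simp
  linear_combination h3

/-- The relation between the boundary values in terms of the Jacobi matrix. -/
theorem jump_iff (hε : 0 < ε) {β : ℂ} {j d D : ℕ → ℂ} (hD : ∀ n, D n = (quarter ε n : ℂ) * j n / 2)
    (n : ℕ) : β * d n = (ladder (n + 1) : ℂ) * j (n + 1) + (ladder n : ℂ) * j (n - 1) ↔
      β * d n = 2 * ((Real.sqrt 2 : ℝ) : ℂ) * (quarter ε n : ℂ) * jacobiAction ε D n := by
  have hj : ∀ m, j m = 2 * D m / (quarter ε m : ℂ) := fun m => by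
    have : (quarter ε m : ℂ) ≠ 0 := Complex.ofReal_ne_zero.mpr (quarter_pos hε m).ne'
    rw [hD]
    field_simp
  have he : ∀ m, ((Real.sqrt 2 : ℝ) : ℂ) * (jacobiEntry ε (m + 1) : ℂ) =
      (ladder (m + 1) : ℂ) / ((quarter ε m : ℂ) * (quarter ε (m + 1) : ℂ)) := fun m => by
    exact_mod_cast congrArg (fun r : ℝ => (r : ℂ)) (jacobiEntry_quarter hε m)
  have hq : ∀ m, (quarter ε m : ℂ) ≠ 0 := fun m =>
    Complex.ofReal_ne_zero.mpr (quarter_pos hε m).ne'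
  have key : (ladder (n + 1) : ℂ) * j (n + 1) + (ladder n : ℂ) * j (n - 1) =
      2 * ((Real.sqrt 2 : ℝ) : ℂ) * (quarter ε n : ℂ) * jacobiAction ε D n := by
    cases n with
    | zero =>
      have e1 := he 0
      have q0 := hq 0
      have q1 := hq 1
      rw [zero_add] at e1
      rw [jacobiAction, ladder_zero, hj 1]
      rw [eq_div_iff (mul_ne_zero q0 q1)] at e1
      push_cast
      rw [← e1]
      field_simp
      ring
    | succ m =>
      have e1 := he (m + 1)
      have e2 := he m
      have q0 := hq m
      have q1 := hq (m + 1)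
      have q2 := hq (m + 1 + 1)
      rw [eq_div_iff (mul_ne_zero q1 q2)] at e1
      rw [eq_div_iff (mul_ne_zero q0 q1)] at e2
      rw [Nat.add_sub_cancel, hj, hj, jacobiAction, ← e1, ← e2]
      field_simp
      ring
  rw [key]

/-- `u'`, `(n + ε)^(1/2) u` and the vector of jumps of a function in the domain of `H_β`, which
determine the quadratic form of `H_β`. -/
structure FormData (β ε : ℝ) (u f X Z : CoeffSpace) (D : L2Seq) : Prop where
  exists_coeffPair : ∃ u'' a b d, CoeffPair β u f X u'' a b d ∧
    ∀ n, D n = (quarter ε n : ℂ) * (a n - b n) / 2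
  eq : ∀ n, Z n = ((quarter ε n ^ 2 : ℝ) : ℂ) • u n

/-- The trace inequality with ζ = (n+ε)^(1/2), combined with |a - b|² ≤ 2(|a|² + |b|²). -/
theorem norm_jump_sq_le {u v z : L2Line} {a b D : ℂ} (n : ℕ) (h : HalfDeriv u v a b)
    (hz : z = ((quarter ε n ^ 2 : ℝ) : ℂ) • u) (hD : D = (quarter ε n : ℂ) * (a - b) / 2) :
    2 * ‖D‖ ^ 2 ≤ ‖v‖ ^ 2 + ‖z‖ ^ 2 := by
  have h1 := h.trace_le (sq_nonneg (quarter ε n))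
  have h2 : ‖z‖ ^ 2 = (quarter ε n ^ 2) ^ 2 * ‖u‖ ^ 2 := by
    rw [hz, norm_smul, mul_pow, Complex.norm_real, Real.norm_eq_abs, sq_abs]
  have h3 : ‖D‖ ^ 2 = quarter ε n ^ 2 * ‖a - b‖ ^ 2 / 4 := by
    rw [hD, norm_div, norm_mul, Complex.norm_real, Real.norm_eq_abs, div_pow, mul_pow, sq_abs]
    norm_num
  have h4 : ‖a - b‖ ^ 2 ≤ 2 * (‖a‖ ^ 2 + ‖b‖ ^ 2) := by
    have := norm_sub_le a b
    nlinarith [sq_nonneg (‖a‖ - ‖b‖), norm_nonneg (a - b), norm_nonneg a, norm_nonneg b]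
  rw [h2, h3]
  nlinarith [mul_le_mul_of_nonneg_left h4 (sq_nonneg (quarter ε n))]

/-- Weighted summability of u handles Z, since n + ε ≤ (1 + 2ε)(n + 1/2); the trace inequality then
handles D. -/
theorem CoeffPair.exists_formData (hε : 0 < ε) {β : ℝ} {u f u' u'' : CoeffSpace} {a b d : ℕ → ℂ}
    (h : CoeffPair β u f u' u'' a b d) : ∃ Z D, FormData β ε u f u' Z D := by
  have hZ : Summable fun n => ‖((quarter ε n ^ 2 : ℝ) : ℂ) • u n‖ ^ 2 := by
    refine Summable.of_nonneg_of_le (fun n => sq_nonneg _) (fun n => ?_)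
      (h.summable.mul_left (1 + 2 * ε))
    rw [norm_smul, mul_pow, Complex.norm_real, Real.norm_eq_abs, sq_abs, ← pow_mul,
      quarter_pow hε, ← mul_assoc]
    refine mul_le_mul_of_nonneg_right ?_ (sq_nonneg _)
    have hn := Nat.cast_nonneg (α := ℝ) n
    nlinarith [mul_nonneg hε.le hn]
  let Z : CoeffSpace := ⟨fun n => ((quarter ε n ^ 2 : ℝ) : ℂ) • u n, memlp_two_iff.mpr hZ⟩
  have hD : Summable fun n => ‖(quarter ε n : ℂ) * (a n - b n) / 2‖ ^ 2 := by
    refine Summable.of_nonneg_of_le (fun n => sq_nonneg _) (fun n => ?_)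
      ((summable_sq_norm u').add (summable_sq_norm Z))
    have := norm_jump_sq_le n (h.halfDeriv n) (z := Z n) rfl rfl
    linarith [sq_nonneg ‖(quarter ε n : ℂ) * (a n - b n) / 2‖]
  exact ⟨Z, ⟨_, memlp_two_iff.mpr hD⟩, ⟨u'', a, b, d, h, fun n => rfl⟩, fun n => rfl⟩

/-- The sesquilinear form of `H_β` below its essential spectrum. -/
theorem FormData.inner_eq (hε : 0 < ε) {β : ℝ} (hβ : β ≠ 0) {u f X Z v g Y W : CoeffSpace}
    {D E : L2Seq} (h : FormData β ε u f X Z D) (k : FormData β ε v g Y W E) :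
    inner ℂ u (g - ((1 / 2 - ε : ℝ) : ℂ) • v) = inner ℂ X Y + inner ℂ Z W +
      ((4 * Real.sqrt 2 / β : ℝ) : ℂ) * inner ℂ D (jacobiCLM hε E) := by
  obtain ⟨⟨u'', a, b, d, hu, hD⟩, hZ⟩ := h
  obtain ⟨⟨v'', a', b', d', hv, hE⟩, hW⟩ := k
  refine (lp.hasSum_inner (𝕜 := ℂ) u (g - ((1 / 2 - ε : ℝ) : ℂ) • v)).unique ?_
  have hs := ((lp.hasSum_inner (𝕜 := ℂ) X Y).add (lp.hasSum_inner (𝕜 := ℂ) Z W)).add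
    ((lp.hasSum_inner (𝕜 := ℂ) D (jacobiCLM hε E)).mul_left ((4 * Real.sqrt 2 / β : ℝ) : ℂ))
  convert hs using 1
  funext n
  symm
  have hg := (hu.halfDeriv n).green (hv.halfDeriv' n)
  have hj := (jump_iff hε hE n).mp (hv.jump n)
  have hD' : starRingEnd ℂ (D n) =
      (quarter ε n : ℂ) * (starRingEnd ℂ (a n) - starRingEnd ℂ (b n)) / 2 := by
    rw [hD, map_div₀, map_mul, map_sub, Complex.conj_ofReal, map_ofNat]
  have hq : ((quarter ε n : ℝ) : ℂ) ^ 4 = (n : ℂ) + ε := by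
    exact_mod_cast congrArg (fun r : ℝ => (r : ℂ)) (quarter_pow hε n)
  have e1 : inner ℂ (Z n) (W n) = ((n : ℂ) + ε) * inner ℂ (u n) (v n) := by
    rw [hZ, hW, inner_smul_left, inner_smul_right, Complex.conj_ofReal, ← hq]
    push_cast
    ring
  have e2 : (g - ((1 / 2 - ε : ℝ) : ℂ) • v : CoeffSpace) n =
      -v'' n + ((n : ℂ) + ε) • v n := by
    have : (g - ((1 / 2 - ε : ℝ) : ℂ) • v : CoeffSpace) n =
      g n - ((1 / 2 - ε : ℝ) : ℂ) • v n := rfl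
    rw [this, hv.eq, add_sub_assoc, ← sub_smul]
    congr 2
    push_cast
    ring
  have e3 : inner ℂ (D n) (jacobiCLM hε E n) = starRingEnd ℂ (D n) * jacobiAction ε E n := by
    rw [RCLike.inner_apply, jacobiCLM_apply, mul_comm]
  have hβ' : (β : ℂ) ≠ 0 := Complex.ofReal_ne_zero.mpr hβ
  rw [e1, e2, e3, hD', inner_add_right, inner_neg_right, inner_smul_right]
  -- Green's formula leaves the boundary term (ā - b̄) d'. Expressing d' through J E and a - b
  -- through D gives the coefficient 4√2/β.
  have e4 : d' n = 2 * ((Real.sqrt 2 : ℝ) : ℂ) * (quarter ε n : ℂ) * jacobiAction ε E n / β := by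
    rw [eq_div_iff hβ', mul_comm, hj]
  rw [e4] at hg
  push_cast
  linear_combination hg

end Form

/-! ### Odd and even exponentials -/

section Exponentials

variable {k : ℝ} (hk : 0 < k)

/-- `sign x * exp (-k|x|)`. -/
noncomputable def oddExp : L2Line := expLp hk 1 0 (-1) 0

/-- `exp (-k|x|)`. -/
noncomputable def evenExp : L2Line := expLp hk 1 0 1 0

theorem halfDeriv_oddExp : HalfDeriv (oddExp hk) (-(k : ℂ) • evenExp hk : L2Line) 1 (-1) := by
  have e : expLp hk (0 - k * 1) (-k * 0) (0 + k * (-1)) (k * 0) = (-k : ℂ) • evenExp hk := by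
    rw [evenExp, smul_expLp]
    congr 1 <;> ring
  rw [← e]
  exact halfDeriv_expLp hk 1 0 (-1) 0

theorem halfDeriv_evenExp : HalfDeriv (evenExp hk) (-(k : ℂ) • oddExp hk : L2Line) 1 1 := by
  have e : expLp hk (0 - k * 1) (-k * 0) (0 + k * 1) (k * 0) = (-k : ℂ) • oddExp hk := by
    rw [oddExp, smul_expLp]
    congr 1 <;> ring
  rw [← e]
  exact halfDeriv_expLp hk 1 0 1 0

theorem norm_sq_oddExp : ‖oddExp hk‖ ^ 2 = k⁻¹ := (norm_expLp_one hk).1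

theorem norm_sq_evenExp : ‖evenExp hk‖ ^ 2 = k⁻¹ := (norm_expLp_one hk).2

end Exponentials

/-! ### Symmetry of H_β -/

section Symmetric

theorem exists_formData_of_mem_domain {ε β : ℝ} (hε : 0 < ε) (x : (hamiltonian β).domain) :
    ∃ X Z D, FormData β ε (hermiteExpansion x) (hermiteExpansion (hamiltonian β x)) X Z D := by
  obtain ⟨u', u'', a, b, d, h⟩ :=
    (mem_graph_hamiltonian_iff β _ _).mp ((hamiltonian β).mem_graph x)
  obtain ⟨Z, D, h2⟩ := h.exists_formData hε
  exact ⟨u', Z, D, h2⟩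

theorem inner_hamiltonian_sub {ε β : ℝ} (hε : 0 < ε) (hβ : β ≠ 0) {x y : (hamiltonian β).domain}
    {X Z Y W : CoeffSpace} {D E : L2Seq}
    (hx : FormData β ε (hermiteExpansion x) (hermiteExpansion (hamiltonian β x)) X Z D)
    (hy : FormData β ε (hermiteExpansion y) (hermiteExpansion (hamiltonian β y)) Y W E) :
    inner ℂ (x : L2Plane) (hamiltonian β y - ((1 / 2 - ε : ℝ) : ℂ) • (y : L2Plane)) =
      inner ℂ X Y + inner ℂ Z W + ((4 * Real.sqrt 2 / β : ℝ) : ℂ) * inner ℂ D (jacobiCLM hε E) := by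
  rw [← hx.inner_eq hε hβ hy, ← hermiteExpansion.inner_map_map, map_sub, map_smul]

/-- The form identity is Hermitian because J is symmetric and β real. It is used at ε = 1, and the
real shift 1/2 - ε drops out. -/
theorem hamiltonian_symm {β : ℝ} (hβ : β ≠ 0) (x y : (hamiltonian β).domain) :
    inner ℂ (hamiltonian β x) (y : L2Plane) = inner ℂ (x : L2Plane) (hamiltonian β y) := by
  obtain ⟨X, Z, D, hx⟩ := exists_formData_of_mem_domain one_pos x
  obtain ⟨Y, W, E, hy⟩ := exists_formData_of_mem_domain one_pos y
  have h1 := inner_hamiltonian_sub one_pos hβ hx hy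
  have h2 := congrArg (starRingEnd ℂ) (inner_hamiltonian_sub one_pos hβ hy hx)
  rw [map_add, map_add, map_mul, Complex.conj_ofReal, inner_conj_symm, inner_conj_symm,
    inner_conj_symm, inner_conj_symm, jacobiCLM_symm, ← h1, inner_sub_left, inner_sub_right,
    inner_smul_left, inner_smul_right, Complex.conj_ofReal] at h2
  exact sub_left_injective h2

end Symmetric

/-! ### Surjectivity of H_β + 3/2 -/

section Surjective

theorem one_le_quarter (n : ℕ) : 1 ≤ quarter 2 n := by
  have h := quarter_pow (ε := 2) two_pos n
  by_contra! hc
  have := pow_le_one₀ (quarter_pos two_pos n).le hc.le (n := 4)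
  have hn := Nat.cast_nonneg (α := ℝ) n
  linarith

theorem jacobiEntry_succ_eq (n : ℕ) (ε : ℝ) : jacobiEntry ε (n + 1) =
    Real.sqrt (n + 1) / (2 * quarter ε (n + 1) * quarter ε n) := by
  rw [jacobiEntry_succ, quarter, quarter]
  push_cast
  rfl

theorem le_of_pow_four_le {x y : ℝ} (hy : 0 ≤ y) (h : x ^ 4 ≤ y ^ 4) : x ≤ y :=
  le_of_not_gt fun hc => absurd h (not_le.mpr (pow_lt_pow_left₀ hc hy four_ne_zero))

/-- After fourth powers the claims are (n+1)²(n+2) ≤ (n+3)³ and (n+1)²(n+3) ≤ (n+2)³. The shift ε =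
2 makes the second one true. -/
theorem jacobiEntry_mul_quarter_le (n : ℕ) :
    jacobiEntry 2 (n + 1) * quarter 2 n ^ 2 / quarter 2 (n + 1) ^ 2 ≤ 1 / 2 ∧
      jacobiEntry 2 (n + 1) * quarter 2 (n + 1) ^ 2 / quarter 2 n ^ 2 ≤ 1 / 2 := by
  have h1 := quarter_pos (ε := 2) two_pos n
  have h2 := quarter_pos (ε := 2) two_pos (n + 1)
  have h3 := quarter_pow (ε := 2) two_pos n
  have h4 := quarter_pow (ε := 2) two_pos (n + 1)
  have hn := Nat.cast_nonneg (α := ℝ) n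
  have h5 : Real.sqrt (n + 1) ^ 4 = ((n : ℝ) + 1) ^ 2 := by
    rw [show 4 = 2 * 2 from rfl, pow_mul, Real.sq_sqrt (by positivity)]
  rw [jacobiEntry_succ_eq]
  push_cast at h4
  generalize quarter 2 n = x at *
  generalize quarter 2 (n + 1) = y at *
  generalize Real.sqrt (n + 1) = s at *
  have k1 : s * x ≤ y ^ 3 := by
    refine le_of_pow_four_le (by positivity) ?_
    rw [mul_pow, ← pow_mul, mul_comm 3 4, pow_mul, h3, h4, h5]
    nlinarith [mul_nonneg hn hn, mul_nonneg (mul_nonneg hn hn) hn]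
  have k2 : s * y ≤ x ^ 3 := by
    refine le_of_pow_four_le (by positivity) ?_
    rw [mul_pow, ← pow_mul, mul_comm 3 4, pow_mul, h3, h4, h5]
    nlinarith [mul_nonneg hn hn, mul_nonneg (mul_nonneg hn hn) hn]
  constructor
  · rw [div_mul_eq_mul_div, div_div, div_le_iff₀ (by positivity)]
    nlinarith [mul_le_mul_of_nonneg_right k1 h1.le]
  · rw [div_mul_eq_mul_div, div_div, div_le_iff₀ (by positivity)]
    nlinarith [mul_le_mul_of_nonneg_right k2 h2.le]

/-- Conjugating J(2) by (n+2)^(1/2) keeps its off-diagonal entries at most 1/2. After the factor 2√2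
the two shifts have norm at most √2 each, and β exceeds their sum. -/
theorem exists_band_solution {β : ℝ} (hβ : 2 * Real.sqrt 2 < β) (r : L2Seq) : ∃ G : L2Seq, ∀ n,
    (β : ℂ) * G n + 2 * ((Real.sqrt 2 : ℝ) : ℂ) * (quarter 2 n : ℂ) ^ 2 *
      jacobiAction 2 (fun m => G m / (quarter 2 m : ℂ) ^ 2) n = r n := by
  have h2 : 0 < Real.sqrt 2 := Real.sqrt_pos.mpr two_pos
  have hj := fun n => jacobiEntry_succ_nonneg (ε := 2) two_pos n
  let p : ℕ → ℝ := fun n =>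
    2 * Real.sqrt 2 * (jacobiEntry 2 (n + 1) * quarter 2 n ^ 2 / quarter 2 (n + 1) ^ 2)
  let p' : ℕ → ℝ := fun n =>
    2 * Real.sqrt 2 * (jacobiEntry 2 (n + 1) * quarter 2 (n + 1) ^ 2 / quarter 2 n ^ 2)
  have hp : ∀ n, ‖(p n : ℂ)‖ ≤ Real.sqrt 2 := fun n => by
    rw [Complex.norm_real, Real.norm_of_nonneg (mul_nonneg (by positivity)
      (div_nonneg (mul_nonneg (hj n) (sq_nonneg _)) (sq_nonneg _)))]
    have := mul_le_mul_of_nonneg_left (jacobiEntry_mul_quarter_le n).1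
      (by positivity : 0 ≤ 2 * Real.sqrt 2)
    exact this.trans (by linarith)
  have hp' : ∀ n, ‖if n = 0 then 0 else (p' (n - 1) : ℂ)‖ ≤ Real.sqrt 2 := fun n => by
    split_ifs
    · simp
    rw [Complex.norm_real, Real.norm_of_nonneg (mul_nonneg (by positivity)
      (div_nonneg (mul_nonneg (hj _) (sq_nonneg _)) (sq_nonneg _)))]
    have := mul_le_mul_of_nonneg_left (jacobiEntry_mul_quarter_le (n - 1)).2
      (by positivity : 0 ≤ 2 * Real.sqrt 2)
    exact this.trans (by linarith)
  obtain ⟨S, hS, hSn⟩ := exists_shift_down hp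
  obtain ⟨R, hR, hRn⟩ := exists_shift_up hp' (if_pos rfl)
  obtain ⟨G, hG⟩ := exists_add_smul_eq (S + R) (c := (β : ℂ)) (by
    rw [Complex.norm_real, Real.norm_of_nonneg (by linarith)]
    exact (norm_add_le _ _).trans_lt (by linarith)) r
  refine ⟨G, fun n => ?_⟩
  rw [← hG]
  have h3 : (S G + R G + (β : ℂ) • G : L2Seq) n = S G n + R G n + (β : ℂ) * G n := rfl
  have hq : ∀ m, (quarter 2 m : ℂ) ≠ 0 := fun m =>
    Complex.ofReal_ne_zero.mpr (quarter_pos two_pos m).ne'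
  rw [add_apply, h3, hS, hR]
  cases n with
  | zero =>
    have q0 := hq 0
    have q1 := hq 1
    simp only [p, jacobiAction, if_pos]
    push_cast
    field_simp
    ring
  | succ n =>
    have q0 := hq n
    have q1 := hq (n + 1)
    have q2 := hq (n + 1 + 1)
    simp only [p, p', jacobiAction, if_neg n.succ_ne_zero, Nat.add_sub_cancel]
    push_cast
    field_simp
    ring

/-- The coefficients of the solution of `H_β Ψ + (3/2) Ψ = F`. -/
theorem exists_coeffPair {β : ℝ} (hβ : 2 * Real.sqrt 2 < β) (F : CoeffSpace) :
    ∃ u u' u'' : CoeffSpace, ∃ a b d, CoeffPair β u (F + ((1 / 2 - 2 : ℝ) : ℂ) • u) u' u'' a b d := by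
  have hζ : ∀ n, 0 < quarter 2 n ^ 2 := fun n => pow_pos (quarter_pos two_pos n) 2
  have hζ1 : ∀ n, 1 ≤ quarter 2 n ^ 2 := fun n => one_le_pow₀ (one_le_quarter n)
  -- Solutions without jump, one for each n. Adding cₙ times an odd exponential creates the jump 2cₙ
  -- and changes the derivative at 0 from δₙ to δₙ - (n+2)^(1/2) cₙ.
  choose w w' α δ hw hw' using fun n => exists_solution (F n) (hζ n)
  have hn := fun n => norm_solution_le (hζ n) (hw n) (hw' n)
  have hF := summable_sq_norm F
  have b1 : ∀ n, ‖w n‖ ≤ ‖F n‖ := fun n =>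
    (le_mul_of_one_le_left (norm_nonneg _) (one_le_pow₀ (hζ1 n))).trans (hn n).1
  have b2 : ∀ n, ‖w' n‖ ≤ ‖F n‖ := fun n =>
    (le_mul_of_one_le_left (norm_nonneg _) (hζ1 n)).trans (hn n).2.1
  have b3 : ∀ n, ‖((quarter 2 n ^ 2 : ℝ) : ℂ) ^ 2 • w n - F n‖ ≤ 2 * ‖F n‖ := fun n => (hn n).2.2
  have b4 : ∀ n, ‖(β : ℂ) * ((quarter 2 n : ℂ) * δ n)‖ ^ 2 ≤ β ^ 2 * 5 * ‖F n‖ ^ 2 := fun n => by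
    have h1 := (hw' n).trace_le (hζ n).le
    have h2 := pow_le_pow_left₀ (norm_nonneg _) (b3 n) 2
    have h3 := pow_le_pow_left₀ (by have := hζ n; positivity) (hn n).2.1 2
    rw [norm_mul, norm_mul, mul_pow, mul_pow, Complex.norm_real, Complex.norm_real,
      Real.norm_eq_abs, Real.norm_eq_abs, sq_abs, sq_abs, mul_assoc]
    refine mul_le_mul_of_nonneg_left ?_ (sq_nonneg _)
    nlinarith [mul_nonneg (hζ n).le (sq_nonneg ‖δ n‖), sq_nonneg ‖F n‖]
  -- The jump condition multiplied by (n+2)^(1/4) is the band equation with this right side; it is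
  -- in ℓ² by the trace inequality for w'.
  let r : L2Seq := ⟨fun n => (β : ℂ) * ((quarter 2 n : ℂ) * δ n), memlp_two_iff.mpr
    (Summable.of_nonneg_of_le (fun n => sq_nonneg _) b4 (hF.mul_left _))⟩
  obtain ⟨G, hG⟩ := exists_band_solution hβ r
  have hGs := summable_sq_norm G
  -- With this power of (n+2)^(1/4), the second derivative of cₙ times the odd exponential has norm
  -- exactly |Gₙ|, so G in ℓ² gives square summability.
  let c : ℕ → ℂ := fun n => G n / (quarter 2 n : ℂ) ^ 3
  have hc : ∀ n, ‖c n‖ ^ 2 * (quarter 2 n ^ 2) ^ 3 = ‖G n‖ ^ 2 := fun n => by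
    have := quarter_pos (ε := 2) two_pos n
    simp only [c]
    rw [norm_div, norm_pow, Complex.norm_real, Real.norm_of_nonneg this.le]
    field_simp
  have hsq : ∀ {x y : L2Line} {A B C : ℝ}, ‖x‖ ≤ C * A → ‖y‖ ^ 2 ≤ B ^ 2 →
      ‖x + y‖ ^ 2 ≤ 2 * C ^ 2 * A ^ 2 + 2 * B ^ 2 := fun {x y A B C} hx hy => by
    have h1 := pow_le_pow_left₀ (norm_nonneg _) (norm_add_le x y) 2
    have h2 := pow_le_pow_left₀ (norm_nonneg _) hx 2
    nlinarith [sq_nonneg (‖x‖ - ‖y‖)]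
  have hm : ∀ (x y : ℕ → L2Line) (C : ℝ), (∀ n, ‖x n‖ ≤ C * ‖F n‖) → (∀ n, ‖y n‖ ^ 2 ≤ ‖G n‖ ^ 2) →
      Memℓp (fun n => x n + y n) 2 := fun x y C hx hy => memlp_two_iff.mpr
    (Summable.of_nonneg_of_le (fun n => sq_nonneg _) (fun n => hsq (hx n) (hy n))
      ((hF.mul_left _).add (hGs.mul_left _)))
  have m1 := hm w (fun n => c n • oddExp (hζ n)) 1 (fun n => (b1 n).trans_eq (one_mul _).symm)
    fun n => by
      rw [norm_smul, mul_pow, norm_sq_oddExp, ← hc]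
      exact mul_le_mul_of_nonneg_left ((inv_le_one_of_one_le₀ (hζ1 n)).trans
        (one_le_pow₀ (hζ1 n))) (sq_nonneg _)
  have m2 := hm w' (fun n => c n • (-((quarter 2 n ^ 2 : ℝ) : ℂ) • evenExp (hζ n))) 1
    (fun n => (b2 n).trans_eq (one_mul _).symm) fun n => by
      rw [norm_smul, norm_smul, mul_pow, mul_pow, norm_sq_evenExp, ← hc, norm_neg,
        Complex.norm_real, Real.norm_of_nonneg (hζ n).le, sq (quarter 2 n ^ 2), mul_inv_cancel_right₀ (hζ n).ne']
      exact mul_le_mul_of_nonneg_left (le_self_pow₀ (hζ1 n) three_ne_zero) (sq_nonneg _)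
  have m3 := hm (fun n => ((quarter 2 n ^ 2 : ℝ) : ℂ) ^ 2 • w n - F n)
    (fun n => c n • (-((quarter 2 n ^ 2 : ℝ) : ℂ) • (-((quarter 2 n ^ 2 : ℝ) : ℂ) •
      oddExp (hζ n)))) 2 b3 fun n => by
      rw [norm_smul, norm_smul, norm_smul, mul_pow, mul_pow, mul_pow, norm_sq_oddExp, ← hc,
        norm_neg, Complex.norm_real, Real.norm_of_nonneg (hζ n).le]
      refine le_of_eq ?_
      have := quarter_pos (ε := 2) two_pos n
      field_simp
  refine ⟨⟨_, m1⟩, ⟨_, m2⟩, ⟨_, m3⟩, fun n => α n + c n * 1, fun n => α n + c n * (-1),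
    fun n => δ n + c n * (-((quarter 2 n ^ 2 : ℝ) : ℂ) * 1), ?_, ?_, ?_, ?_⟩
  · exact fun n => (hw n).add_Lp ((halfDeriv_oddExp (hζ n)).smul_Lp (c n))
  · exact fun n => (hw' n).add_Lp (((halfDeriv_evenExp (hζ n)).smul_Lp _).smul_Lp (c n))
  · have hD : ∀ n, G n / (quarter 2 n : ℂ) ^ 2 =
        (quarter 2 n : ℂ) * ((α n + c n * 1) - (α n + c n * (-1))) / 2 := fun n => by
      have : (quarter 2 n : ℂ) ≠ 0 := Complex.ofReal_ne_zero.mpr (quarter_pos two_pos n).ne'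
      simp only [c]
      field_simp
      ring
    intro n
    refine (jump_iff (j := fun n => (α n + c n * 1) - (α n + c n * (-1)))
      (d := fun n => δ n + c n * (-((quarter 2 n ^ 2 : ℝ) : ℂ) * 1)) two_pos hD n).mpr ?_
    have h1 : _ = (β : ℂ) * ((quarter 2 n : ℂ) * δ n) := hG n
    have h2 : (quarter 2 n : ℂ) ≠ 0 := Complex.ofReal_ne_zero.mpr (quarter_pos two_pos n).ne'
    refine mul_left_cancel₀ h2 ?_
    have h3 : (quarter 2 n : ℂ) * (c n * (quarter 2 n : ℂ) ^ 2) = G n := by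
      simp only [c]
      field_simp
    push_cast
    linear_combination -h1 - (β : ℂ) * h3
  · intro n
    have hq : ((quarter 2 n : ℝ) : ℂ) ^ 4 = (n : ℂ) + 2 := by
      have := quarter_pow (ε := 2) two_pos n
      exact_mod_cast congrArg (fun r : ℝ => (r : ℂ)) this
    change F n + ((1 / 2 - 2 : ℝ) : ℂ) • (w n + c n • oddExp (hζ n)) = -(_ + _) + _ • (_ + _)
    have hn2 : ((n : ℂ) + 1 / 2) = ((quarter 2 n : ℝ) : ℂ) ^ 4 + ((1 / 2 - 2 : ℝ) : ℂ) := by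
      rw [hq]
      push_cast
      ring
    rw [hn2]
    push_cast
    module

theorem hamiltonian_surjective {β : ℝ} (hβ : 2 * Real.sqrt 2 < β) (F : L2Plane) :
    ∃ x : (hamiltonian β).domain,
      hamiltonian β x - ((1 / 2 - 2 : ℝ) : ℂ) • (x : L2Plane) = F := by
  obtain ⟨u, u', u'', a, b, d, h⟩ := exists_coeffPair hβ (hermiteExpansion F)
  have hg : (hermiteExpansion.symm u, F + ((1 / 2 - 2 : ℝ) : ℂ) • hermiteExpansion.symm u) ∈
      (hamiltonian β).graph := by
    refine (mem_graph_hamiltonian_iff β _ _).mpr ⟨u', u'', a, b, d, ?_⟩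
    rw [map_add, map_smul, hermiteExpansion.apply_symm_apply]
    exact h
  obtain ⟨x, hx, hx'⟩ := (LinearPMap.mem_graph_iff _).mp hg
  refine ⟨x, ?_⟩
  rw [hx', hx]
  exact add_sub_cancel_right _ _

end Surjective

/-! ### The symmetry of J(ε) under (-1)ⁿ -/

section SignFlip

theorem exists_signFlip (D : L2Seq) : ∃ D' : L2Seq, ∀ n, D' n = (-1) ^ n * D n := by
  refine ⟨⟨fun n => (-1) ^ n * D n, memlp_two_iff.mpr ?_⟩, fun n => rfl⟩
  simpa using summable_sq_norm D

variable {ε : ℝ} (hε : 0 < ε)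

/-- J couples only indices of opposite parity, its diagonal being zero. -/
theorem jacobiCLM_signFlip {D D' : L2Seq} (h : ∀ n, D' n = (-1) ^ n * D n) (n : ℕ) :
    jacobiCLM hε D' n = -((-1) ^ n * jacobiCLM hε D n) := by
  rw [jacobiCLM_apply, jacobiCLM_apply]
  cases n with
  | zero => simp [jacobiAction, h]
  | succ n =>
    simp only [jacobiAction, h]
    ring

theorem inner_signFlip (l : ℝ) {D D' E E' : L2Seq} (h : ∀ n, D' n = (-1) ^ n * D n)
    (h' : ∀ n, E' n = (-1) ^ n * E n) :
    inner ℂ D' ((l : ℂ) • E' - jacobiCLM hε E') = inner ℂ D ((l : ℂ) • E + jacobiCLM hε E) := by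
  refine (lp.hasSum_inner (𝕜 := ℂ) D' _).unique ?_
  convert lp.hasSum_inner (𝕜 := ℂ) D ((l : ℂ) • E + jacobiCLM hε E) using 1
  funext n
  have e1 : ((l : ℂ) • E' - jacobiCLM hε E' : L2Seq) n = (l : ℂ) * E' n - jacobiCLM hε E' n := rfl
  have e2 : ((l : ℂ) • E + jacobiCLM hε E : L2Seq) n = (l : ℂ) * E n + jacobiCLM hε E n := rfl
  have e3 : ((-1 : ℂ) ^ n) * (-1) ^ n = 1 := by rw [← mul_pow]; simp
  rw [RCLike.inner_apply, RCLike.inner_apply, e1, e2, h, h', jacobiCLM_signFlip hε h', map_mul,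
    map_pow, map_neg, map_one]
  linear_combination ((l : ℂ) * E n + jacobiCLM hε E n) * starRingEnd ℂ (D n) * e3

theorem Nplus_jacobiOperator_eq {ε : ℝ} (hε : 0 < ε) (l : ℝ) :
    Nplus l (jacobiOperator ε) = Nminus (-l) (jacobiOperator ε) := by
  have hs := exists_isSpectralMeasureOf (jacobiOperator_symm hε) _ (jacobiOperator_surjective hε)
  refine eq_of_forall_natCast_le_iff fun k => ?_
  rw [le_Nplus_iff hs, le_Nminus_iff hs]
  constructor
  · rintro ⟨v, hv⟩
    choose D' hD' using fun i => exists_signFlip (v i : L2Seq)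
    refine ⟨fun i => ⟨D' i, mem_domain_jacobiOperator hε _⟩, ?_⟩
    convert hv using 3 with i j
    rw [jacobiOperator_apply hε, jacobiOperator_apply hε]
    refine (inner_signFlip hε (-l) (hD' i) (hD' j)).trans ?_
    rw [Complex.ofReal_neg, neg_smul, neg_add_eq_sub]
  · rintro ⟨v, hv⟩
    choose D' hD' using fun i => exists_signFlip (v i : L2Seq)
    refine ⟨fun i => ⟨D' i, mem_domain_jacobiOperator hε _⟩, ?_⟩
    convert hv using 3 with i j
    rw [jacobiOperator_apply hε, jacobiOperator_apply hε]
    have := inner_signFlip hε l (hD' i) (hD' j)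
    rw [Complex.ofReal_neg, neg_smul, ← neg_add', inner_neg_right, ← this, ← inner_neg_right,
      neg_sub]

end SignFlip

/-! ### From negative directions of H_β to those of J(ε) -/

section Compare

variable {ε β : ℝ}

theorem re_neg_pos_of_forms {κ x d : ℝ} {A B : ℂ} (hκ : 0 < κ) (h : 0 < (-(A + (κ : ℂ) * B)).re)
    (hA : A = ((x : ℝ) : ℂ)) (hd : 2 * d ≤ x) : 0 < -(2 / κ) * d - B.re := by
  rw [hA, Complex.neg_re, Complex.add_re, Complex.ofReal_re, Complex.re_ofReal_mul] at h
  have h1 : 0 < -(2 * d) - κ * B.re := by linarith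
  have h2 : -(2 / κ) * d - B.re = (-(2 * d) - κ * B.re) / κ := by
    field_simp
  rw [h2]
  exact div_pos h1 hκ

theorem sum_apply_lp {E : Type*} [NormedAddCommGroup E] [Module ℂ E] [IsBoundedSMul ℂ E] {k : ℕ}
    (c : Fin k → ℂ) (v : Fin k → lp (fun _ : ℕ => E) 2) (n : ℕ) :
    (∑ i, c i • v i : lp (fun _ : ℕ => E) 2) n = ∑ i, c i • v i n := by
  rw [lp.coeFn_sum, Finset.sum_apply]
  rfl

/-- Boundary values depend linearly on the function, so the trace inequality may be applied to every
linear combination and summed over n. -/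
theorem two_mul_norm_sum_sq_le {k : ℕ} {u f X Z : Fin k → CoeffSpace} {D : Fin k → L2Seq}
    (h : ∀ i, FormData β ε (u i) (f i) (X i) (Z i) (D i)) (c : Fin k → ℂ) :
    2 * ‖∑ i, c i • D i‖ ^ 2 ≤ ‖∑ i, c i • X i‖ ^ 2 + ‖∑ i, c i • Z i‖ ^ 2 := by
  choose u'' a b d hu hD using fun i => (h i).exists_coeffPair
  refine hasSum_le (fun n => ?_) ((hasSum_sq_norm _).mul_left 2)
    ((hasSum_sq_norm (∑ i, c i • X i)).add (hasSum_sq_norm (∑ i, c i • Z i)))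
  rw [sum_apply_lp, sum_apply_lp, sum_apply_lp]
  refine norm_jump_sq_le (ε := ε) n (HalfDeriv.sum_Lp Finset.univ fun i =>
    ((hu i).halfDeriv n).smul_Lp (c i)) ?_ ?_
  · rw [Finset.smul_sum]
    exact Finset.sum_congr rfl fun i _ => by rw [(h i).eq n, smul_comm]
  · rw [← Finset.sum_sub_distrib, Finset.mul_sum, Finset.sum_div]
    refine Finset.sum_congr rfl fun i _ => ?_
    rw [hD, smul_eq_mul]
    ring

/-- Replacing the energy by its lower bound 2‖D‖² can only help positivity of the negated form.
Linear independence of the D is not needed separately, as positivity contains it. -/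
theorem isPositiveForm_jacobi_of_hamiltonian (hε : 0 < ε) (hβ : 0 < β) {k : ℕ}
    {v : Fin k → (hamiltonian β).domain} (hv : IsPositiveForm fun i j => inner ℂ (v i : L2Plane)
      (((1 / 2 - ε : ℝ) : ℂ) • (v j : L2Plane) - hamiltonian β (v j))) :
    ∃ D : Fin k → L2Seq, IsPositiveForm fun i j => inner ℂ (D i)
      (((-(β / (2 * Real.sqrt 2)) : ℝ) : ℂ) • D j - jacobiCLM hε (D j)) := by
  choose X Z D h using fun i => exists_formData_of_mem_domain hε (v i)
  refine ⟨D, fun c hc => ?_⟩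
  have e1 : ∀ i j, inner ℂ (v i : L2Plane)
      (((1 / 2 - ε : ℝ) : ℂ) • (v j : L2Plane) - hamiltonian β (v j)) =
      -((inner ℂ (X i) (X j) + inner ℂ (Z i) (Z j)) +
        ((4 * Real.sqrt 2 / β : ℝ) : ℂ) * inner ℂ (D i) (jacobiCLM hε (D j))) := fun i j => by
    rw [← neg_sub, inner_neg_right, inner_hamiltonian_sub hε hβ.ne' (h i) (h j)]
  have e2 : ∑ i, ∑ j, starRingEnd ℂ (c i) * c j * inner ℂ (v i : L2Plane)
      (((1 / 2 - ε : ℝ) : ℂ) • (v j : L2Plane) - hamiltonian β (v j)) =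
      -((inner ℂ (∑ i, c i • X i) (∑ i, c i • X i) + inner ℂ (∑ i, c i • Z i) (∑ i, c i • Z i)) +
        ((4 * Real.sqrt 2 / β : ℝ) : ℂ) *
          inner ℂ (∑ i, c i • D i) (∑ i, c i • jacobiCLM hε (D i))) := by
    rw [← sum_form, ← sum_form, ← sum_form]
    simp only [e1, Finset.mul_sum, ← Finset.sum_add_distrib, ← Finset.sum_neg_distrib]
    refine Finset.sum_congr rfl fun i _ => Finset.sum_congr rfl fun j _ => ?_
    ring
  have h3 := hv c hc
  rw [e2] at h3
  have h4 := re_neg_pos_of_forms (by positivity) h3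
    (x := ‖∑ i, c i • X i‖ ^ 2 + ‖∑ i, c i • Z i‖ ^ 2)
    (by rw [inner_self_ofReal, inner_self_ofReal]; push_cast; rfl) (two_mul_norm_sum_sq_le h c)
  rw [sum_form]
  have e3 : ∑ j, c j • (((-(β / (2 * Real.sqrt 2)) : ℝ) : ℂ) • D j - jacobiCLM hε (D j)) =
      ((-(β / (2 * Real.sqrt 2)) : ℝ) : ℂ) • ∑ i, c i • D i - ∑ i, c i • jacobiCLM hε (D i) := by
    rw [Finset.smul_sum, ← Finset.sum_sub_distrib]
    exact Finset.sum_congr rfl fun i _ => by rw [smul_sub, smul_comm]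
  rw [e3, inner_sub_right, inner_smul_right, inner_self_ofReal, Complex.sub_re,
    Complex.re_ofReal_mul, Complex.ofReal_re]
  -- The threshold μ arises as the ratio of the constants 2 and 4√2/β in the form.
  have e4 : 2 / (4 * Real.sqrt 2 / β) = β / (2 * Real.sqrt 2) := by
    field_simp
    norm_num
  rw [← e4]
  exact h4

end Compare

/-! ### Truncations and correctors of the derivative at the origin -/

section Trial

/-- The element of `⨁ L²(ℝ)` with components `x n` for `n < N`. -/
noncomputable def truncate {E : Type*} [NormedAddCommGroup E] (N : ℕ) (x : ℕ → E) :
    lp (fun _ : ℕ => E) 2 :=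
  ∑ n ∈ Finset.range N, lp.single 2 n (x n)

theorem truncate_apply {E : Type*} [NormedAddCommGroup E] {N : ℕ} {x : ℕ → E}
    (h : ∀ n, N ≤ n → x n = 0) (n : ℕ) : truncate N x n = x n := by
  rw [truncate, lp.coeFn_sum, Finset.sum_apply]
  simp only [lp.coeFn_single, Finset.sum_pi_single, Finset.mem_range]
  split_ifs with hn
  · rfl
  · exact (h n (not_lt.mp hn)).symm

theorem truncate_apply_of_le {E : Type*} [NormedAddCommGroup E] {N : ℕ} (x : ℕ → E) {n : ℕ}
    (h : N ≤ n) : truncate N x n = 0 := by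
  rw [truncate, lp.coeFn_sum, Finset.sum_apply]
  simp only [lp.coeFn_single, Finset.sum_pi_single, Finset.mem_range]
  rw [if_neg (not_lt.mpr h)]

theorem tendsto_truncate {E : Type*} [NormedAddCommGroup E] (N : ℕ) {x : ℕ → ℕ → E} {y : ℕ → E}
    (h : ∀ n, Tendsto (fun m => x m n) atTop (𝓝 (y n))) :
    Tendsto (fun m => truncate N (x m)) atTop (𝓝 (truncate N y)) :=
  tendsto_finsetSum _ fun n _ =>
    ((lp.isometry_single (E := fun _ : ℕ => E) (p := 2) n).continuous.tendsto _).comp (h n)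

theorem tendsto_truncate_self {E : Type*} [NormedAddCommGroup E] (v : lp (fun _ : ℕ => E) 2) :
    Tendsto (fun N => truncate N v) atTop (𝓝 v) :=
  (lp.hasSum_single (by simp) v).tendsto_sum_nat

/-- Take x exp(-(m+1)|x|): it vanishes at 0 with slope 1 on both sides, while its norm and that of
its derivative tend to 0. So dₙ can be prescribed at negligible energy. -/
theorem exists_corrector : ∃ W W' W'' : ℕ → L2Line,
    (∀ m, HalfDeriv (W m) (W' m) 0 0 ∧ HalfDeriv (W' m) (W'' m) 1 1) ∧
      Tendsto W atTop (𝓝 0) ∧ Tendsto W' atTop (𝓝 0) := by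
  have hk : ∀ m : ℕ, (0 : ℝ) < m + 1 := fun m => by positivity
  have hlim : ∀ M : ℝ, Tendsto (fun m : ℕ => M ^ 2 * (2 / ((m : ℝ) + 1))) atTop (𝓝 0) := fun M => by
    have := (tendsto_one_div_add_atTop_nhds_zero_nat (𝕜 := ℝ)).const_mul (M ^ 2 * 2)
    rw [mul_zero] at this
    refine this.congr fun m => ?_
    ring
  have htend : ∀ (F : ℕ → L2Line) (M : ℝ), (∀ m, ‖F m‖ ^ 2 ≤ M ^ 2 * (2 / ((m : ℝ) + 1))) →
      Tendsto F atTop (𝓝 0) := fun F M hF => by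
    have h1 := squeeze_zero (fun m => sq_nonneg ‖F m‖) hF (hlim M)
    rw [tendsto_zero_iff_norm_tendsto_zero]
    have h2 := (Real.continuous_sqrt.tendsto 0).comp h1
    rw [Real.sqrt_zero] at h2
    exact h2.congr fun m => Real.sqrt_sq (norm_nonneg _)
  have h1 := fun m => halfDeriv_expLp (hk m) 0 1 0 1
  have h2 := fun m : ℕ => halfDeriv_expLp (hk m) (1 - ((m + 1 : ℝ) : ℂ) * 0)
    (-((m + 1 : ℝ) : ℂ) * 1) (1 + ((m + 1 : ℝ) : ℂ) * 0) (((m + 1 : ℝ) : ℂ) * 1)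
  have e1 : ∀ m : ℕ, (1 : ℂ) - ((m + 1 : ℝ) : ℂ) * 0 = 1 := fun m => by ring
  have e2 : ∀ m : ℕ, (1 : ℂ) + ((m + 1 : ℝ) : ℂ) * 0 = 1 := fun m => by ring
  simp only [e1, e2] at h1 h2
  -- With k = m + 1, the constants 2 and 3 bound 2/k and 1 + k · (2/k).
  refine ⟨_, _, _, fun m => ⟨h1 m, h2 m⟩, htend _ 2 fun m => ?_, htend _ 3 fun m => ?_⟩
  · have : 2 / ((m : ℝ) + 1) ≤ 2 := by
      rw [div_le_iff₀ (hk m)]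
      linarith [Nat.cast_nonneg (α := ℝ) m]
    refine norm_expLp_le (hk m) ?_ ?_ <;> simpa using this
  · have h3 : ‖((m + 1 : ℝ) : ℂ)‖ = m + 1 := by
      rw [Complex.norm_real, Real.norm_of_nonneg (hk m).le]
    have h4 : (1 : ℝ) + (m + 1) * (2 / (m + 1)) ≤ 3 := by
      rw [mul_div_cancel₀ _ (hk m).ne']
      norm_num
    refine norm_expLp_le (hk m) ?_ ?_
    · rw [mul_one, norm_one, norm_neg, h3]
      exact h4
    · rw [mul_one, norm_one, h3]
      exact h4

end Trial

/-! ### Optimal trial functions and negative directions of H_β -/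

section Trial

variable {ε : ℝ}

/-- The components of `u'` for the optimal trial function with vector of jumps `D`. -/
noncomputable def trialDeriv (hε : 0 < ε) (D : L2Seq) (n : ℕ) : L2Line :=
  (D n / (quarter ε n : ℂ)) • (-((quarter ε n ^ 2 : ℝ) : ℂ) •
    evenExp (pow_pos (quarter_pos hε n) 2))

/-- The components of `(n + ε)^(1/2) u` for the optimal trial function with vector of jumps `D`. -/
noncomputable def trialWeighted (hε : 0 < ε) (D : L2Seq) (n : ℕ) : L2Line :=
  ((quarter ε n ^ 2 : ℝ) : ℂ) • ((D n / (quarter ε n : ℂ)) •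
    oddExp (pow_pos (quarter_pos hε n) 2))

theorem inner_trial (hε : 0 < ε) (D E : L2Seq) (n : ℕ) :
    inner ℂ (trialDeriv hε D n) (trialDeriv hε E n) = inner ℂ (D n) (E n) ∧
      inner ℂ (trialWeighted hε D n) (trialWeighted hε E n) = inner ℂ (D n) (E n) := by
  have h0 := quarter_pos hε n
  have hq : (quarter ε n : ℂ) ≠ 0 := Complex.ofReal_ne_zero.mpr h0.ne'
  constructor
  · simp only [trialDeriv, inner_smul_left, inner_smul_right]
    rw [inner_self_ofReal, norm_sq_evenExp, RCLike.inner_apply, map_div₀, map_neg,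
      Complex.conj_ofReal, Complex.conj_ofReal]
    push_cast
    field_simp
  · simp only [trialWeighted, inner_smul_left, inner_smul_right]
    rw [inner_self_ofReal, norm_sq_oddExp, RCLike.inner_apply, map_div₀,
      Complex.conj_ofReal, Complex.conj_ofReal]
    push_cast
    field_simp

/-- Equality case of the trace inequality: the derivative part and the weighted part each contribute
⟪D, E⟫. -/
theorem inner_truncate_trial (hε : 0 < ε) {N : ℕ} {D E : L2Seq} (hD : ∀ n, N ≤ n → D n = 0) :
    inner ℂ (truncate N (trialDeriv hε D)) (truncate N (trialDeriv hε E)) +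
      inner ℂ (truncate N (trialWeighted hε D)) (truncate N (trialWeighted hε E)) =
        2 * inner ℂ D E := by
  rw [two_mul]
  refine ((lp.hasSum_inner (𝕜 := ℂ) _ _).add (lp.hasSum_inner (𝕜 := ℂ) _ _)).unique ?_
  convert (lp.hasSum_inner (𝕜 := ℂ) D E).add (lp.hasSum_inner (𝕜 := ℂ) D E) using 1
  funext n
  rcases lt_or_ge n N with hn | hn
  · have e : ∀ x : ℕ → L2Line, truncate N x n = x n := fun x => by
      rw [truncate, lp.coeFn_sum, Finset.sum_apply]
      simp only [lp.coeFn_single, Finset.sum_pi_single, Finset.mem_range]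
      rw [if_pos hn]
    rw [e, e, e, e, (inner_trial hε D E n).1, (inner_trial hε D E n).2]
  · rw [truncate_apply_of_le _ hn, truncate_apply_of_le (trialWeighted hε D) hn, hD n hn, inner_zero_left,
      inner_zero_left, inner_zero_left]

/-- The optimal exponentials carry the jumps D, and multiples of the corrector enforce the condition
on the derivative without changing the jumps. The cutoff is N + 1 because J spreads the support of D
by one index. -/
theorem exists_trial (hε : 0 < ε) {β : ℝ} (hβ : β ≠ 0) {N : ℕ} {D : L2Seq}
    (hD : ∀ n, N ≤ n → D n = 0) : ∃ u f X Z : ℕ → CoeffSpace,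
      (∀ m, FormData β ε (u m) (f m) (X m) (Z m) D) ∧
      Tendsto X atTop (𝓝 (truncate (N + 1) (trialDeriv hε D))) ∧
      Tendsto Z atTop (𝓝 (truncate (N + 1) (trialWeighted hε D))) := by
  obtain ⟨W, W', W'', hW, hW0, hW0'⟩ := exists_corrector
  have hζ : ∀ n, 0 < quarter ε n ^ 2 := fun n => pow_pos (quarter_pos hε n) 2
  have hq : ∀ n, (quarter ε n : ℂ) ≠ 0 := fun n =>
    Complex.ofReal_ne_zero.mpr (quarter_pos hε n).ne'
  have hβ' : (β : ℂ) ≠ 0 := Complex.ofReal_ne_zero.mpr hβ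
  let c : ℕ → ℂ := fun n => D n / (quarter ε n : ℂ)
  -- The derivative required by the jump condition minus the derivative -(n+ε)^(1/2) cₙ already
  -- supplied by the exponential.
  let δ : ℕ → ℂ := fun n => 2 * ((Real.sqrt 2 : ℝ) : ℂ) * (quarter ε n : ℂ) *
    jacobiAction ε D n / β + (quarter ε n : ℂ) ^ 2 * c n
  have hc : ∀ n, N + 1 ≤ n → c n = 0 := fun n hn => by
    simp only [c]
    rw [hD n (by omega), zero_div]
  have hδ : ∀ n, N + 1 ≤ n → δ n = 0 := fun n hn => by
    obtain ⟨n, rfl⟩ : ∃ k, n = k + 1 := ⟨n - 1, by omega⟩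
    simp only [δ, jacobiAction]
    rw [hc _ hn, hD n (by omega), hD (n + 2) (by omega)]
    simp
  let u : ℕ → ℕ → L2Line := fun m n => c n • oddExp (hζ n) + δ n • W m
  let X : ℕ → ℕ → L2Line := fun m n =>
    c n • (-((quarter ε n ^ 2 : ℝ) : ℂ) • evenExp (hζ n)) + δ n • W' m
  let U : ℕ → ℕ → L2Line := fun m n =>
    c n • (-((quarter ε n ^ 2 : ℝ) : ℂ) • (-((quarter ε n ^ 2 : ℝ) : ℂ) • oddExp (hζ n))) +
      δ n • W'' m
  let f : ℕ → ℕ → L2Line := fun m n => -U m n + ((n : ℂ) + 1 / 2) • u m n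
  let Z : ℕ → ℕ → L2Line := fun m n => ((quarter ε n ^ 2 : ℝ) : ℂ) • u m n
  have zu : ∀ m n, N + 1 ≤ n → u m n = 0 := fun m n hn => by
    simp only [u]
    rw [hc n hn, hδ n hn, zero_smul, zero_smul, add_zero]
  have zX : ∀ m n, N + 1 ≤ n → X m n = 0 := fun m n hn => by
    simp only [X]
    rw [hc n hn, hδ n hn, zero_smul, zero_smul, add_zero]
  have zU : ∀ m n, N + 1 ≤ n → U m n = 0 := fun m n hn => by
    simp only [U]
    rw [hc n hn, hδ n hn, zero_smul, zero_smul, add_zero]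
  have zf : ∀ m n, N + 1 ≤ n → f m n = 0 := fun m n hn => by
    simp only [f]
    rw [zU m n hn, zu m n hn, smul_zero, neg_zero, add_zero]
  have zZ : ∀ m n, N + 1 ≤ n → Z m n = 0 := fun m n hn => by
    simp only [Z]
    rw [zu m n hn, smul_zero]
  have hDq : ∀ n, D n = (quarter ε n : ℂ) * ((c n * 1 + δ n * 0) - (c n * (-1) + δ n * 0)) / 2 :=
    fun n => by
      have := hq n
      simp only [c]
      field_simp
      ring
  refine ⟨fun m => truncate (N + 1) (u m), fun m => truncate (N + 1) (f m),
    fun m => truncate (N + 1) (X m), fun m => truncate (N + 1) (Z m), fun m => ⟨⟨truncate (N + 1)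
    (U m), fun n => c n * 1 + δ n * 0, fun n => c n * (-1) + δ n * 0,
    fun n => c n * (-((quarter ε n ^ 2 : ℝ) : ℂ) * 1) + δ n * 1, ⟨fun n => ?_, fun n => ?_,
      fun n => ?_, fun n => ?_⟩, hDq⟩, fun n => ?_⟩, tendsto_truncate _ fun n => ?_,
    tendsto_truncate _ fun n => ?_⟩
  · rw [truncate_apply (zu m), truncate_apply (zX m)]
    exact ((halfDeriv_oddExp (hζ n)).smul_Lp (c n)).add_Lp ((hW m).1.smul_Lp (δ n))
  · rw [truncate_apply (zX m), truncate_apply (zU m)]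
    exact (((halfDeriv_evenExp (hζ n)).smul_Lp _).smul_Lp (c n)).add_Lp ((hW m).2.smul_Lp (δ n))
  · refine (jump_iff (j := fun n => (c n * 1 + δ n * 0) - (c n * (-1) + δ n * 0))
      (d := fun n => c n * (-((quarter ε n ^ 2 : ℝ) : ℂ) * 1) + δ n * 1) hε hDq n).mpr ?_
    simp only [δ]
    push_cast
    field_simp
    ring
  · rw [truncate_apply (zu m), truncate_apply (zU m), truncate_apply (zf m)]
  · rw [truncate_apply (zu m), truncate_apply (zZ m)]
  · have := ((hW0'.const_smul (δ n)).const_add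
      (c n • (-((quarter ε n ^ 2 : ℝ) : ℂ) • evenExp (hζ n))))
    rw [smul_zero, add_zero] at this
    exact this
  · have := ((hW0.const_smul (δ n)).const_add (c n • oddExp (hζ n))).const_smul
      ((quarter ε n ^ 2 : ℝ) : ℂ)
    rw [smul_zero, add_zero] at this
    exact this

theorem FormData.exists_mem_domain {β : ℝ} {u f X Z : CoeffSpace} {D : L2Seq}
    (h : FormData β ε u f X Z D) : ∃ x : (hamiltonian β).domain,
      FormData β ε (hermiteExpansion x) (hermiteExpansion (hamiltonian β x)) X Z D := by
  obtain ⟨⟨u'', a, b, d, hu, hD⟩, hZ⟩ := h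
  have hg : (hermiteExpansion.symm u, hermiteExpansion.symm f) ∈ (hamiltonian β).graph := by
    refine (mem_graph_hamiltonian_iff β _ _).mpr ⟨X, u'', a, b, d, ?_⟩
    rwa [hermiteExpansion.apply_symm_apply, hermiteExpansion.apply_symm_apply]
  obtain ⟨x, hx, hx'⟩ := (LinearPMap.mem_graph_iff _).mp hg
  have e1 : (x : L2Plane) = hermiteExpansion.symm u := hx
  have e2 : hamiltonian β x = hermiteExpansion.symm f := hx'
  refine ⟨x, ?_⟩
  rw [e1, e2, hermiteExpansion.apply_symm_apply, hermiteExpansion.apply_symm_apply]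
  exact ⟨⟨u'', a, b, d, hu, hD⟩, hZ⟩

theorem IsPositiveForm.smul {k : ℕ} {M : Fin k → Fin k → ℂ} (h : IsPositiveForm M) {r : ℝ}
    (hr : 0 < r) : IsPositiveForm fun i j => (r : ℂ) * M i j := by
  intro c hc
  have e : ∑ i, ∑ j, starRingEnd ℂ (c i) * c j * ((r : ℂ) * M i j) =
      (r : ℂ) * ∑ i, ∑ j, starRingEnd ℂ (c i) * c j * M i j := by
    simp only [Finset.mul_sum]
    exact Finset.sum_congr rfl fun i _ => Finset.sum_congr rfl fun j _ => by ring
  rw [e, Complex.re_ofReal_mul]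
  exact mul_pos hr (h c hc)

/-- Strict positivity survives truncation of the D to finite support, and then replacement of the
optimal functions by nearby elements of the domain. -/
theorem isPositiveForm_hamiltonian_of_jacobi (hε : 0 < ε) {β : ℝ} (hβ : 0 < β) {k : ℕ}
    {D : Fin k → L2Seq} (hD : IsPositiveForm fun i j => inner ℂ (D i)
      (((-(β / (2 * Real.sqrt 2)) : ℝ) : ℂ) • D j - jacobiCLM hε (D j))) :
    ∃ v : Fin k → (hamiltonian β).domain, IsPositiveForm fun i j => inner ℂ (v i : L2Plane)
      (((1 / 2 - ε : ℝ) : ℂ) • (v j : L2Plane) - hamiltonian β (v j)) := by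
  obtain ⟨N, hN⟩ := (hD.eventually (N := fun N i j => inner ℂ (truncate N (D i))
      (((-(β / (2 * Real.sqrt 2)) : ℝ) : ℂ) • truncate N (D j) -
        jacobiCLM hε (truncate N (D j)))) fun i j =>
    (tendsto_truncate_self (D i)).inner (((tendsto_truncate_self (D j)).const_smul _).sub
      (((jacobiCLM hε).continuous.tendsto _).comp (tendsto_truncate_self (D j))))).exists
  set E : Fin k → L2Seq := fun i => truncate N (D i)
  have hE : ∀ i n, N ≤ n → E i n = 0 := fun i n hn => truncate_apply_of_le _ hn
  choose u f X Z hF hX hZ using fun i => exists_trial hε hβ.ne' (hE i)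
  choose v hv using fun i m => (hF i m).exists_mem_domain
  -- Multiplied by 4√2/β, the Jacobi form is exactly the limit of the forms of H_β on the trial
  -- functions.
  have hlim := (hN.smul (r := 4 * Real.sqrt 2 / β) (by positivity)).eventually
    (N := fun m i j => inner ℂ (v i m : L2Plane)
      (((1 / 2 - ε : ℝ) : ℂ) • (v j m : L2Plane) - hamiltonian β (v j m))) fun i j => by
    have e1 : ∀ m, inner ℂ (v i m : L2Plane)
        (((1 / 2 - ε : ℝ) : ℂ) • (v j m : L2Plane) - hamiltonian β (v j m)) =
        -((inner ℂ (X i m) (X j m) + inner ℂ (Z i m) (Z j m)) +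
          ((4 * Real.sqrt 2 / β : ℝ) : ℂ) * inner ℂ (E i) (jacobiCLM hε (E j))) := fun m => by
      rw [← neg_sub, inner_neg_right, inner_hamiltonian_sub hε hβ.ne' (hv i m) (hv j m)]
    simp only [e1]
    have h3 := ((((hX i).inner (𝕜 := ℂ) (hX j)).add ((hZ i).inner (𝕜 := ℂ) (hZ j))).add_const
      (((4 * Real.sqrt 2 / β : ℝ) : ℂ) * inner ℂ (E i) (jacobiCLM hε (E j)))).neg
    rw [inner_truncate_trial hε fun n hn => hE i n (by omega)] at h3
    convert h3 using 2
    have e2 : (4 * Real.sqrt 2 / β) * -(β / (2 * Real.sqrt 2)) = -2 := by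
      field_simp
      norm_num
    have e3 : ((4 * Real.sqrt 2 / β : ℝ) : ℂ) * ((-(β / (2 * Real.sqrt 2)) : ℝ) : ℂ) = -2 := by
      exact_mod_cast congrArg (fun r : ℝ => (r : ℂ)) e2
    change _ * inner ℂ (E i) (_ • E j - jacobiCLM hε (E j)) = _
    rw [inner_sub_right, inner_smul_right, mul_sub, ← mul_assoc, e3]
    ring
  obtain ⟨m, hm⟩ := hlim.exists
  exact ⟨fun i => v i m, hm⟩

end Trial

/-! ### Equality of the counting functions -/

section Main

theorem Nminus_hamiltonian_eq {β ε : ℝ} (hβ : 2 * Real.sqrt 2 < β) (hε : 0 < ε) :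
    Nminus (1 / 2 - ε) (hamiltonian β) = Nminus (-(β / (2 * Real.sqrt 2))) (jacobiOperator ε) := by
  have hβ0 : 0 < β := lt_of_le_of_lt (by positivity) hβ
  have hH := exists_isSpectralMeasureOf (hamiltonian_symm hβ0.ne') _ (hamiltonian_surjective hβ)
  have hJ := exists_isSpectralMeasureOf (jacobiOperator_symm hε) _ (jacobiOperator_surjective hε)
  refine eq_of_forall_natCast_le_iff fun k => ?_
  rw [le_Nminus_iff hH, le_Nminus_iff hJ]
  constructor
  · rintro ⟨v, hv⟩
    obtain ⟨D, hD⟩ := isPositiveForm_jacobi_of_hamiltonian hε hβ0 hv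
    refine ⟨fun i => ⟨D i, mem_domain_jacobiOperator hε _⟩, ?_⟩
    simpa only [jacobiOperator_apply hε] using hD
  · rintro ⟨v, hv⟩
    simp only [jacobiOperator_apply hε] at hv
    exact isPositiveForm_hamiltonian_of_jacobi hε hβ0 hv

end Main

end SmilanskySolomyak

theorem theorem8 (β ε : ℝ) (hβ : 2 * Real.sqrt 2 < β) (hε₀ : 0 < ε) (hε₁ : ε < 1 / 2) :
    IsSelfAdjoint (SmilanskySolomyak.hamiltonian β) ∧
    IsSelfAdjoint (SmilanskySolomyak.jacobiOperator ε) ∧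
    SmilanskySolomyak.Nminus (1 / 2 - ε) (SmilanskySolomyak.hamiltonian β) =
      SmilanskySolomyak.Nplus (β / (2 * Real.sqrt 2)) (SmilanskySolomyak.jacobiOperator ε) ∧
    SmilanskySolomyak.Nplus (β / (2 * Real.sqrt 2)) (SmilanskySolomyak.jacobiOperator ε) =
      SmilanskySolomyak.Nminus (-(β / (2 * Real.sqrt 2))) (SmilanskySolomyak.jacobiOperator ε) := by
  have hβ0 : 0 < β := lt_of_le_of_lt (by positivity) hβ
  have h := SmilanskySolomyak.Nplus_jacobiOperator_eq hε₀ (β / (2 * Real.sqrt 2))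
  exact ⟨SmilanskySolomyak.isSelfAdjoint_of_surjective (SmilanskySolomyak.hamiltonian_symm hβ0.ne') _
      (SmilanskySolomyak.hamiltonian_surjective hβ),
    SmilanskySolomyak.isSelfAdjoint_of_surjective (SmilanskySolomyak.jacobiOperator_symm hε₀) _
      (SmilanskySolomyak.jacobiOperator_surjective hε₀),
    (SmilanskySolomyak.Nminus_hamiltonian_eq hβ hε₀).trans h.symm, h⟩
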